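/- Let $R>0$ and $B_R=\{x\in\mathbb R^3:|x|<R\}$. For $\sigma>0$, $k>0$ and a real-valued $f\in L^2(\mathbb R^3)$ with compact support contained in $B_R$, let $u(\cdot,k)$ be the (unique) solution in the sense of tempered distributions, identified with its continuous representative, of the damped biharmonic plate equation $$\Delta^2u-k^2u-\mathrm i k\sigma u=f\quad\text{in }\mathbb R^3 ,$$ put $\kappa=(k^2+\mathrm i k\sigma)^{1/4}$ with $\Re\kappa>0$, $\Im\kappa>0$, and $$\|u(\cdot,k)\|_{\partial B_R}^2=\int_{\partial B_R}\Big((k^4+k^2)|u|^2+k^2|\nabla u|^2+(k^2+1)|\Delta u|^2+|\nabla\Delta u|^2\Big)\,\mathrm ds .$$ There is a constant $C>0$ depending only on $R$ such that for every $\sigma>0$ there are constants $d>0$, $0<\delta<K$ and a function $\mu:(K,\infty)\to\mathbb R$, all independent of $f$ and $Q$, with $$\mu(k)\ \ge\ \frac{64ad}{3\pi^2(a^2+4d^2)}\,e^{\frac{\pi}{2d}\left(\frac a2-k\right)}\qquad (k>K),\qquad a=K-\delta,$$ such that, for every $Q\ge 1$ and every real-valued $f\in L^2(\mathbb R^3)$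 with compact support in $B_R$ and $\|f\|_{L^2(B_R)}\le Q$, $$|I(k)|\ \le\ C\,Q^2e^{4R(\sigma+2)|\kappa|}\,\epsilon_1^{2\mu(k)}\qquad\text{for all }k>K,$$ where $I(k)=\int_\delta^k\|u(\cdot,\omega)\|^2_{\partial B_R}\,\mathrm d\omega$ and $\epsilon_1\ge0$ is given by $\epsilon_1^2=\int_\delta^K\|u(\cdot,\omega)\|^2_{\partial B_R}\,\mathrm d\omega$. -/

import Mathlib

open MeasureTheory Laplacian
open scoped SchwartzMap

/-- The Euclidean space `ℝ³`. -/
abbrev Space3 : Type := EuclideanSpace ℝ (Fin 3)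

/-- The complex number `k² + i k σ`. -/
noncomputable def plateSymbol (σ k : ℝ) : ℂ :=
  (k : ℂ) ^ 2 + Complex.I * (k : ℂ) * (σ : ℂ)

/-- The complex wavenumber `κ = (k² + i k σ)^{1/4}`. For `k, σ > 0` the principal branch is the root
with `Re κ > 0` and `Im κ > 0`. -/
noncomputable def plateKappa (σ k : ℝ) : ℂ :=
  plateSymbol σ k ^ (1 / 4 : ℂ)

/-- `u` is the (continuous representative of the) tempered distribution solving
`Δ² u - k² u - i k σ u = f` in `ℝ³`. -/
structure IsPlateSolution (σ k : ℝ) (f : Space3 → ℝ) (u : Space3 → ℂ) : Prop where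
  continuous : Continuous u
  integrable : ∀ φ : 𝓢(Space3, ℂ), Integrable (fun x => φ x * u x)
  equation : ∃ T : 𝓢'(Space3, ℂ),
    (∀ φ : 𝓢(Space3, ℂ), T φ = ∫ x, φ x * u x) ∧
    ∀ φ : 𝓢(Space3, ℂ), (Δ (Δ T) - plateSymbol σ k • T) φ = ∫ x, φ x * (f x : ℂ)

/-- The squared length `|∇ v (x)|² = ∑ⱼ |∂ⱼ v (x)|²` of the gradient of a complex-valued function. -/
noncomputable def gradSq (v : Space3 → ℂ) (x : Space3) : ℝ :=
  ∑ j : Fin 3, ‖fderiv ℝ v x (EuclideanSpace.single j (1 : ℝ))‖ ^ 2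

/-- The surface integral `∫_{∂B_R} g ds`, written as an integral over the unit sphere against its
surface measure `volume.toSphere`. -/
noncomputable def sphereIntegral (R : ℝ) (g : Space3 → ℝ) : ℝ :=
  R ^ 2 * ∫ y : Metric.sphere (0 : Space3) 1, g (R • (y : Space3)) ∂(volume : Measure Space3).toSphere

/-- The squared boundary norm
`∫_{∂B_R} ((k⁴ + k²)|u|² + k²|∇u|² + (k² + 1)|Δu|² + |∇Δu|²) ds`. -/
noncomputable def boundaryNormSq (R k : ℝ) (u : Space3 → ℂ) : ℝ :=
  sphereIntegral R fun x =>
    (k ^ 4 + k ^ 2) * ‖u x‖ ^ 2 + k ^ 2 * gradSq u x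
      + (k ^ 2 + 1) * ‖(Δ u) x‖ ^ 2 + gradSq (Δ u) x

/-- `I(k) = ∫_δ^k ‖u(·, ω)‖²_{∂B_R} dω`; the first argument of `u` is the wavenumber. -/
noncomputable def dataIntegral (R δ : ℝ) (u : ℝ → Space3 → ℂ) (k : ℝ) : ℝ :=
  ∫ ω in δ..k, boundaryNormSq R ω (u ω)

/-! The squared boundary norm, as a function of the wavenumber, is the restriction to the real axis
of a function holomorphic in a half-strip. Smallness of its integral over a bounded interval
therefore propagates to every larger wavenumber, at a rate governed by harmonic measure.

Off the support of `f` the solution is the potential of `f` with kernel `(e^{iκr} - e^{-κr}) /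
(8πκ²r)` (`plateSolution_eq`), where `κ⁴ = z (z + iσ)`. Damping is what gives room in the complex
plane: the imaginary part `Re z (2 Im z + σ)` of `κ⁴` is positive for `Re z > 1`, `|Im z| < σ/2`, so
the principal fourth root is holomorphic there with positive real and imaginary parts. Both
exponentials then have modulus at most 1, and the kernels of `u`, `∇u`, `Δu`, `∇Δu` grow only
polynomially in `z`. The half-strip is invariant under conjugation, so `|P(k)|²` extends
holomorphically as `P(z)` times the conjugate of `P` at the conjugate of `z`; this defines
`boundaryForm`.

The constant may depend only on `R`, not on the distance from the support of `f` to the sphere. That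
distance enters only the proofs of smoothness and holomorphy; the size of `boundaryForm` comes from
a trace estimate for potentials with an `|x-y|⁻²` singularity (`exists_lintegral_sphere_riesz_le`).

The primitive of `boundaryForm` from 2, divided by `M (1+z)⁷`, is at most 1 in the half-strip and at
most `ε₁²` on `[2, 2+σ/2]`. Two explicit comparison functions, a quadratic polynomial on triangles
over that interval and an exponential on the half-strip beyond it, give the exponent `1/4 ·
exp(-(4π/σ)(k - 2 - σ/4))` (`integral_le_rpow_of_holomorphic`). With `d = σ/16` the prescribed lower
bound for `μ` decays twice as fast and so lies below it, and the factor `e^{4R(σ+2)|κ|}` absorbs the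
polynomial growth. -/

/-! ### Quantitative unique continuation in a half-strip -/

/-- Two-constants estimate: a majorant `‖F z‖ ≤ η ^ (re W z)` on the frontier of a bounded open set
propagates to its closure. -/
theorem norm_le_exp_of_frontier {U : Set ℂ} (hU : Bornology.IsBounded U) {F W : ℂ → ℂ}
    (hF : DifferentiableOn ℂ F (closure U)) (hW : Differentiable ℂ W) {L : ℝ}
    (h : ∀ z ∈ frontier U, ‖F z‖ ≤ Real.exp (-(L * (W z).re))) {z : ℂ} (hz : z ∈ closure U) :
    ‖F z‖ ≤ Real.exp (-(L * (W z).re)) := by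
  -- Multiplying by `exp (L W)` turns the majorant into the constant 1, and the maximum principle
  -- applies.
  have hd : DiffContOnCl ℂ (fun z => F z * Complex.exp (L * W z)) U := by
    apply DifferentiableOn.diffContOnCl
    exact hF.mul ((hW.const_mul _).cexp.differentiableOn)
  have hn : ∀ z, ‖F z * Complex.exp (L * W z)‖ = ‖F z‖ * Real.exp (L * (W z).re) := by
    intro z
    rw [norm_mul, Complex.norm_exp]
    simp
  have key := Complex.norm_le_of_forall_mem_frontier_norm_le hU hd (C := 1) (fun w hw => by
    rw [hn]
    have := h w hw
    rw [Real.exp_neg] at this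
    calc _ ≤ (Real.exp (L * (W w).re))⁻¹ * Real.exp (L * (W w).re) := by gcongr
      _ = 1 := inv_mul_cancel₀ (Real.exp_pos _).ne') hz
  rw [hn] at key
  rw [Real.exp_neg, ← one_div, le_div_iff₀ (Real.exp_pos _)]
  exact key

/-- From a horizontal segment to the vertical segment above it. -/
theorem norm_le_exp_of_triangle {b : ℝ} (hb : 0 < b) {F : ℂ → ℂ} {D : Set ℂ}
    (hD : ∀ z : ℂ, 0 ≤ z.im → z.im + |z.re| ≤ b → z ∈ D)
    (hF : DifferentiableOn ℂ F D) {L : ℝ} (hL : 0 ≤ L) (h1 : ∀ z ∈ D, ‖F z‖ ≤ 1)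
    (h2 : ∀ x : ℝ, |x| ≤ b → ‖F x‖ ≤ Real.exp (-L)) {y : ℝ} (hy : 0 ≤ y) (hyb : y ≤ b / 2) :
    ‖F (y * Complex.I)‖ ≤ Real.exp (-(L * (1 / 4))) := by
  set U : Set ℂ := {z : ℂ | 0 < z.im ∧ z.im + |z.re| < b} with hUdef
  have hUo : IsOpen U := by
    apply IsOpen.inter
    · exact isOpen_lt continuous_const Complex.continuous_im
    · exact isOpen_lt (Complex.continuous_im.add Complex.continuous_re.abs) continuous_const
  have hcl : closure U ⊆ {z : ℂ | 0 ≤ z.im ∧ z.im + |z.re| ≤ b} := by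
    apply closure_minimal
    · rintro z ⟨h, h'⟩
      exact ⟨h.le, h'.le⟩
    · apply IsClosed.inter
      · exact isClosed_le continuous_const Complex.continuous_im
      · exact isClosed_le (Complex.continuous_im.add Complex.continuous_re.abs) continuous_const
  have hbd : Bornology.IsBounded U := by
    apply (Metric.isBounded_closedBall (x := (0 : ℂ)) (r := b)).subset
    rintro z ⟨h, h'⟩
    rw [mem_closedBall_zero_iff]
    refine (Complex.norm_le_abs_re_add_abs_im z).trans ?_
    rw [abs_of_pos h]
    linarith
  -- With `z = x + iy`, the real part is `((b-y)² - x²) / b²`: zero on the slanted sides `|x| = b -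
  -- y`, at most 1 on the base, and at least `1/4` on the axis up to height `b/2`.
  set W : ℂ → ℂ := fun z => -((z - b * Complex.I) ^ 2) / (b : ℂ) ^ 2 with hWdef
  have hW : Differentiable ℂ W := by
    intro z
    simp only [hWdef]
    fun_prop
  have hre : ∀ z : ℂ, (W z).re = ((b - z.im) ^ 2 - z.re ^ 2) / b ^ 2 := by
    intro z
    have : W z = ((1 / b ^ 2 : ℝ) : ℂ) * (-((z - b * Complex.I) ^ 2)) := by
      simp only [hWdef]
      push_cast
      ring
    rw [this, Complex.re_ofReal_mul]
    simp [pow_two]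
    ring
  have hfr : ∀ z ∈ frontier U, ‖F z‖ ≤ Real.exp (-(L * (W z).re)) := by
    intro z hz
    rw [hUo.frontier_eq] at hz
    obtain ⟨hz1, hz2⟩ := hz
    obtain ⟨h3, h4⟩ := hcl hz1
    rcases h3.eq_or_lt with h5 | h5
    · have hzr : z = (z.re : ℂ) := by
        apply Complex.ext <;> simp [← h5]
      have h6 : ‖F z‖ ≤ Real.exp (-L) := by
        rw [hzr]
        apply h2
        linarith
      refine h6.trans (Real.exp_le_exp.mpr ?_)
      have : (W z).re ≤ 1 := by
        rw [hre, div_le_one (by positivity), ← h5]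
        nlinarith [sq_nonneg z.re]
      nlinarith
    · have h6 : z.im + |z.re| = b := by
        apply le_antisymm h4
        by_contra h7
        exact hz2 ⟨h5, not_le.mp h7⟩
      have h7 : (W z).re = 0 := by
        rw [hre, ← h6]
        simp
      rw [h7]
      simpa using h1 z (hD z h3 h4)
  have hyc : (y * Complex.I : ℂ) ∈ closure U := by
    -- The case `y = 0` is a boundary point, so the point is approached from above; shifts of at
    -- most `b/4` keep the height below `b`.
    have hseg : Filter.Tendsto (fun n : ℕ => (((y + (b / 4) * (1 / ((n : ℝ) + 1)) : ℝ) : ℂ) * Complex.I))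
        Filter.atTop (nhds (((y + (b / 4) * 0 : ℝ) : ℂ) * Complex.I)) := by
      apply Filter.Tendsto.mul_const
      apply (Complex.continuous_ofReal.tendsto _).comp
      apply Filter.Tendsto.const_add
      apply Filter.Tendsto.const_mul
      exact tendsto_one_div_add_atTop_nhds_zero_nat
    simp only [mul_zero, add_zero] at hseg
    apply mem_closure_of_tendsto hseg
    filter_upwards with n
    have h8 : (1 / ((n : ℝ) + 1)) ≤ 1 := by
      rw [div_le_one (by positivity)]
      linarith [Nat.cast_nonneg (α := ℝ) n]
    have h9 : 0 < (1 / ((n : ℝ) + 1)) := by positivity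
    have h10 : b / 4 * (1 / ((n : ℝ) + 1)) ≤ b / 4 * 1 := by gcongr
    have h11 : 0 < b / 4 * (1 / ((n : ℝ) + 1)) := by positivity
    generalize b / 4 * (1 / ((n : ℝ) + 1)) = t at h10 h11
    refine ⟨?_, ?_⟩
    · simp
      linarith
    · simp
      linarith
  have hdc : DifferentiableOn ℂ F (closure U) := hF.mono fun z hz => hD z (hcl hz).1 (hcl hz).2
  refine (norm_le_exp_of_frontier hbd hdc hW hfr hyc).trans (Real.exp_le_exp.mpr ?_)
  have : 1 / 4 ≤ (W (y * Complex.I)).re := by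
    rw [hre, le_div_iff₀ (by positivity)]
    simp
    nlinarith
  nlinarith

/-- Continuation from the left edge of a half-strip. -/
theorem norm_le_exp_of_halfStrip {h : ℝ} (hh : 0 < h) {c : ℝ} {F : ℂ → ℂ} {D : Set ℂ}
    (hD : ∀ z : ℂ, c ≤ z.re → |z.im| ≤ h → z ∈ D)
    (hF : DifferentiableOn ℂ F D) {L : ℝ} (hL : 0 ≤ L) (h1 : ∀ z ∈ D, ‖F z‖ ≤ 1)
    (h2 : ∀ y : ℝ, |y| ≤ h → ‖F (c + y * Complex.I)‖ ≤ Real.exp (-L)) {k : ℝ} (hk : c ≤ k) :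
    ‖F k‖ ≤ Real.exp (-(L * Real.exp (-(Real.pi / (2 * h) * (k - c))))) := by
  set p : ℝ := Real.pi / (2 * h) with hp
  have hpp : 0 < p := by positivity
  have hph : p * h = Real.pi / 2 := by rw [hp]; field_simp
  have main : ∀ N : ℝ, k < N → ‖F k‖ ≤
      Real.exp (-(L * (Real.exp (-(p * (k - c))) - Real.exp (-(p * (N - c)))))) := by
    intro N hN
    set U : Set ℂ := Set.Ioo c N ×ℂ Set.Ioo (-h) h with hU
    have hUo : IsOpen U := isOpen_Ioo.reProdIm isOpen_Ioo
    have hcl : closure U = Set.Icc c N ×ℂ Set.Icc (-h) h := by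
      rw [hU, Complex.closure_reProdIm, closure_Ioo (by linarith), closure_Ioo (by linarith)]
    have hbd : Bornology.IsBounded U := Metric.isBounded_Ioo _ _ |>.reProdIm (Metric.isBounded_Ioo _ _)
    -- The real part of the exponential is `e^{-p(x-c)} cos(py)`, and `ph = π/2` makes it vanish on
    -- the horizontal sides. Subtracting its value at `N` makes `W` harmless on the artificial right
    -- edge; `N` then tends to infinity.
    set W : ℂ → ℂ := fun z => Complex.exp (-(p * (z - c))) - (Real.exp (-(p * (N - c))) : ℂ) with hWdef
    have hW : Differentiable ℂ W := by
      intro z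
      simp only [hWdef]
      fun_prop
    have hre : ∀ z : ℂ, (W z).re = Real.exp (-(p * (z.re - c))) * Real.cos (p * z.im)
        - Real.exp (-(p * (N - c))) := by
      intro z
      simp only [hWdef, Complex.sub_re, Complex.exp_re, Complex.ofReal_re]
      simp
    have hcos : ∀ y : ℝ, |y| ≤ h → 0 ≤ Real.cos (p * y) := by
      intro y hy
      obtain ⟨hy1, hy2⟩ := abs_le.mp hy
      apply Real.cos_nonneg_of_neg_pi_div_two_le_of_le <;> nlinarith
    have hfr : ∀ z ∈ frontier U, ‖F z‖ ≤ Real.exp (-(L * (W z).re)) := by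
      intro z hz
      rw [hUo.frontier_eq, hcl] at hz
      obtain ⟨hz1, hz2⟩ := hz
      rw [Complex.mem_reProdIm] at hz1
      obtain ⟨⟨h3, h4⟩, h5, h6⟩ := hz1
      have him : |z.im| ≤ h := abs_le.mpr ⟨h5, h6⟩
      have hzD : z ∈ D := hD z h3 him
      have hone : (W z).re ≤ 0 → ‖F z‖ ≤ Real.exp (-(L * (W z).re)) := by
        intro h0
        refine (h1 z hzD).trans ?_
        rw [← Real.exp_zero]
        exact Real.exp_le_exp.mpr (by nlinarith)
      rcases h3.eq_or_lt with h7 | h7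
      · have hz' : z = c + z.im * Complex.I := by
          apply Complex.ext <;> simp [h7]
        have := h2 z.im him
        rw [← hz'] at this
        refine this.trans (Real.exp_le_exp.mpr ?_)
        have : (W z).re ≤ 1 := by
          rw [hre, ← h7]
          have := Real.cos_le_one (p * z.im)
          have := Real.exp_pos (-(p * (N - c)))
          simp
          linarith
        nlinarith
      · apply hone
        rw [hre]
        rcases h4.eq_or_lt with h8 | h8
        · rw [h8]
          have := Real.cos_le_one (p * z.im)
          have := Real.exp_pos (-(p * (N - c)))
          nlinarith
        · have h9 : |z.im| = h := by
            apply le_antisymm him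
            by_contra h10
            rw [not_le, abs_lt] at h10
            exact hz2 (Complex.mem_reProdIm.mpr ⟨⟨h7, h8⟩, h10⟩)
          have h10 : Real.cos (p * z.im) = 0 := by
            rw [← Real.cos_abs, abs_mul, h9, abs_of_pos hpp, hph, Real.cos_pi_div_two]
          rw [h10]
          have := Real.exp_pos (-(p * (N - c)))
          linarith
    have hkc : (k : ℂ) ∈ closure U := by
      rw [hcl, Complex.mem_reProdIm]
      simp only [Complex.ofReal_re, Complex.ofReal_im, Set.mem_Icc]
      exact ⟨⟨hk, hN.le⟩, by linarith, hh.le⟩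
    have hdc : DifferentiableOn ℂ F (closure U) := hF.mono fun z hz => by
      rw [hcl, Complex.mem_reProdIm] at hz
      exact hD z hz.1.1 (abs_le.mpr hz.2)
    have := norm_le_exp_of_frontier hbd hdc hW hfr hkc
    rw [hre] at this
    simpa using this
  have hlim : Filter.Tendsto (fun N : ℝ =>
      Real.exp (-(L * (Real.exp (-(p * (k - c))) - Real.exp (-(p * (N - c))))))) Filter.atTop
      (nhds (Real.exp (-(L * (Real.exp (-(p * (k - c))) - 0))))) := by
    apply (Real.continuous_exp.tendsto _).comp
    apply Filter.Tendsto.neg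
    apply Filter.Tendsto.const_mul
    apply Filter.Tendsto.const_sub
    apply Real.tendsto_exp_neg_atTop_nhds_zero.comp
    apply Filter.Tendsto.const_mul_atTop hpp
    exact Filter.tendsto_atTop_add_const_right _ _ Filter.tendsto_id
  rw [sub_zero] at hlim
  apply ge_of_tendsto hlim
  filter_upwards [Filter.eventually_gt_atTop k] with N hN
  exact main N hN

/-- Smallness on a real segment propagates along the half-strip. -/
theorem norm_le_exp_of_segment {b s δ x₀ : ℝ} (hb : 0 < b) (hbs : b < s) (hδ : x₀ < δ)
    {F : ℂ → ℂ} (hF : DifferentiableOn ℂ F {z : ℂ | x₀ < z.re ∧ |z.im| < s}) {L : ℝ} (hL : 0 ≤ L)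
    (h1 : ∀ z : ℂ, x₀ < z.re → |z.im| < s → ‖F z‖ ≤ 1)
    (h2 : ∀ t : ℝ, δ ≤ t → t ≤ δ + 2 * b → ‖F t‖ ≤ Real.exp (-L)) {k : ℝ} (hk : δ + b ≤ k) :
    ‖F k‖ ≤ Real.exp (-(L * (1 / 4 * Real.exp (-(Real.pi / b * (k - (δ + b))))))) := by
  set D : Set ℂ := {z : ℂ | x₀ < z.re ∧ |z.im| < s} with hD
  -- The sign `e` selects the triangle above or below the segment; a half-turn about the midpoint `δ
  -- + b` carries one to the other.
  have half : ∀ e : ℝ, |e| = 1 → ∀ y : ℝ, 0 ≤ y → y ≤ b / 2 →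
      ‖F (((δ + b : ℝ) : ℂ) + e * (y * Complex.I))‖ ≤ Real.exp (-(L * (1 / 4))) := by
    intro e he y hy hyb
    set G : ℂ → ℂ := fun z => F (((δ + b : ℝ) : ℂ) + e * z) with hG
    have hmap : ∀ z : ℂ, |z.im| + |z.re| ≤ b → (((δ + b : ℝ) : ℂ) + e * z) ∈ D := by
      intro z hz
      refine ⟨?_, ?_⟩
      · have : |e * z.re| ≤ b := by
          rw [abs_mul, he, one_mul]
          linarith [abs_nonneg z.im]
        have := (abs_le.mp this).1
        simp
        linarith
      · simp [abs_mul, he]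
        linarith [abs_nonneg z.re]
    set D' : Set ℂ := {z | |z.im| + |z.re| ≤ b}
    have hG' : DifferentiableOn ℂ G D' := by
      apply hF.comp (f := fun z : ℂ => ((δ + b : ℝ) : ℂ) + e * z)
      · fun_prop
      · exact fun z hz => hmap z hz
    have := norm_le_exp_of_triangle hb (D := D') (F := G) (L := L) ?_ hG' hL ?_ ?_ hy hyb
    · exact this
    · intro z hz hz'
      simp only [D', Set.mem_ofPred_eq]
      rwa [abs_of_nonneg hz]
    · intro z hz
      exact h1 _ (hmap z hz).1 (hmap z hz).2
    · intro x hx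
      have : |e * x| ≤ b := by rwa [abs_mul, he, one_mul]
      obtain ⟨h3, h4⟩ := abs_le.mp this
      have := h2 (δ + b + e * x) (by linarith) (by linarith)
      simp only [hG]
      push_cast at this ⊢
      exact this
  -- The triangles control the vertical segment only up to height `b/2`, so the narrower half-strip
  -- with `h = b/2` is used, whose rate is `π/b`.
  have := norm_le_exp_of_halfStrip (h := b / 2) (c := δ + b) (D := D) (F := F) (L := L * (1 / 4))
    (by positivity) ?_ hF (by positivity) (fun z hz => h1 z hz.1 hz.2) ?_ hk
  · refine this.trans_eq ?_
    rw [mul_assoc]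
    congr 6
    field_simp
  · intro z hz hz'
    exact ⟨by linarith, by linarith⟩
  · intro y hy
    rcases le_total 0 y with h0 | h0
    · have := half 1 (by simp) y h0 (by rwa [abs_of_nonneg h0] at hy)
      simpa using this
    · have := half (-1) (by simp) (-y) (by linarith) (by rwa [abs_of_nonpos h0] at hy)
      simpa using this

/-! ### Holomorphic dependence of integrals on a parameter -/

/-- An integral of functions holomorphic in a parameter, locally uniformly dominated by an
integrable function, is holomorphic in the parameter. -/
theorem differentiableOn_integral_of_dominated {α : Type*} [MeasurableSpace α] {m : Measure α}
    {U : Set ℂ} (hU : IsOpen U) {F : ℂ → α → ℂ}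
    (hmeas : ∀ z ∈ U, AEStronglyMeasurable (F z) m)
    (hdiff : ∀ᵐ a ∂m, DifferentiableOn ℂ (fun z => F z a) U)
    (hbound : ∀ z₀ ∈ U, ∃ ε > 0, ∃ g : α → ℝ, Integrable g m ∧
      ∀ᵐ a ∂m, ∀ z ∈ Metric.ball z₀ ε, z ∈ U → ‖F z a‖ ≤ g a) :
    DifferentiableOn ℂ (fun z => ∫ a, F z a ∂m) U := by
  intro z₀ hz₀
  obtain ⟨ε, hε, g, hg, hFg⟩ := hbound z₀ hz₀
  obtain ⟨ε', hε', hball⟩ := Metric.isOpen_iff.mp hU z₀ hz₀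
  set r := min ε ε' / 2 with hr
  have hr0 : 0 < r := by positivity
  have hr1 : 2 * r ≤ ε := by rw [hr]; linarith [min_le_left ε ε']
  have hr2 : 2 * r ≤ ε' := by rw [hr]; linarith [min_le_right ε ε']
  have hb2 : Metric.ball z₀ (2 * r) ⊆ U := (Metric.ball_subset_ball hr2).trans hball
  have hmem : ∀ᶠ z in nhds z₀, z ∈ U := hU.mem_nhds hz₀
  have hint : ∀ z ∈ Metric.ball z₀ ε, z ∈ U → Integrable (F z) m := fun z hz hzU =>
    hg.mono' (hmeas z hzU) (hFg.mono fun a ha => ha z hz hzU)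
  have key := hasDerivAt_integral_of_dominated_loc_of_deriv_le (μ := m) (F := F) (x₀ := z₀)
    (F' := fun z a => deriv (fun w => F w a) z) (s := Metric.ball z₀ (r / 2))
    (bound := fun a => g a / (r / 2)) (Metric.ball_mem_nhds _ (by positivity))
    (hmem.mono fun z hz => hmeas z hz) (hint z₀ (Metric.mem_ball_self hε) hz₀) ?_ ?_
    (hg.div_const _) ?_
  · exact key.2.differentiableAt.differentiableWithinAt
  -- The derivative at `z₀` is measurable in the parameter as a limit of difference quotients along
  -- a sequence.
  · have hseq : Filter.Tendsto (fun n : ℕ => z₀ + (((r / ((n : ℝ) + 1)) : ℝ) : ℂ)) Filter.atTop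
        (nhdsWithin z₀ {z₀}ᶜ) := by
      apply tendsto_nhdsWithin_iff.mpr ⟨?_, ?_⟩
      · have : Filter.Tendsto (fun n : ℕ => z₀ + (((r * (1 / ((n : ℝ) + 1))) : ℝ) : ℂ)) Filter.atTop
            (nhds (z₀ + (((r * 0) : ℝ) : ℂ))) := by
          apply Filter.Tendsto.const_add
          apply (Complex.continuous_ofReal.tendsto _).comp
          apply Filter.Tendsto.const_mul
          exact tendsto_one_div_add_atTop_nhds_zero_nat
        simpa [div_eq_mul_inv] using this
      · filter_upwards with n
        have : (((r / ((n : ℝ) + 1)) : ℝ) : ℂ) ≠ 0 := by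
          apply Complex.ofReal_ne_zero.mpr
          positivity
        simpa using this
    have hU' : ∀ n : ℕ, z₀ + (((r / ((n : ℝ) + 1)) : ℝ) : ℂ) ∈ U := by
      intro n
      apply hb2
      rw [mem_ball_iff_norm, add_sub_cancel_left, Complex.norm_real, Real.norm_of_nonneg (by positivity)]
      have : r / ((n : ℝ) + 1) ≤ r := div_le_self hr0.le (by linarith [Nat.cast_nonneg (α := ℝ) n])
      linarith
    refine aestronglyMeasurable_of_tendsto_ae Filter.atTop
      (f := fun (n : ℕ) a => slope (fun w => F w a) z₀ (z₀ + (((r / ((n : ℝ) + 1)) : ℝ) : ℂ))) ?_ ?_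
    · intro n
      simp only [slope, vsub_eq_sub, smul_eq_mul]
      exact ((hmeas _ (hU' n)).sub (hmeas _ hz₀)).const_mul _
    · filter_upwards [hdiff] with a ha
      have := (ha.differentiableAt (hU.mem_nhds hz₀)).hasDerivAt
      exact (hasDerivAt_iff_tendsto_slope.mp this).comp hseq
  -- Cauchy's estimate on circles of radius `r/2` turns the bound on the functions into one on their
  -- derivatives.
  · filter_upwards [hdiff, hFg] with a ha hga z hz
    have hsub : Metric.closedBall z (r / 2) ⊆ Metric.ball z₀ (2 * r) := by
      intro w hw
      have h1 := Metric.mem_ball.mp hz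
      have h2 := Metric.mem_closedBall.mp hw
      have := dist_triangle w z z₀
      rw [Metric.mem_ball]
      linarith
    apply Complex.norm_deriv_le_of_forall_mem_sphere_norm_le (by positivity)
    · apply DifferentiableOn.diffContOnCl
      apply ha.mono
      exact (Metric.closure_ball_subset_closedBall.trans hsub).trans hb2
    · intro w hw
      have := hsub (Metric.sphere_subset_closedBall hw)
      exact hga w (Metric.ball_subset_ball hr1 this) (hb2 this)
  · filter_upwards [hdiff] with a ha z hz
    have : z ∈ U := hb2 (Metric.ball_subset_ball (by linarith) hz)
    exact (ha.differentiableAt (hU.mem_nhds this)).hasDerivAt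

/-! ### Radial kernels and the Yukawa kernel -/

theorem hasFDerivAt_radial {G : Type*} [NormedAddCommGroup G] [NormedSpace ℝ G]
    {H H' : ℝ → G} {e : ℝ} {x : Space3}
    (hH : HasDerivAt H (H' (‖x‖ ^ 2 + e)) (‖x‖ ^ 2 + e)) :
    HasFDerivAt (fun x : Space3 => H (‖x‖ ^ 2 + e))
      ((2 • innerSL ℝ x).smulRight (H' (‖x‖ ^ 2 + e))) x := by
  have h1 : HasFDerivAt (fun x : Space3 => ‖x‖ ^ 2 + e) (2 • innerSL ℝ x) x :=
    ((hasStrictFDerivAt_norm_sq x).hasFDerivAt).add_const e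
  have := hH.hasFDerivAt.comp x h1
  refine this.congr_fderiv ?_
  ext v
  simp only [ContinuousLinearMap.comp_apply, ContinuousLinearMap.toSpanSingleton_apply,
    ContinuousLinearMap.smulRight_apply]

theorem fderiv_fderiv_radial {G : Type*} [NormedAddCommGroup G] [NormedSpace ℝ G]
    {H H' H'' : ℝ → G} {e : ℝ} {x : Space3} (hx : 0 < ‖x‖ ^ 2 + e)
    (hH : ∀ q, 0 < q → HasDerivAt H (H' q) q) (hH' : ∀ q, 0 < q → HasDerivAt H' (H'' q) q)
    (v : Space3) :
    fderiv ℝ (fderiv ℝ fun x : Space3 => H (‖x‖ ^ 2 + e)) x v v =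
      (4 * inner ℝ x v ^ 2) • H'' (‖x‖ ^ 2 + e) + (2 * ‖v‖ ^ 2) • H' (‖x‖ ^ 2 + e) := by
  have hev : (fderiv ℝ fun x : Space3 => H (‖x‖ ^ 2 + e)) =ᶠ[nhds x]
      fun x => (2 • innerSL ℝ x).smulRight (H' (‖x‖ ^ 2 + e)) := by
    have : ∀ᶠ y : Space3 in nhds x, 0 < ‖y‖ ^ 2 + e :=
      (continuous_norm.pow 2 |>.add continuous_const).continuousAt.eventually (lt_mem_nhds hx)
    filter_upwards [this] with y hy
    exact (hasFDerivAt_radial (hH _ hy)).fderiv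
  rw [hev.fderiv_eq]
  have h1 : HasFDerivAt (fun x : Space3 => 2 • innerSL ℝ x) (2 • innerSL ℝ (E := Space3)) x :=
    (2 • innerSL ℝ (E := Space3)).hasFDerivAt
  have h2 := hasFDerivAt_radial (hH' _ hx)
  have h3 := (ContinuousLinearMap.smulRightL ℝ Space3 G).hasFDerivAt_of_bilinear h1 h2
  have h4 : HasFDerivAt (fun x : Space3 => (2 • innerSL ℝ x).smulRight (H' (‖x‖ ^ 2 + e))) _ x := h3
  rw [h4.fderiv]
  have h5 : (innerSL ℝ v) v = ‖v‖ ^ 2 := real_inner_self_eq_norm_sq v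
  simp [h5]
  module

/-- Summing the pure second derivatives over an orthonormal basis turns `4⟨x,v⟩²` into `4‖x‖²` by
Parseval, and `2‖v‖²` into `2·3`. -/
theorem laplacian_radial {G : Type*} [NormedAddCommGroup G] [NormedSpace ℝ G]
    {H H' H'' : ℝ → G} {e : ℝ} {x : Space3} (hx : 0 < ‖x‖ ^ 2 + e)
    (hH : ∀ q, 0 < q → HasDerivAt H (H' q) q) (hH' : ∀ q, 0 < q → HasDerivAt H' (H'' q) q) :
    (Δ fun x : Space3 => H (‖x‖ ^ 2 + e)) x =
      (4 * ‖x‖ ^ 2) • H'' (‖x‖ ^ 2 + e) + (6 : ℝ) • H' (‖x‖ ^ 2 + e) := by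
  rw [InnerProductSpace.laplacian_eq_iteratedFDeriv_orthonormalBasis _
    (EuclideanSpace.basisFun (Fin 3) ℝ)]
  simp only [iteratedFDeriv_two_apply]
  simp only [Matrix.cons_val_zero, Matrix.cons_val_one]
  simp only [fderiv_fderiv_radial hx hH hH']
  rw [Finset.sum_add_distrib, ← Finset.sum_smul, ← Finset.sum_smul, ← Finset.mul_sum]
  congr 2
  · rw [OrthonormalBasis.sum_sq_inner_left]
  · simp
    norm_num

/-- `q ↦ exp (-λ √q) / (4π √q)`. -/
noncomputable def yukawaProfile (lam : ℂ) (q : ℝ) : ℂ :=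
  Complex.exp (-(lam * (√q : ℝ))) / (4 * Real.pi * (√q : ℝ))

/-- Derivatives are taken in `q = s²`, because `‖x‖² + e` is smooth in `x` even at the origin. -/
noncomputable def yukawaProfile' (lam : ℂ) (q : ℝ) : ℂ :=
  -((lam / (√q : ℝ) ^ 2 + 1 / (√q : ℝ) ^ 3) * Complex.exp (-(lam * (√q : ℝ))) / (8 * Real.pi))

noncomputable def yukawaProfile'' (lam : ℂ) (q : ℝ) : ℂ :=
  (lam ^ 2 / (√q : ℝ) ^ 3 + 3 * lam / (√q : ℝ) ^ 4 + 3 / (√q : ℝ) ^ 5)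
    * Complex.exp (-(lam * (√q : ℝ))) / (16 * Real.pi)

theorem hasDerivAt_sqrt_ofReal {q : ℝ} (hq : 0 < q) :
    HasDerivAt (fun q : ℝ => ((√q : ℝ) : ℂ)) (1 / (2 * (√q : ℝ)) : ℂ) q := by
  have := (Real.hasDerivAt_sqrt hq.ne').ofReal_comp
  simpa using this

theorem hasDerivAt_yukawaProfile (lam : ℂ) (q : ℝ) (hq : 0 < q) :
    HasDerivAt (yukawaProfile lam) (yukawaProfile' lam q) q := by
  have h := hasDerivAt_sqrt_ofReal hq
  have hs : ((√q : ℝ) : ℂ) ≠ 0 := by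
    simpa using (Real.sqrt_pos.mpr hq).ne'
  have hpi : (Real.pi : ℂ) ≠ 0 := by simp [Real.pi_ne_zero]
  have := ((h.const_mul lam).neg.cexp).div (h.const_mul (4 * Real.pi : ℂ)) (by simp [hs, hpi])
  refine this.congr_deriv ?_
  simp only [yukawaProfile', Pi.neg_apply]
  field_simp
  ring

theorem hasDerivAt_yukawaProfile' (lam : ℂ) (q : ℝ) (hq : 0 < q) :
    HasDerivAt (yukawaProfile' lam) (yukawaProfile'' lam q) q := by
  have h := hasDerivAt_sqrt_ofReal hq
  have hs : ((√q : ℝ) : ℂ) ≠ 0 := by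
    simpa using (Real.sqrt_pos.mpr hq).ne'
  have hpi : (Real.pi : ℂ) ≠ 0 := by simp [Real.pi_ne_zero]
  have := (((((hasDerivAt_const q lam).div (h.pow 2) (by simp [hs])).add
    ((hasDerivAt_const q (1 : ℂ)).div (h.pow 3) (by simp [hs]))).mul
      ((h.const_mul lam).neg.cexp)).div_const (8 * Real.pi : ℂ)).neg
  refine this.congr_deriv ?_
  simp only [yukawaProfile'']
  simp
  field_simp
  ring

/-- The regularised Yukawa kernel `exp (-λ s) / (4π s)`, `s = √(‖x‖² + e)`. -/
noncomputable def yukawa (lam : ℂ) (e : ℝ) (x : Space3) : ℂ :=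
  yukawaProfile lam (‖x‖ ^ 2 + e)

/-- The profile satisfies `4qH'' + 6H' = λ²H`. Since `4‖x‖² = 4q - 4e`, the regularisation leaves
precisely the error `-4eH''`, which becomes the delta mass as `e → 0`. -/
theorem laplacian_yukawa (lam : ℂ) {e : ℝ} {x : Space3} (hx : 0 < ‖x‖ ^ 2 + e) :
    (Δ (yukawa lam e)) x = lam ^ 2 * yukawa lam e x
      - 4 * e * yukawaProfile'' lam (‖x‖ ^ 2 + e) := by
  have := laplacian_radial hx (hasDerivAt_yukawaProfile lam) (hasDerivAt_yukawaProfile' lam)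
  refine this.trans ?_
  have hs : ((√(‖x‖ ^ 2 + e) : ℝ) : ℂ) ≠ 0 := by
    simpa using (Real.sqrt_pos.mpr hx).ne'
  have hpi : (Real.pi : ℂ) ≠ 0 := by simp [Real.pi_ne_zero]
  have hq : ((√(‖x‖ ^ 2 + e) : ℝ) : ℂ) ^ 2 = ((‖x‖ : ℝ) : ℂ) ^ 2 + e := by
    rw [← Complex.ofReal_pow, Real.sq_sqrt hx.le]
    push_cast
    rfl
  have hx2 : ((‖x‖ : ℝ) : ℂ) ^ 2 = ((√(‖x‖ ^ 2 + e) : ℝ) : ℂ) ^ 2 - e := by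
    rw [hq]; ring
  simp only [yukawaProfile', yukawaProfile'', yukawa, yukawaProfile, Complex.real_smul]
  push_cast
  rw [hx2]
  generalize ((√(‖x‖ ^ 2 + e) : ℝ) : ℂ) = s at *
  field_simp
  ring

theorem contDiffAt_yukawaProfile (lam : ℂ) {q : ℝ} (hq : 0 < q) {n : WithTop ℕ∞} :
    ContDiffAt ℝ n (yukawaProfile lam) q := by
  have h1 : ContDiffAt ℝ n (fun q : ℝ => ((√q : ℝ) : ℂ)) q :=
    Complex.ofRealCLM.contDiff.contDiffAt.comp q (Real.contDiffAt_sqrt hq.ne')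
  have hs : ((√q : ℝ) : ℂ) ≠ 0 := by
    simpa using (Real.sqrt_pos.mpr hq).ne'
  have hpi : (Real.pi : ℂ) ≠ 0 := by simp [Real.pi_ne_zero]
  have h2 := (((contDiffAt_const (c := lam)).mul h1).neg.cexp).mul
    (((contDiffAt_const (c := (4 * Real.pi : ℂ))).mul h1).inv (by simp [hs, hpi]))
  exact h2.congr_of_eventuallyEq (Filter.Eventually.of_forall fun q => div_eq_mul_inv _ _)

theorem contDiffAt_yukawa (lam : ℂ) {e : ℝ} {x : Space3} (hx : 0 < ‖x‖ ^ 2 + e)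
    {n : WithTop ℕ∞} : ContDiffAt ℝ n (yukawa lam e) x := by
  have : ContDiffAt ℝ n (fun x : Space3 => ‖x‖ ^ 2 + e) x :=
    ((contDiff_norm_sq ℝ).add contDiff_const).contDiffAt
  exact (contDiffAt_yukawaProfile lam hx).comp x this

theorem fderiv_yukawa (lam : ℂ) {e : ℝ} {x : Space3} (hx : 0 < ‖x‖ ^ 2 + e) (v : Space3) :
    fderiv ℝ (yukawa lam e) x v = (2 * inner ℝ x v) • yukawaProfile' lam (‖x‖ ^ 2 + e) := by
  have := (hasFDerivAt_radial (hasDerivAt_yukawaProfile lam _ hx)).fderiv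
  change fderiv ℝ (fun x : Space3 => yukawaProfile lam (‖x‖ ^ 2 + e)) x v = _
  rw [this]
  simp

theorem norm_exp_neg_mul_le {lam : ℂ} (hlam : 0 ≤ lam.re) {s : ℝ} (hs : 0 ≤ s) :
    ‖Complex.exp (-(lam * (s : ℝ)))‖ ≤ 1 := by
  rw [Complex.norm_exp, ← Real.exp_zero]
  apply Real.exp_le_exp.mpr
  simp
  positivity

/-- The exponential has modulus at most 1 and `s ≥ ‖x‖`. The bound is uniform in `e`, hence a
dominating function for removing the regularisation. -/
theorem norm_yukawa_le {lam : ℂ} (hlam : 0 ≤ lam.re) {e : ℝ} (he : 0 ≤ e) {x : Space3}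
    (hx : x ≠ 0) : ‖yukawa lam e x‖ ≤ 1 / ‖x‖ := by
  have hx' : 0 < ‖x‖ := norm_pos_iff.mpr hx
  have hs : ‖x‖ ≤ √(‖x‖ ^ 2 + e) := Real.le_sqrt_of_sq_le (by linarith)
  have hs0 := hx'.trans_le hs
  simp only [yukawa, yukawaProfile]
  rw [norm_div, norm_mul, norm_mul, Complex.norm_real, Complex.norm_real, Real.norm_of_nonneg hs0.le,
    Real.norm_of_nonneg Real.pi_pos.le]
  have h1 := norm_exp_neg_mul_le hlam hs0.le
  have h2 : ‖(4 : ℂ)‖ = 4 := by simp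
  rw [h2]
  have h3 : ‖x‖ ≤ 4 * Real.pi * √(‖x‖ ^ 2 + e) := by nlinarith [Real.pi_gt_three]
  gcongr

theorem norm_fderiv_yukawa_le {lam : ℂ} (hlam : 0 ≤ lam.re) {e : ℝ} (he : 0 ≤ e) {x : Space3}
    (hx : x ≠ 0) (v : Space3) :
    ‖fderiv ℝ (yukawa lam e) x v‖ ≤ (‖lam‖ / ‖x‖ + 1 / ‖x‖ ^ 2) * ‖v‖ := by
  have hx' : 0 < ‖x‖ := norm_pos_iff.mpr hx
  have hs : ‖x‖ ≤ √(‖x‖ ^ 2 + e) := Real.le_sqrt_of_sq_le (by linarith)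
  have hs0 := hx'.trans_le hs
  rw [fderiv_yukawa lam (by positivity), norm_smul]
  have h1 := norm_exp_neg_mul_le hlam hs0.le
  have h2 : ‖yukawaProfile' lam (‖x‖ ^ 2 + e)‖ ≤ (‖lam‖ / ‖x‖ ^ 2 + 1 / ‖x‖ ^ 3) * (1 / 2) := by
    simp only [yukawaProfile']
    rw [norm_neg, norm_div, norm_mul]
    have h3 : ‖lam / ((√(‖x‖ ^ 2 + e) : ℝ) : ℂ) ^ 2 + 1 / ((√(‖x‖ ^ 2 + e) : ℝ) : ℂ) ^ 3‖ ≤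
        ‖lam‖ / ‖x‖ ^ 2 + 1 / ‖x‖ ^ 3 := by
      refine (norm_add_le _ _).trans ?_
      simp only [norm_div, norm_pow, Complex.norm_real, norm_one]
      rw [Real.norm_of_nonneg hs0.le]
      gcongr
    have h4 : ‖(8 * Real.pi : ℂ)‖ = 8 * Real.pi := by
      rw [norm_mul, Complex.norm_real, Real.norm_of_nonneg Real.pi_pos.le]
      simp
    rw [h4, div_eq_mul_one_div]
    have h5 : 1 / (8 * Real.pi) ≤ 1 / 2 := by
      apply one_div_le_one_div_of_le (by norm_num)
      nlinarith [Real.pi_gt_three]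
    have h6 : 0 ≤ ‖lam‖ / ‖x‖ ^ 2 + 1 / ‖x‖ ^ 3 := by positivity
    calc _ ≤ (‖lam‖ / ‖x‖ ^ 2 + 1 / ‖x‖ ^ 3) * 1 * (1 / 2) := by gcongr
      _ = _ := by ring
  have h7 : ‖(2 * inner ℝ x v : ℝ)‖ ≤ 2 * (‖x‖ * ‖v‖) := by
    rw [norm_mul, Real.norm_of_nonneg (by norm_num : (0:ℝ) ≤ 2)]
    gcongr
    exact norm_inner_le_norm x v
  calc _ ≤ 2 * (‖x‖ * ‖v‖) * ((‖lam‖ / ‖x‖ ^ 2 + 1 / ‖x‖ ^ 3) * (1 / 2)) := by gcongr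
    _ = _ := by field_simp

/-! ### Potentials off the support of the density -/

theorem aestronglyMeasurable_comp_sub {G : Type*} [NormedAddCommGroup G] {k : Space3 → G}
    (hk : ContinuousOn k {0}ᶜ) (x : Space3) :
    AEStronglyMeasurable (fun y => k (x - y)) volume := by
  rw [← restrict_compl_singleton (μ := volume) x]
  apply ContinuousOn.aestronglyMeasurable _ (measurableSet_singleton x).compl
  apply hk.comp (by fun_prop)
  intro y hy h
  exact hy (sub_eq_zero.mp h).symm

/-- For `x'` near `x` and `y` in the compact support, `x' - y` stays in a compact shell avoiding the
origin. The kernel and its derivative are bounded there, so a constant multiple of `|f|` dominates.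
-/
theorem hasFDerivAt_potential {G : Type*} [NormedAddCommGroup G] [NormedSpace ℝ G]
    [CompleteSpace G] {k : Space3 → G} (hk : ContDiffOn ℝ 1 k {0}ᶜ) {f : Space3 → ℝ}
    (hf : Integrable f) (hfc : HasCompactSupport f) {x : Space3} (hx : x ∉ tsupport f) :
    Integrable (fun y => f y • fderiv ℝ k (x - y)) ∧
    HasFDerivAt (fun x => ∫ y, f y • k (x - y)) (∫ y, f y • fderiv ℝ k (x - y)) x := by
  obtain ⟨η, hη, hball⟩ := Metric.isOpen_iff.mp (isClosed_tsupport f).isOpen_compl x hx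
  obtain ⟨ρ, hρ⟩ := hfc.isBounded.exists_norm_le
  have hopen : IsOpen ({0}ᶜ : Set Space3) := isOpen_compl_singleton
  have hkf : ContinuousOn (fderiv ℝ k) {0}ᶜ := hk.continuousOn_fderiv_of_isOpen hopen le_rfl
  have hdist : ∀ y ∈ tsupport f, ∀ x' ∈ Metric.ball x (η / 2),
      x' - y ∈ Metric.closedBall (0 : Space3) (‖x‖ + η + ρ) \ Metric.ball 0 (η / 2) := by
    intro y hy x' hx'
    have h1 : η ≤ dist y x := by
      by_contra h
      exact hball (not_le.mp h) hy
    have h2 : dist x' x < η / 2 := hx'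
    refine ⟨?_, ?_⟩
    · rw [mem_closedBall_zero_iff]
      calc ‖x' - y‖ = ‖x + (x' - x) - y‖ := by congr 1; abel
        _ ≤ ‖x‖ + ‖x' - x‖ + ‖y‖ := by
          refine (norm_sub_le _ _).trans ?_
          gcongr
          exact norm_add_le _ _
        _ ≤ _ := by
          rw [← dist_eq_norm]
          have := hρ y hy
          linarith
    · rw [mem_ball_zero_iff, not_lt, ← dist_eq_norm]
      have := dist_triangle y x' x
      rw [dist_comm y x'] at this
      linarith
  have hcomp : IsCompact (Metric.closedBall (0 : Space3) (‖x‖ + η + ρ) \ Metric.ball 0 (η / 2)) :=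
    (isCompact_closedBall _ _).diff Metric.isOpen_ball
  have hsub : Metric.closedBall (0 : Space3) (‖x‖ + η + ρ) \ Metric.ball 0 (η / 2) ⊆ {0}ᶜ := by
    rintro w ⟨_, hw⟩ rfl
    exact hw (Metric.mem_ball_self (by positivity))
  obtain ⟨C, hC⟩ := hcomp.exists_bound_of_continuousOn (hkf.mono hsub)
  obtain ⟨C0, hC0⟩ := hcomp.exists_bound_of_continuousOn (hk.continuousOn.mono hsub)
  have hmeas : ∀ x', AEStronglyMeasurable (fun y => f y • k (x' - y)) volume := fun x' =>
    hf.aestronglyMeasurable.smul (aestronglyMeasurable_comp_sub hk.continuousOn x')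
  have hmeas' : AEStronglyMeasurable (fun y => f y • fderiv ℝ k (x - y)) volume :=
    hf.aestronglyMeasurable.smul (aestronglyMeasurable_comp_sub hkf x)
  have hbound : ∀ y, ∀ x' ∈ Metric.ball x (η / 2), ‖f y • fderiv ℝ k (x' - y)‖ ≤ ‖f y‖ * C := by
    intro y x' hx'
    by_cases hy : y ∈ tsupport f
    · rw [norm_smul]
      gcongr
      exact hC _ (hdist y hy x' hx')
    · rw [image_eq_zero_of_notMem_tsupport hy]
      simp
  have hself : x ∈ Metric.ball x (η / 2) := Metric.mem_ball_self (by positivity)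
  refine ⟨(hf.norm.mul_const C).mono' hmeas' (Filter.Eventually.of_forall fun y =>
    hbound y x hself), ?_⟩
  refine hasFDerivAt_integral_of_dominated_of_fderiv_le (bound := fun y => ‖f y‖ * C)
    (Metric.ball_mem_nhds x (by positivity : 0 < η / 2))
    (F' := fun x' y => f y • fderiv ℝ k (x' - y))
    (Filter.Eventually.of_forall hmeas) ?_ hmeas' ?_ (hf.norm.mul_const C) ?_
  · refine (hf.norm.mul_const C0).mono' (hmeas x) (Filter.Eventually.of_forall fun y => ?_)
    by_cases hy : y ∈ tsupport f
    · rw [norm_smul]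
      gcongr
      exact hC0 _ (hdist y hy x hself)
    · rw [image_eq_zero_of_notMem_tsupport hy]
      simp
  · exact Filter.Eventually.of_forall hbound
  · refine Filter.Eventually.of_forall fun y x' hx' => ?_
    by_cases hy : y ∈ tsupport f
    · have h0 : x' - y ∈ ({0}ᶜ : Set Space3) := hsub (hdist y hy x' hx')
      have h1 : HasFDerivAt k (fderiv ℝ k (x' - y)) (x' - y) :=
        ((hk.differentiableOn (by norm_num)).differentiableAt (hopen.mem_nhds h0)).hasFDerivAt
      have h2 : HasFDerivAt (fun x' : Space3 => k (x' - y)) (fderiv ℝ k (x' - y)) x' := by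
        exact h1.comp x' ((hasFDerivAt_id x').sub_const y)
      exact h2.const_smul (f y)
    · simp only [image_eq_zero_of_notMem_tsupport hy, zero_smul]
      exact hasFDerivAt_const _ _

theorem fderiv_potential_apply {k : Space3 → ℂ} (hk : ContDiffOn ℝ 1 k {0}ᶜ) {f : Space3 → ℝ}
    (hf : Integrable f) (hfc : HasCompactSupport f) {x : Space3} (hx : x ∉ tsupport f)
    (v : Space3) :
    fderiv ℝ (fun x => ∫ y, f y • k (x - y)) x v = ∫ y, f y • fderiv ℝ k (x - y) v := by
  obtain ⟨h1, h2⟩ := hasFDerivAt_potential hk hf hfc hx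
  rw [h2.fderiv, ContinuousLinearMap.integral_apply h1]
  rfl

theorem laplacian_potential {k : Space3 → ℂ} (hk : ContDiffOn ℝ 2 k {0}ᶜ) {f : Space3 → ℝ}
    (hf : Integrable f) (hfc : HasCompactSupport f) {x : Space3} (hx : x ∉ tsupport f) :
    (Δ fun x => ∫ y, f y • k (x - y)) x = ∫ y, f y • (Δ k) (x - y) := by
  have hopen : IsOpen ({0}ᶜ : Set Space3) := isOpen_compl_singleton
  have hk1 : ContDiffOn ℝ 1 k {0}ᶜ := hk.of_le (by norm_num)
  have hk2 : ContDiffOn ℝ 1 (fderiv ℝ k) {0}ᶜ := hk.fderiv_of_isOpen hopen (by norm_num)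
  have hev : fderiv ℝ (fun x => ∫ y, f y • k (x - y)) =ᶠ[nhds x]
      fun x => ∫ y, f y • fderiv ℝ k (x - y) := by
    filter_upwards [(isClosed_tsupport f).isOpen_compl.mem_nhds hx] with x' hx'
    exact (hasFDerivAt_potential hk1 hf hfc hx').2.fderiv
  obtain ⟨h1, h2⟩ := hasFDerivAt_potential hk2 hf hfc hx
  simp only [InnerProductSpace.laplacian_eq_iteratedFDeriv_orthonormalBasis _
    (EuclideanSpace.basisFun (Fin 3) ℝ), iteratedFDeriv_two_apply, Matrix.cons_val_zero,
    Matrix.cons_val_one]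
  rw [hev.fderiv_eq, h2.fderiv]
  simp only [Finset.smul_sum]
  have happ : ∀ v w : Space3, Integrable (fun y => f y • fderiv ℝ (fderiv ℝ k) (x - y) v w) := by
    intro v w
    have := (h1.apply_continuousLinearMap v).apply_continuousLinearMap w
    simpa using this
  rw [integral_finsetSum _ fun i _ => happ _ _]
  refine Finset.sum_congr rfl fun i _ => ?_
  rw [ContinuousLinearMap.integral_apply h1,
    ContinuousLinearMap.integral_apply (h1.apply_continuousLinearMap _)]
  simp

/-! ### Integrability of power singularities -/

theorem integrableOn_norm_rpow_ball {p : ℝ} (hp : p < 3) {r : ℝ} (hr : 0 < r) :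
    IntegrableOn (fun x : Space3 => ‖x‖ ^ (-p)) (Metric.ball 0 r) := by
  rw [integrableOn_fun_norm_addHaar volume (f := fun t : ℝ => t ^ (-p))]
  have h : IntegrableOn (fun y : ℝ => y ^ (2 - p)) (Set.Ioo 0 r) :=
    (intervalIntegral.integrableOn_Ioo_rpow_iff hr).mpr (by linarith)
  refine h.congr_fun (fun y hy => ?_) measurableSet_Ioo
  have hy0 : 0 < y := hy.1
  simp only [finrank_euclideanSpace, Fintype.card_fin, smul_eq_mul]
  rw [show (3 - 1 : ℕ) = 2 from rfl, ← Real.rpow_natCast, ← Real.rpow_add hy0]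
  norm_num
  ring_nf

theorem measurable_norm_rpow {p : ℝ} : Measurable (fun x : Space3 => ‖x‖ ^ p) :=
  measurable_norm.pow_const p

/-- In the unit ball the power is integrable and `g` bounded; outside, the power is at most 1 and
`g` integrable. -/
theorem integrable_norm_rpow_mul {p : ℝ} (hp0 : 0 ≤ p) (hp : p < 3) {g : Space3 → ℝ}
    (hg : Integrable g) {C : ℝ} (hC : ∀ x, ‖g x‖ ≤ C) :
    Integrable (fun x : Space3 => ‖x‖ ^ (-p) * g x) := by
  have h1 : IntegrableOn (fun x : Space3 => ‖x‖ ^ (-p) * g x) (Metric.ball 0 1) :=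
    Integrable.mul_bdd (integrableOn_norm_rpow_ball hp one_pos) hg.aestronglyMeasurable.restrict
      (Filter.Eventually.of_forall hC)
  have h2 : IntegrableOn (fun x : Space3 => ‖x‖ ^ (-p) * g x) (Metric.ball 0 1)ᶜ := by
    apply Integrable.bdd_mul (c := 1) hg.integrableOn
      measurable_norm_rpow.aestronglyMeasurable
    filter_upwards [ae_restrict_mem Metric.isOpen_ball.measurableSet.compl] with x hx
    have : 1 ≤ ‖x‖ := by simpa using hx
    rw [Real.norm_of_nonneg (by positivity)]
    exact Real.rpow_le_one_of_one_le_of_nonpos this (by linarith)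
  have := h1.union h2
  rwa [Set.union_compl_self, integrableOn_univ] at this

theorem integrable_inv_norm_mul_schwartz (φ : 𝓢(Space3, ℂ)) (a b : ℝ) :
    Integrable (fun x : Space3 => (a / ‖x‖ + b / ‖x‖ ^ 2) * ‖φ x‖) := by
  have hC : ∀ x, ‖‖φ x‖‖ ≤ SchwartzMap.seminorm ℝ 0 0 φ := fun x => by
    rw [norm_norm]
    exact SchwartzMap.norm_le_seminorm ℝ φ x
  have h1 := (integrable_norm_rpow_mul (p := 1) (by norm_num) (by norm_num)
    φ.integrable.norm hC).const_mul a
  have h2 := (integrable_norm_rpow_mul (p := 2) (by norm_num) (by norm_num)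
    φ.integrable.norm hC).const_mul b
  refine (h1.add h2).congr (Filter.Eventually.of_forall fun x => ?_)
  have e1 : ‖x‖ ^ (-1 : ℝ) = 1 / ‖x‖ := by
    rw [Real.rpow_neg_one, one_div]
  have e2 : ‖x‖ ^ (-2 : ℝ) = 1 / ‖x‖ ^ 2 := by
    rw [Real.rpow_neg (norm_nonneg _), one_div]
    norm_cast
  simp only [Pi.add_apply, e1, e2]
  ring

/-! ### The Yukawa kernel is a fundamental solution -/

theorem contDiff_yukawa (lam : ℂ) {e : ℝ} (he : 0 < e) {n : WithTop ℕ∞} :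
    ContDiff ℝ n (yukawa lam e) :=
  contDiff_iff_contDiffAt.mpr fun x => contDiffAt_yukawa lam (by positivity)

/-- A bound that degenerates as `e → 0`; it serves only to justify integration by parts at a fixed
`e`. -/
theorem norm_fderiv_fderiv_yukawa_le {lam : ℂ} (hlam : 0 ≤ lam.re) {e : ℝ} (he : 0 < e)
    (x v : Space3) :
    ‖fderiv ℝ (fderiv ℝ (yukawa lam e)) x v v‖ ≤
      (4 * (‖lam‖ ^ 2 / √e + 3 * ‖lam‖ / √e ^ 2 + 3 / √e ^ 3)
        + 2 * (‖lam‖ / √e ^ 2 + 1 / √e ^ 3)) * ‖v‖ ^ 2 := by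
  have hx : 0 < ‖x‖ ^ 2 + e := by positivity
  have he' : 0 < √e := Real.sqrt_pos.mpr he
  have hs : √e ≤ √(‖x‖ ^ 2 + e) := Real.sqrt_le_sqrt (by linarith [sq_nonneg ‖x‖])
  have hxs : ‖x‖ ≤ √(‖x‖ ^ 2 + e) := Real.le_sqrt_of_sq_le (by linarith)
  have hs0 := he'.trans_le hs
  have key := fderiv_fderiv_radial hx (hasDerivAt_yukawaProfile lam) (hasDerivAt_yukawaProfile' lam) v
  change fderiv ℝ (fderiv ℝ (yukawa lam e)) x v v = _ at key
  rw [key]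
  have hexp := norm_exp_neg_mul_le hlam hs0.le
  simp only [yukawaProfile', yukawaProfile'']
  generalize √(‖x‖ ^ 2 + e) = s at *
  generalize √e = t at *
  have hns : ‖(s : ℂ)‖ = s := by rw [Complex.norm_real, Real.norm_of_nonneg hs0.le]
  have hpi : ∀ c : ℝ, 1 ≤ c → ‖((c : ℂ) * Real.pi)‖⁻¹ ≤ 1 := by
    intro c hc
    rw [norm_mul, Complex.norm_real, Complex.norm_real, Real.norm_of_nonneg Real.pi_pos.le,
      Real.norm_of_nonneg (by linarith)]
    apply inv_le_one_of_one_le₀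
    nlinarith [Real.pi_gt_three]
  have h8 := hpi 8 (by norm_num)
  have h16 := hpi 16 (by norm_num)
  push_cast at h8 h16
  have b2 : ‖-((lam / (s : ℂ) ^ 2 + 1 / (s : ℂ) ^ 3) * Complex.exp (-(lam * s)) / (8 * Real.pi))‖ ≤
      ‖lam‖ / t ^ 2 + 1 / t ^ 3 := by
    rw [norm_neg, div_eq_mul_inv, norm_mul, norm_mul, norm_inv]
    have : ‖lam / (s : ℂ) ^ 2 + 1 / (s : ℂ) ^ 3‖ ≤ ‖lam‖ / t ^ 2 + 1 / t ^ 3 := by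
      refine (norm_add_le _ _).trans ?_
      rw [norm_div, norm_div, norm_pow, norm_pow, norm_one, hns]
      gcongr
    calc _ ≤ (‖lam‖ / t ^ 2 + 1 / t ^ 3) * 1 * 1 := by gcongr
      _ = _ := by ring
  have b1 : ‖(lam ^ 2 / (s : ℂ) ^ 3 + 3 * lam / (s : ℂ) ^ 4 + 3 / (s : ℂ) ^ 5)
      * Complex.exp (-(lam * s)) / (16 * Real.pi)‖ ≤
      (‖lam‖ ^ 2 / t + 3 * ‖lam‖ / t ^ 2 + 3 / t ^ 3) / s ^ 2 := by
    rw [div_eq_mul_inv _ (16 * (Real.pi : ℂ)), norm_mul, norm_mul, norm_inv]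
    have : ‖lam ^ 2 / (s : ℂ) ^ 3 + 3 * lam / (s : ℂ) ^ 4 + 3 / (s : ℂ) ^ 5‖ ≤
        (‖lam‖ ^ 2 / t + 3 * ‖lam‖ / t ^ 2 + 3 / t ^ 3) / s ^ 2 := by
      refine norm_add₃_le.trans ?_
      simp only [norm_div, norm_pow, norm_mul, hns]
      have e3 : ‖(3 : ℂ)‖ = 3 := by simp
      rw [e3]
      have : ‖lam‖ ^ 2 / s ^ 3 + 3 * ‖lam‖ / s ^ 4 + 3 / s ^ 5 =
          (‖lam‖ ^ 2 / s + 3 * ‖lam‖ / s ^ 2 + 3 / s ^ 3) / s ^ 2 := by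
        field_simp
      rw [this]
      gcongr
    calc _ ≤ (‖lam‖ ^ 2 / t + 3 * ‖lam‖ / t ^ 2 + 3 / t ^ 3) / s ^ 2 * 1 * 1 := by gcongr
      _ = _ := by ring
  refine (norm_add_le _ _).trans ?_
  rw [norm_smul, norm_smul, Real.norm_of_nonneg (by positivity), Real.norm_of_nonneg (by positivity)]
  have hin : inner ℝ x v ^ 2 ≤ s ^ 2 * ‖v‖ ^ 2 := by
    rw [← mul_pow, ← sq_abs]
    gcongr
    exact (abs_real_inner_le_norm x v).trans (by gcongr)
  calc _ ≤ (4 * (s ^ 2 * ‖v‖ ^ 2)) * ((‖lam‖ ^ 2 / t + 3 * ‖lam‖ / t ^ 2 + 3 / t ^ 3) / s ^ 2)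
      + (2 * ‖v‖ ^ 2) * (‖lam‖ / t ^ 2 + 1 / t ^ 3) := by gcongr
    _ = _ := by
      field_simp
      
theorem norm_fderiv_yukawa_le_of_pos {lam : ℂ} (hlam : 0 ≤ lam.re) {e : ℝ} (he : 0 < e)
    (x v : Space3) :
    ‖fderiv ℝ (yukawa lam e) x v‖ ≤ 2 * (‖lam‖ / √e + 1 / √e ^ 2) * ‖v‖ := by
  have hx : 0 < ‖x‖ ^ 2 + e := by positivity
  have he' : 0 < √e := Real.sqrt_pos.mpr he
  have hs : √e ≤ √(‖x‖ ^ 2 + e) := Real.sqrt_le_sqrt (by linarith [sq_nonneg ‖x‖])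
  have hxs : ‖x‖ ≤ √(‖x‖ ^ 2 + e) := Real.le_sqrt_of_sq_le (by linarith)
  have hs0 := he'.trans_le hs
  rw [fderiv_yukawa lam hx, norm_smul]
  have hexp := norm_exp_neg_mul_le hlam hs0.le
  simp only [yukawaProfile']
  generalize √(‖x‖ ^ 2 + e) = s at *
  generalize √e = t at *
  have hns : ‖(s : ℂ)‖ = s := by rw [Complex.norm_real, Real.norm_of_nonneg hs0.le]
  have h8 : ‖(8 * Real.pi : ℂ)‖⁻¹ ≤ 1 := by
    rw [norm_mul, Complex.norm_real, Real.norm_of_nonneg Real.pi_pos.le]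
    apply inv_le_one_of_one_le₀
    simp
    nlinarith [Real.pi_gt_three]
  have b2 : ‖-((lam / (s : ℂ) ^ 2 + 1 / (s : ℂ) ^ 3) * Complex.exp (-(lam * s)) / (8 * Real.pi))‖ ≤
      (‖lam‖ / t + 1 / t ^ 2) / s := by
    rw [norm_neg, div_eq_mul_inv, norm_mul, norm_mul, norm_inv]
    have : ‖lam / (s : ℂ) ^ 2 + 1 / (s : ℂ) ^ 3‖ ≤ (‖lam‖ / t + 1 / t ^ 2) / s := by
      refine (norm_add_le _ _).trans ?_
      rw [norm_div, norm_div, norm_pow, norm_pow, norm_one, hns]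
      have : ‖lam‖ / s ^ 2 + 1 / s ^ 3 = (‖lam‖ / s + 1 / s ^ 2) / s := by field_simp
      rw [this]
      gcongr
    calc _ ≤ (‖lam‖ / t + 1 / t ^ 2) / s * 1 * 1 := by gcongr
      _ = _ := by ring
  have hin : ‖(2 * inner ℝ x v : ℝ)‖ ≤ 2 * (s * ‖v‖) := by
    rw [norm_mul, Real.norm_of_nonneg (by norm_num : (0:ℝ) ≤ 2)]
    gcongr
    exact (norm_inner_le_norm x v).trans (by gcongr)
  calc _ ≤ 2 * (s * ‖v‖) * ((‖lam‖ / t + 1 / t ^ 2) / s) := by gcongr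
    _ = _ := by field_simp

theorem norm_yukawa_le_of_pos {lam : ℂ} (hlam : 0 ≤ lam.re) {e : ℝ} (he : 0 < e) (x : Space3) :
    ‖yukawa lam e x‖ ≤ 1 / √e := by
  have he' : 0 < √e := Real.sqrt_pos.mpr he
  have hs : √e ≤ √(‖x‖ ^ 2 + e) := Real.sqrt_le_sqrt (by linarith [sq_nonneg ‖x‖])
  have hs0 := he'.trans_le hs
  simp only [yukawa, yukawaProfile]
  rw [norm_div, norm_mul, norm_mul, Complex.norm_real, Complex.norm_real, Real.norm_of_nonneg hs0.le,
    Real.norm_of_nonneg Real.pi_pos.le]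
  have h1 := norm_exp_neg_mul_le hlam hs0.le
  have h2 : ‖(4 : ℂ)‖ = 4 := by simp
  rw [h2]
  have h3 : √e ≤ 4 * Real.pi * √(‖x‖ ^ 2 + e) := by nlinarith [Real.pi_gt_three]
  gcongr

/-- Two integrations by parts in each coordinate; for `e > 0` the kernel has bounded derivatives, so
no boundary terms arise. -/
theorem integral_yukawa_mul_laplacian {lam : ℂ} (hlam : 0 ≤ lam.re) {e : ℝ} (he : 0 < e)
    (φ : 𝓢(Space3, ℂ)) :
    ∫ x, yukawa lam e x * (Δ φ) x = ∫ x, (Δ (yukawa lam e)) x * φ x := by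
  have hY : ∀ n : WithTop ℕ∞, ContDiff ℝ n (yukawa lam e) := fun n => contDiff_yukawa lam he
  have hY1 : Continuous (fderiv ℝ (yukawa lam e)) := (hY 1).continuous_fderiv (by norm_num)
  have hY' : ContDiff ℝ 1 (fderiv ℝ (yukawa lam e)) := (hY 2).fderiv_right (by norm_num)
  have hY2 : Continuous (fderiv ℝ (fderiv ℝ (yukawa lam e))) := hY'.continuous_fderiv (by norm_num)
  have i0 : ∀ ψ : 𝓢(Space3, ℂ), Integrable (fun x => yukawa lam e x * ψ x) := fun ψ =>
    ψ.integrable.bdd_mul (hY 0).continuous.aestronglyMeasurable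
      (Filter.Eventually.of_forall fun x => norm_yukawa_le_of_pos hlam he x)
  have i1 : ∀ (ψ : 𝓢(Space3, ℂ)) v, Integrable (fun x => fderiv ℝ (yukawa lam e) x v * ψ x) :=
    fun ψ v => ψ.integrable.bdd_mul (hY1.clm_apply continuous_const).aestronglyMeasurable
      (Filter.Eventually.of_forall fun x => norm_fderiv_yukawa_le_of_pos hlam he x v)
  have i2 : ∀ (ψ : 𝓢(Space3, ℂ)) v,
      Integrable (fun x => fderiv ℝ (fderiv ℝ (yukawa lam e)) x v v * ψ x) :=
    fun ψ v => ψ.integrable.bdd_mul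
      ((hY2.clm_apply continuous_const).clm_apply continuous_const).aestronglyMeasurable
      (Filter.Eventually.of_forall fun x => norm_fderiv_fderiv_yukawa_le hlam he x v)
  have hline : ∀ v : Space3, ∫ x, yukawa lam e x * (LineDeriv.lineDerivOp v (LineDeriv.lineDerivOp v φ)) x
      = ∫ x, fderiv ℝ (fderiv ℝ (yukawa lam e)) x v v * φ x := by
    intro v
    have hf2 : ∀ x, fderiv ℝ (fun y => fderiv ℝ (yukawa lam e) y v) x v =
        fderiv ℝ (fderiv ℝ (yukawa lam e)) x v v := by
      intro x
      rw [fderiv_clm_apply ((hY'.differentiable (by norm_num)) x) (differentiableAt_const v)]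
      simp
    have s1 := integral_mul_fderiv_eq_neg_fderiv_mul_of_integrable (μ := volume)
      (f := yukawa lam e) (g := ⇑(LineDeriv.lineDerivOp v φ)) (v := v)
      (i1 _ v) ((i0 (LineDeriv.lineDerivOp v (LineDeriv.lineDerivOp v φ))).congr
        (Filter.Eventually.of_forall fun x => by
          simp only [SchwartzMap.lineDerivOp_apply_eq_fderiv v (LineDeriv.lineDerivOp v φ)]))
      (i0 _) (fun x _ => (hY 1).differentiable (by norm_num) x)
      (fun x _ => (LineDeriv.lineDerivOp v φ).differentiable x)
    have s2 := integral_mul_fderiv_eq_neg_fderiv_mul_of_integrable (μ := volume)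
      (f := fun x => fderiv ℝ (yukawa lam e) x v) (g := ⇑φ) (v := v)
      ((i2 φ v).congr (Filter.Eventually.of_forall fun x => by simp only [hf2]))
      ((i1 (LineDeriv.lineDerivOp v φ) v).congr
        (Filter.Eventually.of_forall fun x => by
          simp only [SchwartzMap.lineDerivOp_apply_eq_fderiv v φ]))
      (i1 φ v)
      (fun x _ => ((hY'.differentiable (by norm_num)) x).clm_apply (differentiableAt_const v))
      (fun x _ => φ.differentiable x)
    simp only [SchwartzMap.lineDerivOp_apply_eq_fderiv v (LineDeriv.lineDerivOp v φ)]
    rw [s1]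
    simp only [SchwartzMap.lineDerivOp_apply_eq_fderiv v φ]
    rw [s2, neg_neg]
    simp only [hf2]
  have hb := SchwartzMap.laplacian_eq_sum (EuclideanSpace.basisFun (Fin 3) ℝ) φ
  rw [hb]
  simp only [InnerProductSpace.laplacian_eq_iteratedFDeriv_orthonormalBasis _
    (EuclideanSpace.basisFun (Fin 3) ℝ), iteratedFDeriv_two_apply, Matrix.cons_val_zero,
    Matrix.cons_val_one, sum_apply, Finset.mul_sum, Finset.sum_mul]
  rw [integral_finsetSum _ fun i _ => i0 _, integral_finsetSum _ fun i _ => i2 _ _]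
  exact Finset.sum_congr rfl fun i _ => hline _

/-- This is the singular part of `(λ² - Δ)` of the regularised kernel, rescaled to `ε = 1` with its
exponential removed. Its total mass 1 normalises the fundamental solution. -/
theorem integral_newton_profile :
    Integrable (fun x : Space3 => 3 / (4 * Real.pi * √(‖x‖ ^ 2 + 1) ^ 5)) ∧
    ∫ x : Space3, 3 / (4 * Real.pi * √(‖x‖ ^ 2 + 1) ^ 5) = 1 := by
  have hpos : ∀ t : ℝ, 0 < t ^ 2 + 1 := fun t => by positivity
  have hI : Integrable (fun x : Space3 => 3 / (4 * Real.pi * √(‖x‖ ^ 2 + 1) ^ 5)) := by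
    have h := (integrable_rpow_neg_one_add_norm_sq (E := Space3) (μ := volume) (r := 5)
      (by simp; norm_num)).const_mul (3 / (4 * Real.pi))
    refine h.congr (Filter.Eventually.of_forall fun x => ?_)
    have : √(‖x‖ ^ 2 + 1) ^ 5 = (1 + ‖x‖ ^ 2) ^ (5 / 2 : ℝ) := by
      rw [Real.sqrt_eq_rpow, ← Real.rpow_natCast, ← Real.rpow_mul (by positivity), add_comm]
      norm_num
    simp only [this]
    rw [neg_div, Real.rpow_neg (by positivity)]
    field_simp
  refine ⟨hI, ?_⟩
  have h1 := (integrable_fun_norm_addHaar (volume : Measure Space3)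
    (f := fun t : ℝ => 3 / (4 * Real.pi * √(t ^ 2 + 1) ^ 5))).mp hI
  rw [integral_fun_norm_addHaar (volume : Measure Space3)
    (fun t : ℝ => 3 / (4 * Real.pi * √(t ^ 2 + 1) ^ 5))]
  have hv : (volume : Measure Space3).real (Metric.ball 0 1) = Real.pi * 4 / 3 := by
    rw [measureReal_def, EuclideanSpace.volume_ball_fin_three]
    simp
    positivity
  rw [hv]
  simp only [finrank_euclideanSpace, Fintype.card_fin, smul_eq_mul] at h1 ⊢
  rw [show (3 - 1 : ℕ) = 2 from rfl] at h1 ⊢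
  -- In polar coordinates the radial integrand has this explicit primitive, with limit `1/(4π)` at
  -- infinity.
  have hd : ∀ t : ℝ, HasDerivAt (fun t : ℝ => t ^ 3 / √(t ^ 2 + 1) ^ 3 / (4 * Real.pi))
      (t ^ 2 * (3 / (4 * Real.pi * √(t ^ 2 + 1) ^ 5))) t := by
    intro t
    have hs := Real.sqrt_pos.mpr (hpos t)
    have d1 : HasDerivAt (fun t : ℝ => √(t ^ 2 + 1)) (t / √(t ^ 2 + 1)) t := by
      have := ((hasDerivAt_pow 2 t).add_const 1).sqrt (hpos t).ne'
      refine this.congr_deriv ?_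
      field_simp
      norm_num
    have d2 : HasDerivAt (fun t : ℝ => √(t ^ 2 + 1) ^ 3) _ t := d1.pow 3
    have := ((hasDerivAt_pow 3 t).div d2 (by positivity)).div_const (4 * Real.pi)
    refine this.congr_deriv ?_
    have hsq : √(t ^ 2 + 1) ^ 2 = t ^ 2 + 1 := Real.sq_sqrt (hpos t).le
    generalize √(t ^ 2 + 1) = s at *
    field_simp
    simp
    linear_combination (3 * t ^ 2 * s ^ 2) * hsq
  have hlim : Filter.Tendsto (fun t : ℝ => t ^ 3 / √(t ^ 2 + 1) ^ 3 / (4 * Real.pi)) Filter.atTop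
      (nhds (1 / (4 * Real.pi))) := by
    apply Filter.Tendsto.div_const
    have h2 : Filter.Tendsto (fun t : ℝ => √(1 - 1 / (t ^ 2 + 1)) ^ 3) Filter.atTop
        (nhds (√(1 - 0) ^ 3)) := by
      apply Filter.Tendsto.pow
      apply (Real.continuous_sqrt.tendsto _).comp
      apply Filter.Tendsto.const_sub
      apply Filter.Tendsto.div_atTop tendsto_const_nhds
      apply Filter.tendsto_atTop_add_const_right
      exact Filter.tendsto_pow_atTop (by norm_num)
    simp only [sub_zero, Real.sqrt_one, one_pow] at h2
    refine h2.congr' ?_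
    filter_upwards [Filter.eventually_ge_atTop 0] with t ht
    have : 1 - 1 / (t ^ 2 + 1) = t ^ 2 / (t ^ 2 + 1) := by
      have := (hpos t).ne'
      field_simp
      ring
    rw [this, Real.sqrt_div (sq_nonneg t), Real.sqrt_sq ht, div_pow]
  rw [integral_Ioi_of_hasDerivAt_of_tendsto (hd 0).continuousAt.continuousWithinAt
    (fun t _ => hd t) h1 hlim]
  have := Real.pi_pos
  simp
  field_simp

theorem continuousAt_yukawaProfile (lam : ℂ) {q : ℝ} (hq : 0 < q) :
    ContinuousAt (yukawaProfile lam) q :=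
  (hasDerivAt_yukawaProfile lam q hq).continuousAt

theorem ae_ne_zero : ∀ᵐ x : Space3, x ≠ 0 := by
  rw [ae_iff]
  simp

/-- The less singular part of `(λ² - Δ)` applied to the regularised kernel. -/
theorem tendsto_integral_yukawa_remainder {lam : ℂ} (hlam : 0 ≤ lam.re) (φ : 𝓢(Space3, ℂ)) :
    Filter.Tendsto (fun ε : ℝ => ∫ x : Space3,
      (ε : ℂ) ^ 2 * (lam ^ 2 / (√(‖x‖ ^ 2 + ε ^ 2) : ℝ) ^ 3 + 3 * lam / (√(‖x‖ ^ 2 + ε ^ 2) : ℝ) ^ 4)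
        * Complex.exp (-(lam * (√(‖x‖ ^ 2 + ε ^ 2) : ℝ))) / (4 * Real.pi) * φ x)
      (nhdsWithin 0 (Set.Ioi 0)) (nhds 0) := by
  have hpi : ‖(4 * Real.pi : ℂ)‖⁻¹ ≤ 1 := by
    rw [norm_mul, Complex.norm_real, Real.norm_of_nonneg Real.pi_pos.le]
    apply inv_le_one_of_one_le₀
    simp
    nlinarith [Real.pi_gt_three]
  -- Each term is `ε²/s² ≤ 1` times a function with a singularity of order at most 2, integrable in
  -- dimension three; the first factor tends to 0 off the origin.
  have hb : ∀ ε : ℝ, ∀ x : Space3, x ≠ 0 →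
      ‖(ε : ℂ) ^ 2 * (lam ^ 2 / (√(‖x‖ ^ 2 + ε ^ 2) : ℝ) ^ 3 + 3 * lam / (√(‖x‖ ^ 2 + ε ^ 2) : ℝ) ^ 4)
        * Complex.exp (-(lam * (√(‖x‖ ^ 2 + ε ^ 2) : ℝ))) / (4 * Real.pi) * φ x‖ ≤
      ε ^ 2 / (‖x‖ ^ 2 + ε ^ 2) * ((‖lam‖ ^ 2 / ‖x‖ + (3 * ‖lam‖) / ‖x‖ ^ 2) * ‖φ x‖) := by
    intro ε x hx
    have hx' : 0 < ‖x‖ := norm_pos_iff.mpr hx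
    have hxs : ‖x‖ ≤ √(‖x‖ ^ 2 + ε ^ 2) := Real.le_sqrt_of_sq_le (by nlinarith)
    have hs0 := hx'.trans_le hxs
    have hexp := norm_exp_neg_mul_le hlam hs0.le
    have hsq : √(‖x‖ ^ 2 + ε ^ 2) ^ 2 = ‖x‖ ^ 2 + ε ^ 2 := Real.sq_sqrt (by positivity)
    rw [← hsq, Real.sqrt_sq hs0.le]
    generalize √(‖x‖ ^ 2 + ε ^ 2) = s at *
    have hns : ‖(s : ℂ)‖ = s := by rw [Complex.norm_real, Real.norm_of_nonneg hs0.le]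
    have e3 : ‖(3 : ℂ)‖ = 3 := by simp
    have h1 : ‖lam ^ 2 / (s : ℂ) ^ 3 + 3 * lam / (s : ℂ) ^ 4‖ ≤
        (‖lam‖ ^ 2 / ‖x‖ + (3 * ‖lam‖) / ‖x‖ ^ 2) / s ^ 2 := by
      refine (norm_add_le _ _).trans ?_
      simp only [norm_div, norm_pow, norm_mul, hns, e3]
      have : ‖lam‖ ^ 2 / s ^ 3 + 3 * ‖lam‖ / s ^ 4 =
          (‖lam‖ ^ 2 / s + 3 * ‖lam‖ / s ^ 2) / s ^ 2 := by
        field_simp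
      rw [this]
      gcongr
    rw [norm_mul, div_eq_mul_inv _ (4 * (Real.pi : ℂ)), norm_mul, norm_mul, norm_mul, norm_inv,
      norm_pow, Complex.norm_real, Real.norm_eq_abs, sq_abs]
    calc _ ≤ ε ^ 2 * ((‖lam‖ ^ 2 / ‖x‖ + (3 * ‖lam‖) / ‖x‖ ^ 2) / s ^ 2) * 1 * 1 * ‖φ x‖ := by
          gcongr
      _ = _ := by ring
  have hcoef : ∀ ε : ℝ, ∀ x : Space3, x ≠ 0 → ε ^ 2 / (‖x‖ ^ 2 + ε ^ 2) ≤ 1 := by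
    intro ε x hx
    have hx' : 0 < ‖x‖ := norm_pos_iff.mpr hx
    rw [div_le_one (by positivity)]
    nlinarith
  rw [show (0 : ℂ) = ∫ _ : Space3, (0 : ℂ) by simp]
  refine tendsto_integral_filter_of_dominated_convergence
    (fun x => (‖lam‖ ^ 2 / ‖x‖ + (3 * ‖lam‖) / ‖x‖ ^ 2) * ‖φ x‖) ?_ ?_
    (integrable_inv_norm_mul_schwartz φ _ _) ?_
  · refine Filter.Eventually.of_forall fun ε => ?_
    have := φ.continuous.measurable
    exact Measurable.aestronglyMeasurable (by fun_prop)
  · refine Filter.Eventually.of_forall fun ε => ?_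
    filter_upwards [ae_ne_zero] with x hx
    refine (hb ε x hx).trans ?_
    have : 0 ≤ (‖lam‖ ^ 2 / ‖x‖ + (3 * ‖lam‖) / ‖x‖ ^ 2) * ‖φ x‖ := by positivity
    exact mul_le_of_le_one_left this (hcoef ε x hx)
  · filter_upwards [ae_ne_zero] with x hx
    have hx' : 0 < ‖x‖ := norm_pos_iff.mpr hx
    apply squeeze_zero_norm (fun ε => hb ε x hx)
    have : Filter.Tendsto (fun ε : ℝ => ε ^ 2 / (‖x‖ ^ 2 + ε ^ 2)
        * ((‖lam‖ ^ 2 / ‖x‖ + (3 * ‖lam‖) / ‖x‖ ^ 2) * ‖φ x‖)) (nhds 0)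
        (nhds (0 ^ 2 / (‖x‖ ^ 2 + 0 ^ 2)
        * ((‖lam‖ ^ 2 / ‖x‖ + (3 * ‖lam‖) / ‖x‖ ^ 2) * ‖φ x‖))) := by
      apply Filter.Tendsto.mul_const
      apply Filter.Tendsto.div
      · exact (continuous_pow 2).tendsto 0
      · exact ((continuous_pow 2).tendsto 0).const_add _
      · positivity
    simp at this
    exact this.mono_left nhdsWithin_le_nhds

/-- The singular part of `(λ² - Δ)` applied to the regularised kernel is an approximate
identity. -/
theorem tendsto_integral_yukawa_delta {lam : ℂ} (hlam : 0 ≤ lam.re) (φ : 𝓢(Space3, ℂ)) :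
    Filter.Tendsto (fun ε : ℝ => ∫ x : Space3,
      (ε : ℂ) ^ 2 * (3 / (√(‖x‖ ^ 2 + ε ^ 2) : ℝ) ^ 5)
        * Complex.exp (-(lam * (√(‖x‖ ^ 2 + ε ^ 2) : ℝ))) / (4 * Real.pi) * φ x)
      (nhdsWithin 0 (Set.Ioi 0)) (nhds (φ 0)) := by
  -- Substituting `εx` for `x` turns `s` into `ε√(‖x‖²+1)`; all powers of `ε` cancel, leaving a
  -- fixed mass-one profile.
  have hscale : ∀ ε : ℝ, 0 < ε → ∫ x : Space3,
      (ε : ℂ) ^ 2 * (3 / (√(‖x‖ ^ 2 + ε ^ 2) : ℝ) ^ 5)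
        * Complex.exp (-(lam * (√(‖x‖ ^ 2 + ε ^ 2) : ℝ))) / (4 * Real.pi) * φ x =
      ∫ x : Space3, ((3 / (4 * Real.pi * √(‖x‖ ^ 2 + 1) ^ 5) : ℝ) : ℂ)
        * (Complex.exp (-(lam * ((ε * √(‖x‖ ^ 2 + 1) : ℝ) : ℂ))) * φ (ε • x)) := by
    intro ε hε
    have h1 := Measure.integral_comp_smul (volume : Measure Space3) (fun x : Space3 =>
      (ε : ℂ) ^ 2 * (3 / (√(‖x‖ ^ 2 + ε ^ 2) : ℝ) ^ 5)
        * Complex.exp (-(lam * (√(‖x‖ ^ 2 + ε ^ 2) : ℝ))) / (4 * Real.pi) * φ x) ε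
    have h2 : |(ε ^ Module.finrank ℝ Space3)⁻¹| = (ε ^ 3)⁻¹ := by
      rw [abs_of_pos (by positivity)]
      simp
    rw [h2] at h1
    have h3 : ∀ I J : ℂ, J = (ε ^ 3)⁻¹ • I → I = (ε ^ 3) • J := by
      intro I J h
      rw [h, smul_smul, mul_inv_cancel₀ (by positivity), one_smul]
    rw [h3 _ _ h1, ← integral_smul]
    congr 1
    ext x
    have h4 : √(‖ε • x‖ ^ 2 + ε ^ 2) = ε * √(‖x‖ ^ 2 + 1) := by
      rw [norm_smul, Real.norm_of_nonneg hε.le,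
        show (ε * ‖x‖) ^ 2 + ε ^ 2 = ε ^ 2 * (‖x‖ ^ 2 + 1) by ring,
        Real.sqrt_mul (by positivity), Real.sqrt_sq hε.le]
    rw [h4]
    have h5 : 0 < √(‖x‖ ^ 2 + 1) := Real.sqrt_pos.mpr (by positivity)
    have h6 : (√(‖x‖ ^ 2 + 1) : ℂ) ≠ 0 := by exact_mod_cast h5.ne'
    have h7 : (ε : ℂ) ≠ 0 := by exact_mod_cast hε.ne'
    have hpi : (Real.pi : ℂ) ≠ 0 := by simp [Real.pi_ne_zero]
    rw [Complex.real_smul]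
    push_cast
    field_simp
  obtain ⟨hI, hone⟩ := integral_newton_profile
  have hlimval : φ 0 = ∫ x : Space3, ((3 / (4 * Real.pi * √(‖x‖ ^ 2 + 1) ^ 5) : ℝ) : ℂ) * φ 0 := by
    rw [integral_mul_const, integral_complex_ofReal, hone]
    simp
  rw [hlimval]
  have key : Filter.Tendsto (fun ε : ℝ =>
      ∫ x : Space3, ((3 / (4 * Real.pi * √(‖x‖ ^ 2 + 1) ^ 5) : ℝ) : ℂ)
        * (Complex.exp (-(lam * ((ε * √(‖x‖ ^ 2 + 1) : ℝ) : ℂ))) * φ (ε • x)))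
      (nhdsWithin 0 (Set.Ioi 0))
      (nhds (∫ x : Space3, ((3 / (4 * Real.pi * √(‖x‖ ^ 2 + 1) ^ 5) : ℝ) : ℂ) * φ 0)) := by
    refine tendsto_integral_filter_of_dominated_convergence
      (fun x => (3 / (4 * Real.pi * √(‖x‖ ^ 2 + 1) ^ 5)) * SchwartzMap.seminorm ℝ 0 0 φ) ?_ ?_
      (hI.mul_const _) ?_
    · refine Filter.Eventually.of_forall fun ε => ?_
      have := φ.continuous.measurable
      exact Measurable.aestronglyMeasurable (by fun_prop)
    · filter_upwards [self_mem_nhdsWithin] with ε hε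
      refine Filter.Eventually.of_forall fun x => ?_
      have hε' : 0 < ε := hε
      rw [norm_mul, norm_mul, Complex.norm_real, Real.norm_of_nonneg (by positivity)]
      have h1 := norm_exp_neg_mul_le hlam (s := ε * √(‖x‖ ^ 2 + 1)) (by positivity)
      have h2 := SchwartzMap.norm_le_seminorm ℝ φ (ε • x)
      gcongr
      calc _ ≤ 1 * SchwartzMap.seminorm ℝ 0 0 φ := by gcongr
        _ = _ := one_mul _
    · refine Filter.Eventually.of_forall fun x => ?_
      apply Filter.Tendsto.const_mul
      have hc : Continuous (fun ε : ℝ =>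
          Complex.exp (-(lam * ((ε * √(‖x‖ ^ 2 + 1) : ℝ) : ℂ))) * φ (ε • x)) := by
        have := φ.continuous
        fun_prop
      have := hc.tendsto 0
      simp only [zero_mul, Complex.ofReal_zero, mul_zero, neg_zero, Complex.exp_zero, zero_smul,
        one_mul] at this
      exact this.mono_left nhdsWithin_le_nhds
  refine key.congr' ?_
  filter_upwards [self_mem_nhdsWithin] with ε hε
  exact (hscale ε hε).symm

theorem integrable_yukawa_mul {lam : ℂ} (hlam : 0 ≤ lam.re) (φ : 𝓢(Space3, ℂ)) :
    Integrable (fun x => yukawa lam 0 x * φ x) := by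
  refine (integrable_inv_norm_mul_schwartz φ 1 0).mono' ?_ ?_
  · have := φ.continuous.measurable
    unfold yukawa yukawaProfile
    exact Measurable.aestronglyMeasurable (by fun_prop)
  · filter_upwards [ae_ne_zero] with x hx
    rw [norm_mul]
    have := norm_yukawa_le hlam le_rfl hx
    gcongr
    simpa using this

/-- The Yukawa kernel is a fundamental solution of `λ² - Δ`. -/
theorem integral_yukawa_mul_schwartz {lam : ℂ} (hlam : 0 ≤ lam.re) (φ : 𝓢(Space3, ℂ)) :
    ∫ x, yukawa lam 0 x * (lam ^ 2 • φ - Δ φ) x = φ 0 := by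
  set g : 𝓢(Space3, ℂ) := lam ^ 2 • φ - Δ φ with hg
  have hmeasY : ∀ e : ℝ, Measurable (yukawa lam e) := by
    intro e
    unfold yukawa yukawaProfile
    fun_prop
  -- The same regularised integral has two limits: directly, by dominated convergence, and after
  -- integration by parts, as vanishing remainder plus approximate identity.
  have hleft : Filter.Tendsto (fun ε : ℝ => ∫ x, yukawa lam (ε ^ 2) x * g x)
      (nhdsWithin 0 (Set.Ioi 0)) (nhds (∫ x, yukawa lam 0 x * g x)) := by
    refine tendsto_integral_filter_of_dominated_convergence
      (fun x => (1 / ‖x‖ + 0 / ‖x‖ ^ 2) * ‖g x‖) ?_ ?_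
      (integrable_inv_norm_mul_schwartz g _ _) ?_
    · refine Filter.Eventually.of_forall fun ε => ?_
      exact ((hmeasY _).mul g.continuous.measurable).aestronglyMeasurable
    · refine Filter.Eventually.of_forall fun ε => ?_
      filter_upwards [ae_ne_zero] with x hx
      rw [norm_mul]
      have := norm_yukawa_le hlam (sq_nonneg ε) hx
      gcongr
      simpa using this
    · filter_upwards [ae_ne_zero] with x hx
      have hx' : 0 < ‖x‖ := norm_pos_iff.mpr hx
      apply Filter.Tendsto.mul_const
      have h1 : Filter.Tendsto (fun ε : ℝ => ‖x‖ ^ 2 + ε ^ 2) (nhdsWithin 0 (Set.Ioi 0))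
          (nhds (‖x‖ ^ 2 + 0)) := by
        apply Filter.Tendsto.const_add
        have := (continuous_pow 2).tendsto (0 : ℝ)
        simp only [ne_eq, OfNat.ofNat_ne_zero, not_false_eq_true, zero_pow] at this
        exact this.mono_left nhdsWithin_le_nhds
      exact (continuousAt_yukawaProfile lam (by positivity : 0 < ‖x‖ ^ 2 + 0)).tendsto.comp h1
  have hright := (tendsto_integral_yukawa_remainder hlam φ).add (tendsto_integral_yukawa_delta hlam φ)
  rw [zero_add] at hright
  refine tendsto_nhds_unique hleft (hright.congr' ?_)
  filter_upwards [self_mem_nhdsWithin] with ε hε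
  have hε' : 0 < ε := hε
  have he : 0 < ε ^ 2 := by positivity
  have hparts := integral_yukawa_mul_laplacian hlam he φ
  have hbd : ∀ ψ : 𝓢(Space3, ℂ), Integrable (fun x => yukawa lam (ε ^ 2) x * ψ x) := fun ψ =>
    ψ.integrable.bdd_mul (hmeasY _).aestronglyMeasurable
      (Filter.Eventually.of_forall fun x => norm_yukawa_le_of_pos hlam he x)
  have hs : ∀ x : Space3, ε ≤ √(‖x‖ ^ 2 + ε ^ 2) := fun x =>
    Real.le_sqrt_of_sq_le (by linarith [sq_nonneg ‖x‖])
  have hpow : ∀ (c : ℂ) (n : ℕ), Integrable (fun x : Space3 =>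
      c / (√(‖x‖ ^ 2 + ε ^ 2) : ℝ) ^ n * Complex.exp (-(lam * (√(‖x‖ ^ 2 + ε ^ 2) : ℝ))) * φ x) := by
    intro c n
    apply φ.integrable.bdd_mul (c := ‖c‖ / ε ^ n)
    · exact Measurable.aestronglyMeasurable (by fun_prop)
    · refine Filter.Eventually.of_forall fun x => ?_
      have h0 : 0 < √(‖x‖ ^ 2 + ε ^ 2) := hε'.trans_le (hs x)
      rw [norm_mul, norm_div, norm_pow, Complex.norm_real, Real.norm_of_nonneg h0.le]
      have h1 := norm_exp_neg_mul_le hlam h0.le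
      calc _ ≤ ‖c‖ / ε ^ n * 1 := by
            gcongr
            exact hs x
        _ = _ := mul_one _
  rw [← integral_add]
  · have e1 : ∀ x, yukawa lam (ε ^ 2) x * g x =
        lam ^ 2 * (yukawa lam (ε ^ 2) x * φ x) - yukawa lam (ε ^ 2) x * (Δ φ) x := by
      intro x
      simp only [hg, sub_apply, smul_apply, smul_eq_mul]
      ring
    simp only [e1]
    rw [integral_sub ((hbd φ).const_mul _) (hbd _), hparts, ← integral_sub ((hbd φ).const_mul _)]
    · congr 1
      ext x
      rw [laplacian_yukawa lam (by positivity : 0 < ‖x‖ ^ 2 + ε ^ 2)]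
      simp only [yukawaProfile'']
      have hpi : (Real.pi : ℂ) ≠ 0 := by simp [Real.pi_ne_zero]
      push_cast
      field_simp
      ring
    · have : ∀ x, (Δ (yukawa lam (ε ^ 2))) x * φ x = lam ^ 2 * (yukawa lam (ε ^ 2) x * φ x)
          - (ε ^ 2 / (4 * Real.pi)) *
          (lam ^ 2 / (√(‖x‖ ^ 2 + ε ^ 2) : ℝ) ^ 3 * Complex.exp (-(lam * (√(‖x‖ ^ 2 + ε ^ 2) : ℝ))) * φ x
          + 3 * lam / (√(‖x‖ ^ 2 + ε ^ 2) : ℝ) ^ 4 * Complex.exp (-(lam * (√(‖x‖ ^ 2 + ε ^ 2) : ℝ))) * φ x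
          + 3 / (√(‖x‖ ^ 2 + ε ^ 2) : ℝ) ^ 5 * Complex.exp (-(lam * (√(‖x‖ ^ 2 + ε ^ 2) : ℝ))) * φ x) := by
        intro x
        rw [laplacian_yukawa lam (by positivity : 0 < ‖x‖ ^ 2 + ε ^ 2)]
        simp only [yukawaProfile'']
        have hpi : (Real.pi : ℂ) ≠ 0 := by simp [Real.pi_ne_zero]
        push_cast
        field_simp
        ring
      simp only [this]
      exact ((hbd φ).const_mul _).sub ((((hpow _ _).add (hpow _ _)).add (hpow _ _)).const_mul _)
  · refine (((hpow (lam ^ 2) 3).add (hpow (3 * lam) 4)).const_mul (ε ^ 2 / (4 * Real.pi) : ℂ)).congr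
      (Filter.Eventually.of_forall fun x => ?_)
    simp only [Pi.add_apply]
    ring
  · refine ((hpow 3 5).const_mul (ε ^ 2 / (4 * Real.pi) : ℂ)).congr
      (Filter.Eventually.of_forall fun x => ?_)
    simp only
    ring

/-! ### The fundamental solution of the plate operator -/

/-- `(e^{iκr} - e^{-κr}) / (8π κ² r)`, a fundamental solution of `Δ² - κ⁴`. -/
noncomputable def plateKernel (κ : ℂ) (x : Space3) : ℂ :=
  (yukawa (-(Complex.I * κ)) 0 x - yukawa κ 0 x) / (2 * κ ^ 2)

theorem laplacian_schwartz_sub (φ ψ : 𝓢(Space3, ℂ)) : Δ (φ - ψ) = Δ φ - Δ ψ := by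
  simp only [← SchwartzMap.laplacianCLM_eq (𝕜 := ℂ), map_sub]

theorem laplacian_schwartz_smul (c : ℂ) (φ : 𝓢(Space3, ℂ)) : Δ (c • φ) = c • Δ φ := by
  simp only [← SchwartzMap.laplacianCLM_eq (𝕜 := ℂ), map_smul]

/-- The operator factors as `Δ² - κ⁴ = (-κ² - Δ)(κ² - Δ)`. Testing each Yukawa kernel against the
other factor applied to `φ` gives `±κ²φ(0) - Δφ(0)`; the difference is `2κ²φ(0)`. -/
theorem integral_plateKernel_mul_zero {κ : ℂ} (hre : 0 ≤ κ.re) (him : 0 ≤ κ.im) (h0 : κ ≠ 0)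
    (φ : 𝓢(Space3, ℂ)) :
    ∫ x, plateKernel κ x * (Δ (Δ φ) - κ ^ 4 • φ) x = φ 0 := by
  have hre1 : 0 ≤ (-(Complex.I * κ)).re := by simpa using him
  have h1 := integral_yukawa_mul_schwartz hre1 (κ ^ 2 • φ - Δ φ)
  have h2 := integral_yukawa_mul_schwartz hre (-κ ^ 2 • φ - Δ φ)
  have hI : (-(Complex.I * κ)) ^ 2 = -κ ^ 2 := by
    rw [neg_sq, mul_pow, Complex.I_sq]; ring
  have e1 : (-(Complex.I * κ)) ^ 2 • (κ ^ 2 • φ - Δ φ) - Δ (κ ^ 2 • φ - Δ φ) =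
      Δ (Δ φ) - κ ^ 4 • φ := by
    rw [hI, laplacian_schwartz_sub, laplacian_schwartz_smul]
    module
  have e2 : κ ^ 2 • (-κ ^ 2 • φ - Δ φ) - Δ (-κ ^ 2 • φ - Δ φ) = Δ (Δ φ) - κ ^ 4 • φ := by
    rw [laplacian_schwartz_sub, laplacian_schwartz_smul]
    module
  rw [e1] at h1
  rw [e2] at h2
  have e3 : ∀ x, plateKernel κ x * (Δ (Δ φ) - κ ^ 4 • φ) x =
      (yukawa (-(Complex.I * κ)) 0 x * (Δ (Δ φ) - κ ^ 4 • φ) x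
        - yukawa κ 0 x * (Δ (Δ φ) - κ ^ 4 • φ) x) / (2 * κ ^ 2) := by
    intro x
    simp only [plateKernel]
    ring
  simp only [e3]
  rw [integral_div, integral_sub (integrable_yukawa_mul hre1 _) (integrable_yukawa_mul hre _), h1, h2]
  simp only [sub_apply, smul_apply, smul_eq_mul]
  field_simp
  ring

theorem lineDerivOp_compSubConst (φ : 𝓢(Space3, ℂ)) (a v : Space3) :
    LineDeriv.lineDerivOp v (φ.compSubConstCLM ℂ a) =
      (LineDeriv.lineDerivOp v φ).compSubConstCLM ℂ a := by
  ext x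
  rw [SchwartzMap.lineDerivOp_apply_eq_fderiv, SchwartzMap.compSubConstCLM_apply,
    SchwartzMap.lineDerivOp_apply_eq_fderiv]
  have : (⇑(φ.compSubConstCLM ℂ a) : Space3 → ℂ) = fun x => φ (x - a) := by
    ext x
    rfl
  rw [this, fderiv_comp_sub]

theorem laplacian_compSubConst (φ : 𝓢(Space3, ℂ)) (a : Space3) :
    Δ (φ.compSubConstCLM ℂ a) = (Δ φ).compSubConstCLM ℂ a := by
  simp only [SchwartzMap.laplacian_eq_sum (EuclideanSpace.basisFun (Fin 3) ℝ),
    lineDerivOp_compSubConst, map_sum]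

theorem integral_plateKernel_mul {κ : ℂ} (hre : 0 ≤ κ.re) (him : 0 ≤ κ.im) (h0 : κ ≠ 0)
    (φ : 𝓢(Space3, ℂ)) (x : Space3) :
    ∫ y, plateKernel κ (y - x) * (Δ (Δ φ) - κ ^ 4 • φ) y = φ x := by
  have h := integral_plateKernel_mul_zero hre him h0 (φ.compSubConstCLM ℂ (-x))
  rw [laplacian_compSubConst, laplacian_compSubConst, ← map_smul, ← map_sub] at h
  simp only [SchwartzMap.compSubConstCLM_apply] at h
  rw [zero_sub, neg_neg] at h
  rw [← h, ← integral_sub_right_eq_self (μ := volume)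
    (fun y => plateKernel κ y * (Δ (Δ φ) - κ ^ 4 • φ) (y - -x)) x]
  simp

/-! ### Solvability of the plate equation in Schwartz space -/

/-- Differentiating `(t-c)⁻ⁿ` gives `-n(t-c)⁻ⁿ⁻¹`, and `|t - c| ≥ |Im c|`. The induction runs over
all exponents simultaneously. -/
theorem hasTemperateGrowth_inv_sub {c : ℂ} (hc : c.im ≠ 0) :
    Function.HasTemperateGrowth (fun t : ℝ => ((t : ℂ) - c)⁻¹) := by
  have hne : ∀ t : ℝ, (t : ℂ) - c ≠ 0 := by
    intro t h
    apply hc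
    have := congrArg Complex.im h
    simpa using this
  have hlow : ∀ t : ℝ, ‖((t : ℂ) - c)⁻¹‖ ≤ |c.im|⁻¹ := by
    intro t
    rw [norm_inv]
    apply inv_anti₀ (abs_pos.mpr hc)
    have := Complex.abs_im_le_norm ((t : ℂ) - c)
    simpa using this
  have hcd : ∀ n : ℕ, ContDiff ℝ (⊤ : ℕ∞) (fun t : ℝ => (((t : ℂ) - c)⁻¹) ^ n) := by
    intro n
    apply ContDiff.pow
    apply ContDiff.inv _ hne
    exact Complex.ofRealCLM.contDiff.sub contDiff_const
  have hder : ∀ n : ℕ, deriv (fun t : ℝ => (((t : ℂ) - c)⁻¹) ^ n) =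
      fun t : ℝ => (-n : ℂ) * (((t : ℂ) - c)⁻¹) ^ (n + 1) := by
    intro n
    ext t
    have h1 : HasDerivAt (fun t : ℝ => (t : ℂ) - c) 1 t := (Complex.ofRealCLM.hasDerivAt).sub_const c
    have h2 : HasDerivAt (fun t : ℝ => ((t : ℂ) - c)⁻¹) _ t := h1.inv (hne t)
    have h3 : HasDerivAt (fun t : ℝ => (((t : ℂ) - c)⁻¹) ^ n) _ t := h2.pow n
    rw [h3.deriv]
    rcases n with _ | n
    · simp
    · have := hne t
      simp
      field_simp
      ring
  have hbd : ∀ N n : ℕ, ∃ C, ∀ t : ℝ,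
      ‖iteratedDeriv N (fun t : ℝ => (((t : ℂ) - c)⁻¹) ^ n) t‖ ≤ C := by
    intro N
    induction N with
    | zero =>
      intro n
      refine ⟨|c.im|⁻¹ ^ n, fun t => ?_⟩
      rw [iteratedDeriv_zero, norm_pow]
      exact pow_le_pow_left₀ (norm_nonneg _) (hlow t) n
    | succ N ih =>
      intro n
      obtain ⟨C, hC⟩ := ih (n + 1)
      refine ⟨‖(-n : ℂ)‖ * C, fun t => ?_⟩
      rw [iteratedDeriv_succ', hder, iteratedDeriv_const_mul_field, norm_mul]
      gcongr
      exact hC t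
  refine ⟨by simpa using hcd 1, fun n => ?_⟩
  obtain ⟨C, hC⟩ := hbd n 1
  refine ⟨0, C, fun t => ?_⟩
  rw [norm_iteratedFDeriv_eq_norm_iteratedDeriv]
  simpa using hC t

/-- The symbol `(2π|ξ|)⁴ - c` has no real zero when `c` is not real, so its inverse is an admissible
Fourier multiplier. Solvability for every right-hand side is what gives uniqueness by duality. -/
theorem exists_schwartz_solution {c : ℂ} (hc : c.im ≠ 0) (φ : 𝓢(Space3, ℂ)) :
    ∃ ψ : 𝓢(Space3, ℂ), Δ (Δ ψ) - c • ψ = φ := by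
  set r : Space3 → ℂ := fun x => RCLike.ofReal (K := ℂ) (‖x‖ ^ 2) with hrdef
  have hr : Function.HasTemperateGrowth r := by fun_prop
  have hq : Function.HasTemperateGrowth (fun x : Space3 => (2 * Real.pi) ^ 4 * (‖x‖ ^ 2) ^ 2) :=
    (Function.HasTemperateGrowth.const _).mul ((by fun_prop :
      Function.HasTemperateGrowth (fun x : Space3 => ‖x‖ ^ 2)).pow 2)
  set m : Space3 → ℂ := fun x => ((((2 * Real.pi) ^ 4 * (‖x‖ ^ 2) ^ 2 : ℝ) : ℂ) - c)⁻¹ with hm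
  have hmg : Function.HasTemperateGrowth m := (hasTemperateGrowth_inv_sub hc).comp hq
  have hlap : ∀ f : 𝓢(Space3, ℂ), Δ f = (-(2 * Real.pi) ^ 2 : ℂ) •
      SchwartzMap.fourierMultiplierCLM ℂ r f := by
    intro f
    have h2 : SchwartzMap.fourierMultiplierCLM ℂ r f =
        SchwartzMap.fourierMultiplierCLM ℂ (fun x : Space3 => ‖x‖ ^ 2) f :=
      SchwartzMap.fourierMultiplierCLM_ofReal ℂ (by fun_prop) f
    rw [SchwartzMap.laplacian_eq_fourierMultiplierCLM, h2]
    ext x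
    simp
  refine ⟨SchwartzMap.fourierMultiplierCLM ℂ m φ, ?_⟩
  rw [hlap (SchwartzMap.fourierMultiplierCLM ℂ m φ), laplacian_schwartz_smul, hlap,
    SchwartzMap.fourierMultiplierCLM_fourierMultiplierCLM_apply hr hmg,
    SchwartzMap.fourierMultiplierCLM_fourierMultiplierCLM_apply hr (hr.mul hmg), smul_smul]
  simp only [SchwartzMap.fourierMultiplierCLM_apply]
  rw [← FourierTransform.fourierInv_smul, ← FourierTransform.fourierInv_smul]
  have hsub : ∀ F G : 𝓢(Space3, ℂ), FourierTransform.fourierInv F - FourierTransform.fourierInv G =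
      (FourierTransform.fourierInv (F - G) : 𝓢(Space3, ℂ)) := fun F G =>
    (map_sub (FourierTransform.fourierInvCLM ℂ 𝓢(Space3, ℂ)) F G).symm
  rw [hsub]
  conv_rhs => rw [← FourierTransform.fourierInv_fourier_eq (F := 𝓢(Space3, ℂ)) φ]
  congr 1
  ext x
  have hne : ((((2 * Real.pi) ^ 4 * (‖x‖ ^ 2) ^ 2 : ℝ) : ℂ) - c) ≠ 0 := by
    intro h
    apply hc
    have := congrArg Complex.im h
    rw [Complex.sub_im, Complex.ofReal_im] at this
    simpa using this
  have hmx : ((((2 * Real.pi) ^ 4 * (‖x‖ ^ 2) ^ 2 : ℝ) : ℂ) - c) * m x = 1 := mul_inv_cancel₀ hne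
  have hrx : r x = ((‖x‖ ^ 2 : ℝ) : ℂ) := rfl
  rw [sub_apply, smul_apply, smul_apply, SchwartzMap.smulLeftCLM_apply_apply hmg,
    SchwartzMap.smulLeftCLM_apply_apply (hr.mul (hr.mul hmg))]
  simp only [Pi.mul_apply, smul_eq_mul]
  rw [hrx]
  push_cast at hmx ⊢
  linear_combination (FourierTransform.fourier φ) x * hmx

/-! ### Uniqueness -/

theorem contDiffOn_plateKernel (κ : ℂ) {n : WithTop ℕ∞} : ContDiffOn ℝ n (plateKernel κ) {0}ᶜ := by
  intro x hx
  have hx' : 0 < ‖x‖ := norm_pos_iff.mpr hx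
  have h : 0 < ‖x‖ ^ 2 + 0 := by positivity
  exact (((contDiffAt_yukawa _ h).sub (contDiffAt_yukawa _ h)).div_const _).contDiffWithinAt

theorem measurable_yukawa (lam : ℂ) (e : ℝ) : Measurable (yukawa lam e) := by
  unfold yukawa yukawaProfile
  fun_prop

theorem measurable_plateKernel (κ : ℂ) : Measurable (plateKernel κ) :=
  ((measurable_yukawa _ _).sub (measurable_yukawa _ _)).div_const _

theorem norm_plateKernel_le {κ : ℂ} (hre : 0 ≤ κ.re) (him : 0 ≤ κ.im) {x : Space3} (hx : x ≠ 0) :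
    ‖plateKernel κ x‖ ≤ 1 / ‖κ‖ ^ 2 * (1 / ‖x‖) := by
  have hre1 : 0 ≤ (-(Complex.I * κ)).re := by simpa using him
  have h1 := norm_yukawa_le hre1 le_rfl hx
  have h2 := norm_yukawa_le hre le_rfl hx
  simp only [plateKernel]
  rw [norm_div, norm_mul, norm_pow]
  have h3 : ‖(2 : ℂ)‖ = 2 := by simp
  rw [h3]
  calc _ ≤ (1 / ‖x‖ + 1 / ‖x‖) / (2 * ‖κ‖ ^ 2) := by
        gcongr
        exact (norm_sub_le _ _).trans (add_le_add h1 h2)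
    _ = _ := by
      by_cases hκ : ‖κ‖ = 0
      · simp [hκ]
      · field_simp
        norm_num

theorem integrableOn_plateKernel {κ : ℂ} (hre : 0 ≤ κ.re) (him : 0 ≤ κ.im) {r : ℝ} (hr : 0 < r) :
    IntegrableOn (plateKernel κ) (Metric.ball 0 r) := by
  refine Integrable.mono' (((integrableOn_norm_rpow_ball (p := 1) (by norm_num) hr)).const_mul
    (1 / ‖κ‖ ^ 2)) (measurable_plateKernel κ).aestronglyMeasurable ?_
  filter_upwards [ae_restrict_of_ae ae_ne_zero] with x hx
  have := norm_plateKernel_le hre him hx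
  rwa [Real.rpow_neg_one, ← one_div]

/-- Fubini for the pairing of `φ` with the potential; compact supports compensate for the kernel
being only locally integrable. -/
theorem integral_plate_swap {κ : ℂ} (hre : 0 ≤ κ.re) (him : 0 ≤ κ.im) {f : Space3 → ℝ}
    (hf : Integrable f) (hfc : HasCompactSupport f) {φ : Space3 → ℂ} (hφ : Continuous φ)
    (hφc : HasCompactSupport φ) :
    Integrable (fun y => φ y * ∫ x, f x • plateKernel κ (y - x)) ∧
    ∫ x, (∫ y, plateKernel κ (y - x) * φ y) * (f x : ℂ) =
      ∫ y, φ y * ∫ x, f x • plateKernel κ (y - x) := by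
  obtain ⟨ρ, hρ⟩ := hfc.isBounded.exists_norm_le
  obtain ⟨ρ', hρ'⟩ := hφc.isBounded.exists_norm_le
  -- Differences of points of the two supports stay inside this radius, so truncating the kernel
  -- changes nothing and makes it integrable. Absolute values keep `M` positive even if the supports
  -- are empty.
  set M : ℝ := |ρ| + |ρ'| + 1 with hM
  have hMpos : 0 < M := by positivity
  set k : Space3 → ℂ := (Metric.ball 0 M).indicator (plateKernel κ) with hk
  have hkint : Integrable k := (integrableOn_plateKernel hre him hMpos).integrable_indicator
    Metric.isOpen_ball.measurableSet
  have hfC : Integrable (fun x => (f x : ℂ)) := hf.ofReal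
  have h1 := hfC.convolution_integrand (ContinuousLinearMap.mul ℝ ℂ) hkint (μ := volume)
  obtain ⟨C, hC⟩ := hφ.bounded_above_of_compact_support hφc
  have h2 : Integrable (fun p : Space3 × Space3 => φ p.1 * ((f p.2 : ℂ) * k (p.1 - p.2)))
      (volume.prod volume) := by
    refine Integrable.bdd_mul (c := C) h1 ?_ (Filter.Eventually.of_forall fun p => hC p.1)
    exact (hφ.comp continuous_fst).aestronglyMeasurable
  have h3 : ∀ p : Space3 × Space3, φ p.1 * ((f p.2 : ℂ) * k (p.1 - p.2)) =
      φ p.1 * ((f p.2 : ℂ) * plateKernel κ (p.1 - p.2)) := by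
    intro p
    by_cases ha : p.1 ∈ tsupport φ
    · by_cases hb : p.2 ∈ tsupport f
      · have : p.1 - p.2 ∈ Metric.ball (0 : Space3) M := by
          rw [mem_ball_zero_iff]
          refine (norm_sub_le _ _).trans_lt ?_
          have := hρ _ hb
          have := hρ' _ ha
          have := le_abs_self ρ
          have := le_abs_self ρ'
          linarith
        rw [hk, Set.indicator_of_mem this]
      · rw [image_eq_zero_of_notMem_tsupport hb]
        simp
    · rw [image_eq_zero_of_notMem_tsupport ha]
      simp
  simp only [h3] at h2
  constructor
  · have := h2.integral_prod_left
    simp only [integral_const_mul] at this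
    simpa only [Complex.real_smul] using this
  · have hswap := integral_integral_swap (f := fun y x =>
      φ y * ((f x : ℂ) * plateKernel κ (y - x))) h2
    simp only [integral_const_mul] at hswap
    simp only [Complex.real_smul]
    rw [hswap]
    congr 1
    ext x
    rw [← integral_mul_const]
    congr 1
    ext y
    ring

/-- By duality: for `φ` supported off `f`, solve the equation for a Schwartz `ψ` with right-hand
side `φ`. Testing with `ψ` gives `∫φu = ∫ψf`, and `ψ` is the kernel applied to `φ`, so `u` and the
potential agree as distributions. Both are continuous off the support, hence equal there. -/
theorem plateSolution_eq {σ k : ℝ} {κ : ℂ} (hre : 0 ≤ κ.re) (him : 0 ≤ κ.im)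
    (hκ : κ ^ 4 = plateSymbol σ k) (hc : (plateSymbol σ k).im ≠ 0) {f : Space3 → ℝ}
    (hf : Integrable f) (hfc : HasCompactSupport f) {u : Space3 → ℂ}
    (hu : IsPlateSolution σ k f u) {x : Space3} (hx : x ∉ tsupport f) :
    u x = ∫ y, f y • plateKernel κ (x - y) := by
  have h0 : κ ≠ 0 := by
    rintro rfl
    rw [← hκ] at hc
    simp at hc
  obtain ⟨T, hT1, hT2⟩ := hu.equation
  set V : Space3 → ℂ := fun x => ∫ y, f y • plateKernel κ (x - y) with hV
  have hO : IsOpen (tsupport f)ᶜ := (isClosed_tsupport f).isOpen_compl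
  have hVc : ContinuousOn V (tsupport f)ᶜ := fun y hy =>
    (hasFDerivAt_potential (contDiffOn_plateKernel κ) hf hfc hy).2.continuousAt.continuousWithinAt
  have hae : ∀ᵐ y, y ∈ (tsupport f)ᶜ → (u y - V y) = 0 := by
    apply hO.ae_eq_zero_of_integral_contDiff_smul_eq_zero
    · exact (hu.continuous.continuousOn.sub hVc).locallyIntegrableOn hO.measurableSet
    · intro g hg hgc _
      have hgC : HasCompactSupport (Complex.ofRealCLM ∘ g) := hgc.comp_left rfl
      have hgd : ContDiff ℝ (⊤ : ℕ∞) (Complex.ofRealCLM ∘ g) := by fun_prop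
      set φ : 𝓢(Space3, ℂ) := hgC.toSchwartzMap hgd with hφ
      have hφg : ∀ y, φ y = (g y : ℂ) := fun y => rfl
      obtain ⟨ψ, hψ⟩ := exists_schwartz_solution hc φ
      have e1 : T φ = ∫ y, ψ y * (f y : ℂ) := by
        rw [← hT2 ψ, ← hψ, map_sub, map_smul]
        rw [← TemperedDistribution.laplacian_apply_apply, ← TemperedDistribution.laplacian_apply_apply]
        rfl
      have hψx : ∀ y, ψ y = ∫ z, plateKernel κ (z - y) * φ z := by
        intro y
        rw [← hψ, ← hκ, integral_plateKernel_mul hre him h0]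
      obtain ⟨s1, s2⟩ := integral_plate_swap hre him hf hfc (φ := φ) φ.continuous hgC
      simp only [hψx] at e1
      rw [s2, hT1] at e1
      have : ∀ y, g y • (u y - V y) = φ y * u y - φ y * V y := by
        intro y
        rw [hφg, Complex.real_smul]
        ring
      simp only [this]
      rw [integral_sub (hu.integrable φ) s1, e1, sub_self]
  have hEq : Set.EqOn u V (tsupport f)ᶜ := by
    apply Measure.eqOn_open_of_ae_eq (μ := volume) _ hO hu.continuous.continuousOn hVc
    rw [Filter.EventuallyEq, ae_restrict_iff' hO.measurableSet]
    filter_upwards [hae] with y hy hy'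
    exact sub_eq_zero.mp (hy hy')
  exact hEq hx

/-! ### Singular integrals over the sphere -/

/-- In polar coordinates the sphere integral is 3 times the ball integral of the radial extension,
since `∫₀¹ r² dr = 1/3`; `hcone` says that this extension is at most `H`. Singular sphere integrals
thereby reduce to integrals in the ball. -/
theorem lintegral_toSphere_le {H : Space3 → ENNReal} (hH : Measurable H)
    (hcone : ∀ x : Space3, x ≠ 0 → ‖x‖ < 1 → H (‖x‖⁻¹ • x) ≤ H x) :
    ∫⁻ θ : Metric.sphere (0 : Space3) 1, H θ ∂(volume : Measure Space3).toSphere ≤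
      3 * ∫⁻ x in Metric.ball 0 1, H x := by
  set ind : Set.Ioi (0 : ℝ) → ENNReal := (Set.Iio ⟨1, Set.mem_Ioi.mpr one_pos⟩).indicator 1 with hind
  have hindm : Measurable ind := measurable_one.indicator measurableSet_Iio
  have hHs : Measurable (fun θ : Metric.sphere (0 : Space3) 1 => H θ) := hH.comp measurable_subtype_coe
  have hmp := (volume : Measure Space3).measurePreserving_homeomorphUnitSphereProd
  have hdim : Module.finrank ℝ Space3 - 1 = 2 := by simp
  have h1 : ∫⁻ r, ind r ∂Measure.volumeIoiPow (Module.finrank ℝ Space3 - 1) = 3⁻¹ := by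
    rw [hind, lintegral_indicator_one measurableSet_Iio, Measure.volumeIoiPow_apply_Iio, hdim]
    norm_num
    rw [ENNReal.ofReal_div_of_pos (by norm_num)]
    simp
  have h2 := lintegral_prod_mul (μ := (volume : Measure Space3).toSphere)
    (ν := Measure.volumeIoiPow (Module.finrank ℝ Space3 - 1)) hHs.aemeasurable hindm.aemeasurable
  rw [h1, ← hmp.lintegral_comp_emb (Homeomorph.measurableEmbedding _)] at h2
  have h3 : ∀ x : ({0}ᶜ : Set Space3), H ((homeomorphUnitSphereProd Space3 x).1 : Space3)
      * ind (homeomorphUnitSphereProd Space3 x).2 ≤ (Metric.ball (0 : Space3) 1).indicator H x := by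
    intro x
    rw [homeomorphUnitSphereProd_apply_fst_coe]
    by_cases hx : ‖(x : Space3)‖ < 1
    · rw [Set.indicator_of_mem (by simpa using hx)]
      have : ind (homeomorphUnitSphereProd Space3 x).2 ≤ 1 := by
        apply Set.indicator_le_self'
        simp
      calc _ ≤ H (‖(x : Space3)‖⁻¹ • (x : Space3)) * 1 := by gcongr
        _ = _ := mul_one _
        _ ≤ _ := hcone x x.2 hx
    · have : ind (homeomorphUnitSphereProd Space3 x).2 = 0 := by
        apply Set.indicator_of_notMem
        intro h
        apply hx
        have h' : ((homeomorphUnitSphereProd Space3 x).2 : ℝ) < 1 := h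
        rwa [homeomorphUnitSphereProd_apply_snd_coe] at h'
      rw [this, mul_zero]
      exact zero_le
  have h4 : (∫⁻ θ : Metric.sphere (0 : Space3) 1, H θ ∂(volume : Measure Space3).toSphere) * 3⁻¹ ≤
      ∫⁻ x in Metric.ball 0 1, H x := by
    rw [← h2]
    refine (lintegral_mono h3).trans ?_
    rw [lintegral_subtype_comap (measurableSet_singleton (0 : Space3)).compl
      (fun x => (Metric.ball (0 : Space3) 1).indicator H x), restrict_compl_singleton,
      lintegral_indicator Metric.isOpen_ball.measurableSet]
  rw [← div_eq_mul_inv, ENNReal.div_le_iff (by norm_num) (by norm_num), mul_comm] at h4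
  exact h4

/-- The exponent `3/4 < 1` is integrable on an interval, and Fubini gives the product. -/
theorem lintegral_cube_lt_top :
    ∫⁻ x in {x : Fin 3 → ℝ | ∀ i, |x i| < 1},
      ‖x 0‖ₑ ^ (-(3 / 4) : ℝ) * ‖x 1‖ₑ ^ (-(3 / 4) : ℝ) < ⊤ := by
  have h1 : IntegrableOn (fun t : ℝ => ‖t‖ ^ (-(3 / 4) : ℝ)) (Metric.ball 0 1) := by
    rw [integrableOn_fun_norm_addHaar volume (f := fun t : ℝ => t ^ (-(3 / 4) : ℝ))]
    have h : IntegrableOn (fun y : ℝ => y ^ (-(3 / 4) : ℝ)) (Set.Ioo 0 1) :=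
      (intervalIntegral.integrableOn_Ioo_rpow_iff one_pos).mpr (by norm_num)
    refine h.congr_fun (fun y hy => ?_) measurableSet_Ioo
    simp
  set ψ : ℝ → ℝ := (Metric.ball 0 1).indicator fun t : ℝ => ‖t‖ ^ (-(3 / 4) : ℝ) with hψ
  have hψi : Integrable ψ := h1.integrable_indicator Metric.isOpen_ball.measurableSet
  have h2 : Integrable (fun x : Fin 3 → ℝ => ∏ i, ψ (x i)) :=
    Integrable.fintype_prod (f := fun _ => ψ) fun _ => hψi
  refine lt_of_le_of_lt ?_ h2.lintegral_lt_top
  have hms : MeasurableSet {x : Fin 3 → ℝ | ∀ i, |x i| < 1} := by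
    rw [Set.ofPred_forall]
    refine MeasurableSet.iInter fun i => ?_
    exact measurableSet_lt (measurable_pi_apply i).abs measurable_const
  rw [← lintegral_indicator hms]
  have hne : ∀ i : Fin 3, ∀ᵐ x : Fin 3 → ℝ, x i ≠ 0 := fun i =>
    Measure.ae_eval_ne (μ := fun _ : Fin 3 => (volume : Measure ℝ)) i 0
  refine lintegral_mono_ae ?_
  filter_upwards [hne 0, hne 1, hne 2] with x hx0 hx1 hx2
  by_cases hx : ∀ i, |x i| < 1
  · rw [Set.indicator_of_mem (show x ∈ {x : Fin 3 → ℝ | ∀ i, |x i| < 1} from hx), Fin.prod_univ_three]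
    have hv : ∀ i, ψ (x i) = ‖x i‖ ^ (-(3 / 4) : ℝ) := fun i =>
      Set.indicator_of_mem (by simpa using hx i) _
    rw [hv, hv, hv]
    have hr : ∀ i, x i ≠ 0 → ‖x i‖ₑ ^ (-(3 / 4) : ℝ) = ENNReal.ofReal (‖x i‖ ^ (-(3 / 4) : ℝ)) := by
      intro i hi
      rw [← ofReal_norm, ENNReal.ofReal_rpow_of_pos (norm_pos_iff.mpr hi)]
    rw [hr 0 hx0, hr 1 hx1, ← ENNReal.ofReal_mul (by positivity)]
    apply ENNReal.ofReal_le_ofReal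
    -- A third factor, at least 1 on the cube, is inserted to make the majorant a full product.
    have h3 : 1 ≤ ‖x 2‖ ^ (-(3 / 4) : ℝ) :=
      Real.one_le_rpow_of_pos_of_le_one_of_nonpos (norm_pos_iff.mpr hx2)
        (by simpa using (hx 2).le) (by norm_num)
    exact le_mul_of_one_le_right (by positivity) h3
  · rw [Set.indicator_of_notMem (show x ∉ {x : Fin 3 → ℝ | ∀ i, |x i| < 1} from hx)]
    exact zero_le

theorem exists_orthonormalBasis_two_eq {η : Space3} (hη : ‖η‖ = 1) :
    ∃ b : OrthonormalBasis (Fin 3) ℝ Space3, b 2 = η := by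
  have hon : Orthonormal ℝ (Set.domRestrict ({2} : Set (Fin 3)) fun _ => η) := by
    refine ⟨fun i => hη, fun i j hij => ?_⟩
    exact absurd (Subsingleton.elim i j) hij
  obtain ⟨b, hb⟩ := hon.exists_orthonormalBasis_extension_of_card_eq (by simp)
  exact ⟨b, hb 2 rfl⟩

theorem enorm_rpow_le_of_sq_le {a b c : ℝ} (h : |a * b| ≤ c ^ 2) :
    ‖c‖ₑ ^ (-(3 / 2) : ℝ) ≤ ‖a‖ₑ ^ (-(3 / 4) : ℝ) * ‖b‖ₑ ^ (-(3 / 4) : ℝ) := by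
  rw [← ENNReal.mul_rpow_of_ne_top (by simp) (by simp), ← enorm_mul,
    show (-(3 / 2) : ℝ) = (2 : ℕ) * (-(3 / 4) : ℝ) by norm_num, ENNReal.rpow_mul,
    ENNReal.rpow_natCast, ← enorm_pow, ENNReal.rpow_neg, ENNReal.rpow_neg]
  apply ENNReal.inv_le_inv.mpr
  apply ENNReal.rpow_le_rpow _ (by norm_num)
  rw [enorm_le_iff_norm_le, Real.norm_eq_abs, Real.norm_of_nonneg (sq_nonneg c)]
  exact h

/-- In an orthonormal frame whose last vector is `η`, the squared distance is at least `θ₀² + θ₁² ≥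
|θ₀θ₁|`. So the singularity is bounded by `|θ₀|^{-3/4}|θ₁|^{-3/4}`, homogeneous of negative degree
and integrable over the ball. -/
theorem exists_lintegral_sphere_unit_le : ∃ C : ENNReal, C < ⊤ ∧ ∀ η : Space3, ‖η‖ = 1 →
    ∫⁻ θ : Metric.sphere (0 : Space3) 1, ‖(θ : Space3) - η‖ₑ ^ (-(3 / 2) : ℝ)
      ∂(volume : Measure Space3).toSphere ≤ C := by
  refine ⟨_, ENNReal.mul_lt_top (by norm_num : (3 : ENNReal) < ⊤) lintegral_cube_lt_top, ?_⟩
  intro η hη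
  obtain ⟨b, hb⟩ := exists_orthonormalBasis_two_eq hη
  set H : Space3 → ENNReal := fun x =>
    ‖(b.repr x) 0‖ₑ ^ (-(3 / 4) : ℝ) * ‖(b.repr x) 1‖ₑ ^ (-(3 / 4) : ℝ) with hH
  have hcoord : ∀ i : Fin 3, Continuous fun x : Space3 => (b.repr x) i := by
    intro i
    have := b.repr.continuous
    fun_prop
  have hHm : Measurable H :=
    ((hcoord 0).measurable.enorm.pow_const _).mul ((hcoord 1).measurable.enorm.pow_const _)
  have h1 : ∀ θ : Metric.sphere (0 : Space3) 1, ‖(θ : Space3) - η‖ₑ ^ (-(3 / 2) : ℝ) ≤ H θ := by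
    intro θ
    rw [← enorm_norm]
    apply enorm_rpow_le_of_sq_le
    have e1 : ‖(θ : Space3) - η‖ ^ 2 = ‖b.repr ((θ : Space3) - η)‖ ^ 2 := by
      rw [LinearIsometryEquiv.norm_map]
    have e2 : b.repr η = EuclideanSpace.single 2 1 := by
      rw [← hb, b.repr_self]
    rw [e1, EuclideanSpace.norm_sq_eq, Fin.sum_univ_three, map_sub, e2]
    simp
    rw [← sq_abs ((b.repr (θ : Space3)) 0), ← sq_abs ((b.repr (θ : Space3)) 1)]
    nlinarith [sq_nonneg (|(b.repr (θ : Space3)) 0| - |(b.repr (θ : Space3)) 1|),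
      sq_nonneg ((b.repr (θ : Space3)) 2 - 1), sq_nonneg |(b.repr (θ : Space3)) 0|,
      sq_nonneg |(b.repr (θ : Space3)) 1|]
  refine (lintegral_mono h1).trans ((lintegral_toSphere_le hHm ?_).trans ?_)
  · intro x hx hx1
    have hx' : 0 < ‖x‖ := norm_pos_iff.mpr hx
    have hmono : ∀ i : Fin 3, ‖(b.repr (‖x‖⁻¹ • x)) i‖ₑ ^ (-(3 / 4) : ℝ) ≤
        ‖(b.repr x) i‖ₑ ^ (-(3 / 4) : ℝ) := by
      intro i
      rw [ENNReal.rpow_neg, ENNReal.rpow_neg]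
      apply ENNReal.inv_le_inv.mpr
      apply ENNReal.rpow_le_rpow _ (by norm_num)
      rw [enorm_le_iff_norm_le, map_smul]
      simp only [PiLp.smul_apply, smul_eq_mul, norm_mul, norm_inv, norm_norm]
      apply le_mul_of_one_le_left (norm_nonneg _)
      exact (one_le_inv₀ hx').mpr hx1.le
    exact mul_le_mul' (hmono 0) (hmono 1)
  · gcongr
    set S : Set (Fin 3 → ℝ) := {x : Fin 3 → ℝ | ∀ i, |x i| < 1} with hS
    set G : (Fin 3 → ℝ) → ENNReal := fun x =>
      ‖x 0‖ₑ ^ (-(3 / 4) : ℝ) * ‖x 1‖ₑ ^ (-(3 / 4) : ℝ) with hG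
    have hms : MeasurableSet S := by
      rw [hS, Set.ofPred_forall]
      refine MeasurableSet.iInter fun i => ?_
      exact measurableSet_lt (measurable_pi_apply i).abs measurable_const
    have hGm : Measurable (S.indicator G) := by
      apply Measurable.indicator _ hms
      simp only [hG]
      fun_prop
    have hmp := (PiLp.volume_preserving_ofLp (Fin 3)).comp b.measurePreserving_repr
    rw [← lintegral_indicator hms, ← hmp.lintegral_comp hGm,
      ← lintegral_indicator Metric.isOpen_ball.measurableSet]
    refine lintegral_mono fun x => ?_
    by_cases hx : x ∈ Metric.ball (0 : Space3) 1
    · rw [Set.indicator_of_mem hx, Set.indicator_of_mem]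
      · rfl
      · intro i
        have h2 : ‖(b.repr x) i‖ ≤ ‖b.repr x‖ := PiLp.norm_apply_le _ i
        rw [LinearIsometryEquiv.norm_map] at h2
        have h3 : ‖x‖ < 1 := by simpa using hx
        exact h2.trans_lt h3
    · rw [Set.indicator_of_notMem hx]
      exact zero_le

/-- With `y = ‖y‖η`, one has `|Rθ - y| ≥ (R/2)|θ - η|`: the triangle inequality costs `R - ‖y‖`,
itself at most `|Rθ - y|`. Hence a bound uniform up to the sphere. -/
theorem exists_lintegral_sphere_le {R : ℝ} (hR : 0 < R) : ∃ C : ENNReal, C < ⊤ ∧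
    ∀ y ∈ Metric.ball (0 : Space3) R,
    ∫⁻ θ : Metric.sphere (0 : Space3) 1, ‖R • (θ : Space3) - y‖ₑ ^ (-(3 / 2) : ℝ)
      ∂(volume : Measure Space3).toSphere ≤ C := by
  obtain ⟨C, hC, hb⟩ := exists_lintegral_sphere_unit_le
  refine ⟨ENNReal.ofReal (R / 2) ^ (-(3 / 2) : ℝ) * C, ?_, ?_⟩
  · apply ENNReal.mul_lt_top _ hC
    rw [ENNReal.ofReal_rpow_of_pos (by positivity)]
    exact ENNReal.ofReal_lt_top
  intro y hy
  have hyR : ‖y‖ < R := by simpa using hy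
  obtain ⟨η, hη, hyη⟩ : ∃ η : Space3, ‖η‖ = 1 ∧ y = ‖y‖ • η := by
    by_cases h0 : y = 0
    · exact ⟨EuclideanSpace.single 0 1, by simp, by simp [h0]⟩
    · refine ⟨‖y‖⁻¹ • y, ?_, ?_⟩
      · rw [norm_smul, norm_inv, norm_norm, inv_mul_cancel₀ (norm_ne_zero_iff.mpr h0)]
      · rw [smul_smul, mul_inv_cancel₀ (norm_ne_zero_iff.mpr h0), one_smul]
  have key : ∀ θ : Metric.sphere (0 : Space3) 1, ‖R • (θ : Space3) - y‖ₑ ^ (-(3 / 2) : ℝ) ≤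
      ENNReal.ofReal (R / 2) ^ (-(3 / 2) : ℝ) * ‖(θ : Space3) - η‖ₑ ^ (-(3 / 2) : ℝ) := by
    intro θ
    rw [← ENNReal.mul_rpow_of_ne_top (by simp) (by simp), ENNReal.rpow_neg, ENNReal.rpow_neg]
    apply ENNReal.inv_le_inv.mpr
    apply ENNReal.rpow_le_rpow _ (by norm_num)
    rw [← ofReal_norm, ← ofReal_norm, ← ENNReal.ofReal_mul (by positivity)]
    apply ENNReal.ofReal_le_ofReal
    have hθ : ‖(θ : Space3)‖ = 1 := by simp
    have e1 : ‖R • ((θ : Space3) - η)‖ = R * ‖(θ : Space3) - η‖ := by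
      rw [norm_smul, Real.norm_of_nonneg hR.le]
    have e2 : R • ((θ : Space3) - η) = (R • (θ : Space3) - y) + (‖y‖ - R) • η := by
      rw [sub_smul, ← hyη, smul_sub]
      abel
    have e3 : ‖(‖y‖ - R) • η‖ = R - ‖y‖ := by
      rw [norm_smul, hη, mul_one, Real.norm_of_nonpos (by linarith)]
      ring
    have e4 : R - ‖y‖ ≤ ‖R • (θ : Space3) - y‖ := by
      have := norm_sub_norm_le (R • (θ : Space3)) y
      rwa [norm_smul, hθ, mul_one, Real.norm_of_nonneg hR.le] at this
    have e5 := norm_add_le (R • (θ : Space3) - y) ((‖y‖ - R) • η)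
    rw [← e2, e1, e3] at e5
    linarith
  refine (lintegral_mono key).trans ?_
  have hmeas : Measurable fun θ : Metric.sphere (0 : Space3) 1 =>
      ‖(θ : Space3) - η‖ₑ ^ (-(3 / 2) : ℝ) := by fun_prop
  rw [lintegral_const_mul _ hmeas]
  gcongr
  exact hb η hη

/-- Translating by `x` moves the integral into a ball of radius `2R`, and `5/2 < 3`. -/
theorem exists_lintegral_ball_le (R : ℝ) (hR : 0 < R) : ∃ C : ENNReal, C < ⊤ ∧
    ∀ x : Space3, ‖x‖ = R →
      ∫⁻ y in Metric.ball (0 : Space3) R, ‖x - y‖ₑ ^ (-(5 / 2) : ℝ) ≤ C := by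
  have h1 := (integrableOn_norm_rpow_ball (p := 5 / 2) (by norm_num)
    (by positivity : 0 < 2 * R)).lintegral_lt_top
  refine ⟨_, h1, fun x hx => ?_⟩
  rw [← lintegral_indicator Metric.isOpen_ball.measurableSet,
    ← lintegral_indicator Metric.isOpen_ball.measurableSet,
    ← lintegral_sub_left_eq_self (fun w : Space3 => (Metric.ball (0 : Space3) (2 * R)).indicator
      (fun w => ENNReal.ofReal (‖w‖ ^ (-(5 / 2) : ℝ))) w) x]
  refine lintegral_mono fun y => ?_
  by_cases hy : y ∈ Metric.ball (0 : Space3) R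
  · have hy' : ‖y‖ < R := by simpa using hy
    have h2 : x - y ∈ Metric.ball (0 : Space3) (2 * R) := by
      rw [mem_ball_zero_iff]
      have := norm_sub_le x y
      linarith
    have h3 : 0 < ‖x - y‖ := by
      have := norm_sub_norm_le x y
      linarith
    rw [Set.indicator_of_mem hy, Set.indicator_of_mem h2, ← ofReal_norm,
      ENNReal.ofReal_rpow_of_pos h3]
  · rw [Set.indicator_of_notMem hy]
    exact zero_le

/-- Trace estimate for the most singular potential. -/
theorem exists_lintegral_sphere_riesz_le {R : ℝ} (hR : 0 < R) : ∃ C : ENNReal, C < ⊤ ∧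
    ∀ f : Space3 → ℝ, AEStronglyMeasurable f volume →
    ∫⁻ θ : Metric.sphere (0 : Space3) 1,
      (∫⁻ y in Metric.ball (0 : Space3) R, ‖f y‖ₑ * ‖R • (θ : Space3) - y‖ₑ ^ (-2 : ℝ)) ^ (2 : ℝ)
      ∂(volume : Measure Space3).toSphere ≤
      C * ∫⁻ y in Metric.ball (0 : Space3) R, ‖f y‖ₑ ^ (2 : ℝ) := by
  obtain ⟨C1, hC1, hb1⟩ := exists_lintegral_ball_le R hR
  obtain ⟨C2, hC2, hb2⟩ := exists_lintegral_sphere_le hR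
  refine ⟨C1 * C2, ENNReal.mul_lt_top hC1 hC2, fun f hf => ?_⟩
  set μB := (volume : Measure Space3).restrict (Metric.ball 0 R) with hμB
  have hfm : AEMeasurable (fun y => ‖f y‖ₑ) μB := hf.aemeasurable.enorm.restrict
  have hθ : ∀ θ : Metric.sphere (0 : Space3) 1, ‖R • (θ : Space3)‖ = R := by
    intro θ
    rw [norm_smul, Real.norm_of_nonneg hR.le]
    simp
  have step1 : ∀ θ : Metric.sphere (0 : Space3) 1,
      (∫⁻ y, ‖f y‖ₑ * ‖R • (θ : Space3) - y‖ₑ ^ (-2 : ℝ) ∂μB) ^ (2 : ℝ) ≤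
      C1 * ∫⁻ y, ‖f y‖ₑ ^ (2 : ℝ) * ‖R • (θ : Space3) - y‖ₑ ^ (-(3 / 2) : ℝ) ∂μB := by
    intro θ
    set x : Space3 := R • (θ : Space3) with hx
    -- The exponent 2 is split as `3/4 + 5/4`: after Cauchy–Schwarz the squares are `3/2 < 2`,
    -- integrable over the sphere, and `5/2 < 3`, integrable over the ball.
    have e1 : ∫⁻ y, ‖f y‖ₑ * ‖x - y‖ₑ ^ (-2 : ℝ) ∂μB =
        ∫⁻ y, ((fun y => ‖f y‖ₑ * ‖x - y‖ₑ ^ (-(3 / 4) : ℝ)) *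
          (fun y => ‖x - y‖ₑ ^ (-(5 / 4) : ℝ))) y ∂μB := by
      apply setLIntegral_congr_fun Metric.isOpen_ball.measurableSet
      intro y hy
      have hy' : ‖y‖ < R := by simpa using hy
      have h3 : x - y ≠ 0 := by
        have := norm_sub_norm_le x y
        have := hθ θ
        rw [← norm_pos_iff]
        linarith
      simp only [Pi.mul_apply]
      rw [mul_assoc, ← ENNReal.rpow_add _ _ (by simpa using h3) (by simp)]
      norm_num
    have e2 := ENNReal.lintegral_mul_le_Lp_mul_Lq μB Real.HolderConjugate.two_two
      (f := fun y => ‖f y‖ₑ * ‖x - y‖ₑ ^ (-(3 / 4) : ℝ)) (g := fun y => ‖x - y‖ₑ ^ (-(5 / 4) : ℝ))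
      (hfm.mul (by fun_prop)) (by fun_prop)
    rw [← e1] at e2
    have e3 := ENNReal.rpow_le_rpow e2 (by norm_num : (0 : ℝ) ≤ 2)
    rw [ENNReal.mul_rpow_of_nonneg _ _ (by norm_num), ← ENNReal.rpow_mul, ← ENNReal.rpow_mul] at e3
    norm_num at e3
    simp only [ENNReal.rpow_ofNat]
    refine e3.trans ?_
    rw [mul_comm]
    gcongr ?_ * ?_
    · refine le_trans (le_of_eq ?_) (hb1 x (hθ θ))
      congr 1
      ext y
      rw [← ENNReal.rpow_natCast, ← ENNReal.rpow_mul]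
      norm_num
    · refine le_of_eq ?_
      congr 1
      ext y
      rw [mul_pow, ← ENNReal.rpow_natCast (‖x - y‖ₑ ^ _), ← ENNReal.rpow_mul]
      norm_num
  refine (lintegral_mono step1).trans ?_
  rw [lintegral_const_mul' _ _ hC1.ne, mul_assoc]
  gcongr
  rw [lintegral_lintegral_swap]
  · rw [← lintegral_const_mul' _ _ hC2.ne]
    refine setLIntegral_mono_ae' Metric.isOpen_ball.measurableSet (Filter.Eventually.of_forall
      fun y hy => ?_)
    have hm : Measurable fun θ : Metric.sphere (0 : Space3) 1 =>
        ‖R • (θ : Space3) - y‖ₑ ^ (-(3 / 2) : ℝ) := by fun_prop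
    rw [lintegral_const_mul _ hm, mul_comm]
    gcongr
    exact hb2 y hy
  · refine AEMeasurable.mul ?_ ?_
    · exact (hfm.comp_quasiMeasurePreserving Measure.quasiMeasurePreserving_snd).pow_const _
    · exact Measurable.aemeasurable (by fun_prop)

/-- On `|w| ≤ 2R` the first-order singularity is dominated by `2R` times the second-order one, which
reduces everything to the trace estimate. The constant is independent of the support's distance to
the sphere. -/
theorem exists_lintegral_sphere_potential_le {R : ℝ} (hR : 0 < R) : ∃ C : ℝ, 0 < C ∧
    ∀ (f : Space3 → ℝ) (Q : ℝ), 0 ≤ Q → AEStronglyMeasurable f volume →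
      tsupport f ⊆ Metric.ball 0 R →
      eLpNorm f 2 (volume.restrict (Metric.ball (0 : Space3) R)) ≤ ENNReal.ofReal Q →
      ∀ (k : Space3 → ℂ) (A : ℝ), 0 ≤ A →
      (∀ w, w ≠ 0 → ‖k w‖ ≤ A * (1 / ‖w‖ + 1 / ‖w‖ ^ 2)) →
      ∫⁻ θ : Metric.sphere (0 : Space3) 1,
        ‖∫ y, f y • k (R • (θ : Space3) - y)‖ₑ ^ (2 : ℝ)
        ∂(volume : Measure Space3).toSphere ≤ ENNReal.ofReal (C * A ^ 2 * Q ^ 2) := by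
  obtain ⟨C, hC, hb⟩ := exists_lintegral_sphere_riesz_le hR
  refine ⟨(2 * R + 1) ^ 2 * (C.toReal + 1), by positivity, ?_⟩
  intro f Q hQ hf hsupp hfQ k A hA hk
  have hθ : ∀ θ : Metric.sphere (0 : Space3) 1, ‖R • (θ : Space3)‖ = R := by
    intro θ
    rw [norm_smul, Real.norm_of_nonneg hR.le]
    simp
  have h1 : ∀ θ : Metric.sphere (0 : Space3) 1, ‖∫ y, f y • k (R • (θ : Space3) - y)‖ₑ ≤
      ENNReal.ofReal (A * (2 * R + 1)) *
      ∫⁻ y in Metric.ball (0 : Space3) R, ‖f y‖ₑ * ‖R • (θ : Space3) - y‖ₑ ^ (-2 : ℝ) := by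
    intro θ
    rw [← setIntegral_eq_integral_of_forall_compl_eq_zero (s := Metric.ball (0 : Space3) R)]
    · refine (enorm_integral_le_lintegral_enorm _).trans ?_
      rw [← lintegral_const_mul' _ _ ENNReal.ofReal_ne_top]
      refine setLIntegral_mono_ae' Metric.isOpen_ball.measurableSet (Filter.Eventually.of_forall
        fun y hy => ?_)
      have hy' : ‖y‖ < R := by simpa using hy
      set w : Space3 := R • (θ : Space3) - y with hw
      have hw0 : 0 < ‖w‖ := by
        have := norm_sub_norm_le (R • (θ : Space3)) y
        have := hθ θ
        linarith
      have hw2 : ‖w‖ ≤ 2 * R := by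
        have := norm_sub_le (R • (θ : Space3)) y
        have := hθ θ
        linarith
      rw [enorm_smul, mul_left_comm]
      gcongr
      rw [← ofReal_norm, ← ofReal_norm, ENNReal.ofReal_rpow_of_pos hw0,
        ← ENNReal.ofReal_mul (by positivity)]
      apply ENNReal.ofReal_le_ofReal
      refine (hk w (norm_pos_iff.mp hw0)).trans ?_
      have e1 : ‖w‖ ^ (-2 : ℝ) = 1 / ‖w‖ ^ 2 := by
        rw [Real.rpow_neg hw0.le, one_div]
        norm_cast
      rw [e1, mul_assoc]
      gcongr
      have : 1 / ‖w‖ ≤ 2 * R * (1 / ‖w‖ ^ 2) := by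
        rw [div_le_iff₀ hw0]
        field_simp
        exact hw2
      linarith
    · intro y hy
      rw [image_eq_zero_of_notMem_tsupport (fun h => hy (hsupp h)), zero_smul]
  have hq : ∫⁻ y in Metric.ball (0 : Space3) R, ‖f y‖ₑ ^ (2 : ℝ) ≤ ENNReal.ofReal (Q ^ 2) := by
    rw [eLpNorm_eq_lintegral_rpow_enorm_toReal (by norm_num) (by norm_num)] at hfQ
    have := ENNReal.rpow_le_rpow hfQ (by norm_num : (0 : ℝ) ≤ 2)
    rw [← ENNReal.rpow_mul, ENNReal.ofReal_rpow_of_nonneg hQ (by norm_num)] at this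
    simpa using this
  calc _ ≤ ∫⁻ θ : Metric.sphere (0 : Space3) 1, ENNReal.ofReal (A * (2 * R + 1)) ^ (2 : ℝ) *
      (∫⁻ y in Metric.ball (0 : Space3) R, ‖f y‖ₑ * ‖R • (θ : Space3) - y‖ₑ ^ (-2 : ℝ)) ^ (2 : ℝ)
      ∂(volume : Measure Space3).toSphere := by
        refine lintegral_mono fun θ => ?_
        rw [← ENNReal.mul_rpow_of_nonneg _ _ (by norm_num)]
        exact ENNReal.rpow_le_rpow (h1 θ) (by norm_num)
    _ = ENNReal.ofReal (A * (2 * R + 1)) ^ (2 : ℝ) * ∫⁻ θ : Metric.sphere (0 : Space3) 1,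
      (∫⁻ y in Metric.ball (0 : Space3) R, ‖f y‖ₑ * ‖R • (θ : Space3) - y‖ₑ ^ (-2 : ℝ)) ^ (2 : ℝ)
      ∂(volume : Measure Space3).toSphere := by
        rw [lintegral_const_mul']
        exact ENNReal.rpow_ne_top_of_nonneg (by norm_num) ENNReal.ofReal_ne_top
    _ ≤ ENNReal.ofReal (A * (2 * R + 1)) ^ (2 : ℝ) * (C * ENNReal.ofReal (Q ^ 2)) := by
        gcongr
        exact (hb f hf).trans (by gcongr)
    _ ≤ ENNReal.ofReal ((A * (2 * R + 1)) ^ 2) *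
        (ENNReal.ofReal (C.toReal + 1) * ENNReal.ofReal (Q ^ 2)) := by
        rw [ENNReal.ofReal_rpow_of_nonneg (by positivity) (by norm_num)]
        gcongr
        · norm_num
        · conv_lhs => rw [← ENNReal.ofReal_toReal hC.ne]
          apply ENNReal.ofReal_le_ofReal
          linarith
    _ = _ := by
        rw [← ENNReal.ofReal_mul (by positivity), ← ENNReal.ofReal_mul (by positivity)]
        congr 1
        ring

/-! ### Holomorphic families of potentials -/

/-- The half-strip `{re z > 1, |im z| < σ / 2}`. -/
def halfStrip (σ : ℝ) : Set ℂ := {z : ℂ | 1 < z.re ∧ |z.im| < σ / 2}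

theorem isOpen_halfStrip (σ : ℝ) : IsOpen (halfStrip σ) :=
  (isOpen_lt continuous_const Complex.continuous_re).inter
    (isOpen_lt Complex.continuous_im.abs continuous_const)

theorem conj_mem_halfStrip {σ : ℝ} {z : ℂ} (hz : z ∈ halfStrip σ) :
    (starRingEnd ℂ) z ∈ halfStrip σ := by
  refine ⟨by simpa using hz.1, ?_⟩
  rw [Complex.conj_im, abs_neg]
  exact hz.2

/-- A family of kernels on `ℝ³ ∖ {0}`, holomorphic in the wavenumber, with at most a
second order singularity. -/
structure IsKernelFamily (σ : ℝ) (k : ℂ → Space3 → ℂ) : Prop where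
  holo : ∀ w, w ≠ 0 → DifferentiableOn ℂ (fun z => k z w) (halfStrip σ)
  smooth : ∀ z ∈ halfStrip σ, ContDiffOn ℝ 1 (k z) {0}ᶜ
  bound : ∀ z ∈ halfStrip σ, ∀ w, w ≠ 0 →
    ‖k z w‖ ≤ (1 + σ) * (1 + ‖z‖) * (1 / ‖w‖ + 1 / ‖w‖ ^ 2)

/-- The potential `k * f`. -/
noncomputable def potential (k : Space3 → ℂ) (f : Space3 → ℝ) (x : Space3) : ℂ :=
  ∫ y, f y • k (x - y)

theorem norm_smul_kernel_le {k : Space3 → ℂ} {f : Space3 → ℝ} {A η : ℝ} (hA : 0 ≤ A) (hη : 0 < η)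
    (hk : ∀ w, w ≠ 0 → ‖k w‖ ≤ A * (1 / ‖w‖ + 1 / ‖w‖ ^ 2)) {x : Space3}
    (hx : ∀ y ∈ tsupport f, η ≤ ‖x - y‖) (y : Space3) :
    ‖f y • k (x - y)‖ ≤ ‖f y‖ * (A * (1 / η + 1 / η ^ 2)) := by
  by_cases hy : y ∈ tsupport f
  · rw [norm_smul]
    have h1 := hx y hy
    have h2 : x - y ≠ 0 := norm_pos_iff.mp (hη.trans_le h1)
    gcongr
    refine (hk _ h2).trans ?_
    gcongr
  · rw [image_eq_zero_of_notMem_tsupport hy]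
    simp

theorem norm_potential_le {k : Space3 → ℂ} {f : Space3 → ℝ} (hf : Integrable f) {A η : ℝ}
    (hA : 0 ≤ A) (hη : 0 < η) (hk : ∀ w, w ≠ 0 → ‖k w‖ ≤ A * (1 / ‖w‖ + 1 / ‖w‖ ^ 2)) {x : Space3}
    (hx : ∀ y ∈ tsupport f, η ≤ ‖x - y‖) :
    ‖potential k f x‖ ≤ (∫ y, ‖f y‖) * (A * (1 / η + 1 / η ^ 2)) := by
  rw [← integral_mul_const]
  exact norm_integral_le_of_norm_le (hf.norm.mul_const _)
    (Filter.Eventually.of_forall fun y => norm_smul_kernel_le hA hη hk hx y)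

/-- The distance depends on `f`, so it is used only for qualitative facts such as holomorphy. -/
theorem exists_pos_le_dist_sphere {R : ℝ} {f : Space3 → ℝ}
    (hsupp : tsupport f ⊆ Metric.ball 0 R) :
    ∃ η > 0, ∀ x : Space3, ‖x‖ = R → ∀ y ∈ tsupport f, η ≤ ‖x - y‖ := by
  obtain ⟨r, hr, hsub⟩ := exists_lt_subset_ball (isClosed_tsupport f) hsupp
  refine ⟨R - r, by linarith, fun x hx y hy => ?_⟩
  have h1 : ‖y‖ < r := by simpa using hsub hy
  have := norm_sub_norm_le x y
  linarith

theorem norm_smul_coe_sphere {R : ℝ} (hR : 0 < R) (θ : Metric.sphere (0 : Space3) 1) :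
    ‖R • (θ : Space3)‖ = R := by
  rw [norm_smul, Real.norm_of_nonneg hR.le]
  simp

theorem notMem_tsupport_of_norm_eq {R : ℝ} {f : Space3 → ℝ}
    (hsupp : tsupport f ⊆ Metric.ball 0 R) {x : Space3} (hx : ‖x‖ = R) : x ∉ tsupport f := by
  intro h
  have : ‖x‖ < R := by simpa using hsupp h
  linarith

namespace IsKernelFamily

variable {σ : ℝ} {k : ℂ → Space3 → ℂ}

theorem bound_ball (hk : IsKernelFamily σ k) (hσ : 0 < σ) {z₀ z : ℂ} (hz : z ∈ halfStrip σ)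
    (hz1 : ‖z‖ ≤ ‖z₀‖ + 1) (w : Space3) (hw : w ≠ 0) :
    ‖k z w‖ ≤ (1 + σ) * (2 + ‖z₀‖) * (1 / ‖w‖ + 1 / ‖w‖ ^ 2) := by
  refine (hk.bound z hz w hw).trans ?_
  gcongr ?_ * ?_ * ?_
  linarith

theorem differentiableOn_potential (hk : IsKernelFamily σ k) (hσ : 0 < σ) {f : Space3 → ℝ}
    (hf : Integrable f) {η : ℝ} (hη : 0 < η) {x : Space3} (hx : ∀ y ∈ tsupport f, η ≤ ‖x - y‖) :
    DifferentiableOn ℂ (fun z => potential (k z) f x) (halfStrip σ) := by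
  apply differentiableOn_integral_of_dominated (isOpen_halfStrip σ)
  · intro z hz
    exact hf.aestronglyMeasurable.smul
      (aestronglyMeasurable_comp_sub (hk.smooth z hz).continuousOn x)
  · refine Filter.Eventually.of_forall fun y => ?_
    by_cases hy : y ∈ tsupport f
    · exact (hk.holo _ (norm_pos_iff.mp (hη.trans_le (hx y hy)))).const_smul (f y)
    · simp only [image_eq_zero_of_notMem_tsupport hy, zero_smul]
      exact differentiableOn_const _
  · intro z₀ _
    refine ⟨1, one_pos, _, hf.norm.mul_const ((1 + σ) * (2 + ‖z₀‖) * (1 / η + 1 / η ^ 2)), ?_⟩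
    refine Filter.Eventually.of_forall fun y z hz hzU => ?_
    have hz1 : ‖z‖ ≤ ‖z₀‖ + 1 := by
      rw [mem_ball_iff_norm] at hz
      have := norm_le_norm_add_norm_sub' z z₀
      linarith
    exact norm_smul_kernel_le (by positivity) hη (hk.bound_ball hσ hzU hz1) hx y

theorem continuous_potential_sphere (hk : IsKernelFamily σ k) {f : Space3 → ℝ}
    (hf : Integrable f) (hfc : HasCompactSupport f) {R : ℝ} (hR : 0 < R)
    (hsupp : tsupport f ⊆ Metric.ball 0 R) {z : ℂ} (hz : z ∈ halfStrip σ) :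
    Continuous fun θ : Metric.sphere (0 : Space3) 1 => potential (k z) f (R • (θ : Space3)) := by
  rw [continuous_iff_continuousAt]
  intro θ
  have h1 := (hasFDerivAt_potential (hk.smooth z hz) hf hfc
    (notMem_tsupport_of_norm_eq hsupp (norm_smul_coe_sphere hR θ))).2.continuousAt
  have h2 : ContinuousAt (fun θ : Metric.sphere (0 : Space3) 1 => R • (θ : Space3)) θ := by fun_prop
  exact ContinuousAt.comp (g := potential (k z) f) h1 h2

end IsKernelFamily

/-- The holomorphic extension of `k ↦ ∫_S w(k) |(k * f)(Rθ)|² dθ`. -/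
noncomputable def sphereForm (R : ℝ) (f : Space3 → ℝ) (w : ℂ → ℂ) (k : ℂ → Space3 → ℂ) (z : ℂ) : ℂ :=
  ∫ θ : Metric.sphere (0 : Space3) 1, w z * (potential (k z) f (R • (θ : Space3)) *
    (starRingEnd ℂ) (potential (k ((starRingEnd ℂ) z)) f (R • (θ : Space3))))
    ∂(volume : Measure Space3).toSphere

namespace IsKernelFamily

variable {σ : ℝ} {k : ℂ → Space3 → ℂ}

theorem continuous_sphereForm_integrand (hk : IsKernelFamily σ k) {f : Space3 → ℝ}
    (hf : Integrable f) (hfc : HasCompactSupport f) {R : ℝ} (hR : 0 < R)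
    (hsupp : tsupport f ⊆ Metric.ball 0 R) {z : ℂ} (hz : z ∈ halfStrip σ) (w : ℂ → ℂ) :
    Continuous fun θ : Metric.sphere (0 : Space3) 1 =>
      w z * (potential (k z) f (R • (θ : Space3)) *
      (starRingEnd ℂ) (potential (k ((starRingEnd ℂ) z)) f (R • (θ : Space3)))) :=
  continuous_const.mul ((hk.continuous_potential_sphere hf hfc hR hsupp hz).mul
    (Complex.continuous_conj.comp
      (hk.continuous_potential_sphere hf hfc hR hsupp (conj_mem_halfStrip hz))))

theorem differentiableOn_sphereForm (hk : IsKernelFamily σ k) (hσ : 0 < σ) {f : Space3 → ℝ}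
    (hf : Integrable f) (hfc : HasCompactSupport f) {R : ℝ} (hR : 0 < R)
    (hsupp : tsupport f ⊆ Metric.ball 0 R) {w : ℂ → ℂ} (hw : Differentiable ℂ w) :
    DifferentiableOn ℂ (sphereForm R f w k) (halfStrip σ) := by
  obtain ⟨η, hη, hdist⟩ := exists_pos_le_dist_sphere hsupp
  apply differentiableOn_integral_of_dominated (isOpen_halfStrip σ)
  · intro z hz
    exact (hk.continuous_sphereForm_integrand hf hfc hR hsupp hz w).aestronglyMeasurable
  · refine Filter.Eventually.of_forall fun θ => ?_
    have h1 := hk.differentiableOn_potential hσ hf hη (hdist _ (norm_smul_coe_sphere hR θ))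
    apply hw.differentiableOn.mul
    apply h1.mul
    intro z hz
    -- Conjugating both argument and value preserves holomorphy.
    have h2 := (h1.differentiableAt ((isOpen_halfStrip σ).mem_nhds (conj_mem_halfStrip hz))).conj_conj
    rw [Complex.conj_conj] at h2
    exact h2.differentiableWithinAt
  · intro z₀ _
    obtain ⟨W, hW⟩ := (isCompact_closedBall z₀ 1).exists_bound_of_continuousOn
      hw.continuous.continuousOn
    set M := (∫ y, ‖f y‖) * ((1 + σ) * (2 + ‖z₀‖) * (1 / η + 1 / η ^ 2)) with hM
    refine ⟨1, one_pos, fun _ => W * (M * M), integrable_const _, ?_⟩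
    refine Filter.Eventually.of_forall fun θ z hz hzU => ?_
    have hz1 : ‖z‖ ≤ ‖z₀‖ + 1 := by
      rw [mem_ball_iff_norm] at hz
      have := norm_le_norm_add_norm_sub' z z₀
      linarith
    have h1 := norm_potential_le hf (by positivity) hη (hk.bound_ball hσ hzU hz1)
      (hdist _ (norm_smul_coe_sphere hR θ))
    have h2 := norm_potential_le hf (by positivity) hη
      (hk.bound_ball (z₀ := z₀) hσ (conj_mem_halfStrip hzU) (by rwa [RCLike.norm_conj]))
      (hdist _ (norm_smul_coe_sphere hR θ))
    rw [norm_mul, norm_mul, RCLike.norm_conj]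
    rw [← hM] at h1 h2
    have h3 := hW z (Metric.ball_subset_closedBall hz)
    have h4 : 0 ≤ W := (norm_nonneg _).trans h3
    have h5 : 0 ≤ M := (norm_nonneg _).trans h1
    change _ ≤ W * (M * M)
    gcongr

theorem sphereForm_ofReal {R : ℝ} (f : Space3 → ℝ) {w : ℂ → ℂ}
    {t p : ℝ} (hp : w t = p) : sphereForm R f w k t =
      ((∫ θ : Metric.sphere (0 : Space3) 1, p * ‖potential (k t) f (R • (θ : Space3))‖ ^ 2
        ∂(volume : Measure Space3).toSphere : ℝ) : ℂ) := by
  rw [← integral_complex_ofReal]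
  simp only [sphereForm, hp, Complex.conj_ofReal]
  congr 1
  ext θ
  rw [Complex.mul_conj, Complex.normSq_eq_norm_sq]
  push_cast
  rfl

theorem integrable_sq_potential (hk : IsKernelFamily σ k) {f : Space3 → ℝ}
    (hf : Integrable f) (hfc : HasCompactSupport f) {R : ℝ} (hR : 0 < R)
    (hsupp : tsupport f ⊆ Metric.ball 0 R) {z : ℂ} (hz : z ∈ halfStrip σ) :
    Integrable (fun θ : Metric.sphere (0 : Space3) 1 => ‖potential (k z) f (R • (θ : Space3))‖ ^ 2)
      (volume : Measure Space3).toSphere := by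
  have hc := (hk.continuous_potential_sphere hf hfc hR hsupp hz).norm.pow 2
  obtain ⟨M, hM⟩ := isCompact_univ.exists_bound_of_continuousOn hc.continuousOn
  exact Integrable.of_bound hc.aestronglyMeasurable M
    (Filter.Eventually.of_forall fun θ => hM θ (Set.mem_univ _))

end IsKernelFamily

/-- The product of the potentials at `z` and at its conjugate is at most half the sum of their
squares, and both satisfy the trace bound with the same amplitude because the moduli agree. -/
theorem exists_norm_sphereForm_le {R : ℝ} (hR : 0 < R) : ∃ C : ℝ, 0 < C ∧
    ∀ (σ : ℝ), 0 < σ → ∀ (f : Space3 → ℝ) (Q : ℝ), 0 ≤ Q → Integrable f → HasCompactSupport f →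
      tsupport f ⊆ Metric.ball 0 R →
      eLpNorm f 2 (volume.restrict (Metric.ball (0 : Space3) R)) ≤ ENNReal.ofReal Q →
      ∀ k, IsKernelFamily σ k → ∀ w z, z ∈ halfStrip σ →
        ‖sphereForm R f w k z‖ ≤ ‖w z‖ * (C * ((1 + σ) * (1 + ‖z‖)) ^ 2 * Q ^ 2) := by
  obtain ⟨C, hC, hb⟩ := exists_lintegral_sphere_potential_le hR
  refine ⟨C, hC, fun σ hσ f Q hQ hf hfc hsupp hfQ k hk w z hz => ?_⟩
  set A := (1 + σ) * (1 + ‖z‖) with hA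
  have hA0 : 0 ≤ A := by positivity
  have hz' := conj_mem_halfStrip hz
  have hint : ∀ z' ∈ halfStrip σ, ‖z'‖ = ‖z‖ →
      ∫ θ : Metric.sphere (0 : Space3) 1, ‖potential (k z') f (R • (θ : Space3))‖ ^ 2
        ∂(volume : Measure Space3).toSphere ≤ C * A ^ 2 * Q ^ 2 := by
    intro z' hz' hzz
    have h1 := hb f Q hQ hf.aestronglyMeasurable hsupp hfQ (k z') A hA0 (fun v hv => by
      have := hk.bound z' hz' v hv
      rwa [hzz] at this)
    rw [integral_eq_lintegral_of_nonneg_ae (Filter.Eventually.of_forall fun θ => by positivity)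
      (hk.integrable_sq_potential hf hfc hR hsupp hz').aestronglyMeasurable]
    apply ENNReal.toReal_le_of_le_ofReal (by positivity)
    refine le_trans (le_of_eq ?_) h1
    congr 1
    ext θ
    rw [ENNReal.ofReal_pow (norm_nonneg _), ofReal_norm, ENNReal.rpow_ofNat]
    rfl
  have i1 := hk.integrable_sq_potential hf hfc hR hsupp hz
  have i2 := hk.integrable_sq_potential hf hfc hR hsupp hz'
  have h1 := hint z hz rfl
  have h2 := hint _ hz' (RCLike.norm_conj z)
  have h3 : ‖sphereForm R f w k z‖ ≤ ∫ θ : Metric.sphere (0 : Space3) 1,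
      ‖w z‖ * ((‖potential (k z) f (R • (θ : Space3))‖ ^ 2 +
        ‖potential (k ((starRingEnd ℂ) z)) f (R • (θ : Space3))‖ ^ 2) / 2)
        ∂(volume : Measure Space3).toSphere := by
    apply norm_integral_le_of_norm_le (((i1.add i2).div_const 2).const_mul _)
    refine Filter.Eventually.of_forall fun θ => ?_
    rw [norm_mul, norm_mul, RCLike.norm_conj]
    simp only [Pi.add_apply]
    gcongr
    nlinarith [sq_nonneg (‖potential (k z) f (R • (θ : Space3))‖ -
      ‖potential (k ((starRingEnd ℂ) z)) f (R • (θ : Space3))‖)]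
  refine h3.trans ?_
  rw [integral_const_mul, integral_div, integral_add i1 i2]
  gcongr
  linarith

/-! ### The complex wavenumber -/

/-- The extension of `plateSymbol` to complex wavenumbers. -/
noncomputable def symbolC (σ : ℝ) (z : ℂ) : ℂ := z ^ 2 + Complex.I * z * (σ : ℂ)

/-- The extension of `plateKappa` to complex wavenumbers. -/
noncomputable def kappaC (σ : ℝ) (z : ℂ) : ℂ := symbolC σ z ^ (1 / 4 : ℂ)

theorem kappaC_ofReal (σ k : ℝ) : kappaC σ k = plateKappa σ k := rfl

theorem kappaC_pow_four (σ : ℝ) (z : ℂ) : kappaC σ z ^ 4 = symbolC σ z := by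
  have := Complex.cpow_nat_inv_pow (symbolC σ z) (n := 4) (by norm_num)
  rw [kappaC, one_div]
  exact_mod_cast this

theorem symbolC_eq (σ : ℝ) (z : ℂ) : symbolC σ z = z * (z + Complex.I * σ) := by
  rw [symbolC]; ring

theorem symbolC_im_pos {σ : ℝ} {z : ℂ} (hz : z ∈ halfStrip σ) : 0 < (symbolC σ z).im := by
  obtain ⟨h1, h2⟩ := hz
  have h3 := (abs_lt.mp h2).1
  have : (symbolC σ z).im = z.re * (2 * z.im + σ) := by
    rw [symbolC_eq]
    simp
    ring
  rw [this]
  apply mul_pos <;> linarith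

theorem norm_kappaC_pow_four (σ : ℝ) (z : ℂ) :
    ‖kappaC σ z‖ ^ 4 = ‖z‖ * ‖z + Complex.I * σ‖ := by
  rw [← norm_pow, kappaC_pow_four, symbolC_eq, norm_mul]

theorem one_le_norm_kappaC {σ : ℝ} {z : ℂ} (hz : z ∈ halfStrip σ) : 1 ≤ ‖kappaC σ z‖ := by
  have h1 : 1 ≤ ‖z‖ := hz.1.le.trans (Complex.re_le_norm z)
  have h2 : 1 ≤ ‖z + Complex.I * σ‖ := by
    refine le_trans ?_ (Complex.re_le_norm _)
    have := hz.1
    simp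
    linarith
  have h3 : 1 ≤ ‖kappaC σ z‖ ^ 4 := by
    rw [norm_kappaC_pow_four]
    nlinarith
  by_contra h
  have := pow_lt_one₀ (norm_nonneg (kappaC σ z)) (not_le.mp h) (n := 4) (by norm_num)
  linarith

/-- The identity `|κ|⁴ = |z||z + iσ|` bounds `|κ|²`; since `|κ| ≥ 1`, the same bound holds for
`|κ|`. -/
theorem norm_kappaC_le {σ : ℝ} (hσ : 0 < σ) {z : ℂ} (hz : z ∈ halfStrip σ) :
    ‖kappaC σ z‖ ≤ (1 + σ) * (1 + ‖z‖) := by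
  have h1 := one_le_norm_kappaC hz
  have h2 : ‖z + Complex.I * σ‖ ≤ ‖z‖ + σ := by
    refine (norm_add_le _ _).trans ?_
    rw [norm_mul, Complex.norm_I, one_mul, Complex.norm_real, Real.norm_of_nonneg hσ.le]
  have h3 : ‖kappaC σ z‖ ^ 4 ≤ ((1 + σ) * (1 + ‖z‖)) ^ 2 := by
    rw [norm_kappaC_pow_four]
    have := norm_nonneg z
    calc _ ≤ ‖z‖ * (‖z‖ + σ) := by gcongr
      _ ≤ ((1 + σ) * (1 + ‖z‖)) * ((1 + σ) * (1 + ‖z‖)) := by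
        apply mul_le_mul <;> nlinarith [mul_nonneg hσ.le this]
      _ = _ := by ring
  have h4 : ‖kappaC σ z‖ ^ 2 ≤ ((1 + σ) * (1 + ‖z‖)) := by
    apply le_of_sq_le_sq _ (by positivity)
    calc _ = ‖kappaC σ z‖ ^ 4 := by ring
      _ ≤ _ := h3
  nlinarith

/-- The symbol lies in the open upper half-plane, so its principal fourth root has argument strictly
between 0 and `π/4`. -/
theorem kappaC_re_im_pos {σ : ℝ} {z : ℂ} (hz : z ∈ halfStrip σ) :
    0 < (kappaC σ z).re ∧ 0 < (kappaC σ z).im := by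
  have him := symbolC_im_pos hz
  have h0 : symbolC σ z ≠ 0 := by
    intro h
    rw [h] at him
    simp at him
  have harg1 : 0 < (symbolC σ z).arg := by
    have h1 := Complex.arg_nonneg_iff.mpr him.le
    rcases h1.eq_or_lt with h | h
    · have := (Complex.arg_eq_zero_iff.mp h.symm).2
      linarith
    · exact h
  have harg2 := Complex.arg_le_pi (symbolC σ z)
  rw [kappaC, Complex.cpow_def_of_ne_zero h0]
  have e1 : (Complex.log (symbolC σ z) * (1 / 4)).im = (symbolC σ z).arg / 4 := by
    rw [show (1 / 4 : ℂ) = ((1 / 4 : ℝ) : ℂ) by push_cast; rfl, Complex.im_mul_ofReal, Complex.log_im]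
    ring
  rw [Complex.exp_re, Complex.exp_im, e1]
  constructor
  · apply mul_pos (Real.exp_pos _)
    apply Real.cos_pos_of_mem_Ioo
    constructor <;> linarith [Real.pi_pos]
  · apply mul_pos (Real.exp_pos _)
    apply Real.sin_pos_of_pos_of_lt_pi <;> linarith [Real.pi_pos]

theorem differentiableOn_kappaC (σ : ℝ) : DifferentiableOn ℂ (kappaC σ) (halfStrip σ) := by
  intro z hz
  apply DifferentiableAt.differentiableWithinAt
  have h1 : DifferentiableAt ℂ (symbolC σ) z := by
    unfold symbolC
    fun_prop
  exact h1.cpow_const (Or.inr (symbolC_im_pos hz).ne')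

theorem plateKappa_facts {σ k : ℝ} (hσ : 0 < σ) (hk : 1 < k) :
    (k : ℂ) ∈ halfStrip σ ∧ √k ≤ ‖plateKappa σ k‖ := by
  have hmem : (k : ℂ) ∈ halfStrip σ := by
    refine ⟨by simpa using hk, ?_⟩
    simpa using hσ
  refine ⟨hmem, ?_⟩
  rw [← kappaC_ofReal]
  apply Real.sqrt_le_left (norm_nonneg _) |>.mpr
  apply le_of_sq_le_sq _ (by positivity)
  have h1 := norm_kappaC_pow_four σ k
  have h2 : k ≤ ‖(k : ℂ) + Complex.I * σ‖ := by
    refine le_trans ?_ (Complex.re_le_norm _)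
    simp
  have h3 : ‖(k : ℂ)‖ = k := by rw [Complex.norm_real, Real.norm_of_nonneg (by linarith)]
  rw [h3] at h1
  nlinarith

/-! ### The kernels of `u`, `∇u`, `Δu` and `∇Δu` -/

/-- The Laplacian of `plateKernel` off the origin. -/
noncomputable def plateKernelLap (κ : ℂ) (x : Space3) : ℂ :=
  -((yukawa (-(Complex.I * κ)) 0 x + yukawa κ 0 x) / 2)

theorem contDiffOn_plateKernelLap (κ : ℂ) {n : WithTop ℕ∞} :
    ContDiffOn ℝ n (plateKernelLap κ) {0}ᶜ := by
  intro x hx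
  have hx' : 0 < ‖x‖ := norm_pos_iff.mpr hx
  have h : 0 < ‖x‖ ^ 2 + 0 := by positivity
  exact (((contDiffAt_yukawa _ h).add (contDiffAt_yukawa _ h)).div_const _).neg.contDiffWithinAt

/-- Off the origin the two Yukawa kernels are eigenfunctions of the Laplacian with eigenvalues `-κ²`
and `κ²`, which cancels the denominator. -/
theorem laplacian_plateKernel {κ : ℂ} (hκ : κ ≠ 0) {x : Space3} (hx : x ≠ 0) :
    (Δ (plateKernel κ)) x = plateKernelLap κ x := by
  have hx' : 0 < ‖x‖ := norm_pos_iff.mpr hx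
  have h : 0 < ‖x‖ ^ 2 + 0 := by positivity
  have c1 := contDiffAt_yukawa (-(Complex.I * κ)) h (n := 2)
  have c2 := contDiffAt_yukawa κ h (n := 2)
  have e : plateKernel κ = (1 / (2 * κ ^ 2)) • (yukawa (-(Complex.I * κ)) 0 - yukawa κ 0) := by
    ext x
    simp [plateKernel]
    ring
  have c3 : ContDiffAt ℝ 2 (yukawa (-(Complex.I * κ)) 0 - yukawa κ 0) x := c1.sub c2
  rw [e, InnerProductSpace.laplacian_smul _ c3, c1.laplacian_sub c2,
    laplacian_yukawa _ h, laplacian_yukawa _ h]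
  simp only [plateKernelLap, Complex.ofReal_zero, mul_zero, zero_mul, sub_zero, neg_sq, mul_pow,
    Complex.I_sq, smul_eq_mul]
  field_simp
  ring

theorem fderiv_plateKernel (κ : ℂ) {x : Space3} (hx : x ≠ 0) (v : Space3) :
    fderiv ℝ (plateKernel κ) x v =
      (fderiv ℝ (yukawa (-(Complex.I * κ)) 0) x v - fderiv ℝ (yukawa κ 0) x v) / (2 * κ ^ 2) := by
  have hx' : 0 < ‖x‖ := norm_pos_iff.mpr hx
  have h : 0 < ‖x‖ ^ 2 + 0 := by positivity
  have c1 := (contDiffAt_yukawa (-(Complex.I * κ)) h (n := 1)).differentiableAt (by norm_num)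
  have c2 := (contDiffAt_yukawa κ h (n := 1)).differentiableAt (by norm_num)
  have := ((c1.hasFDerivAt.sub c2.hasFDerivAt).mul_const (1 / (2 * κ ^ 2)))
  have e : plateKernel κ = fun x => (yukawa (-(Complex.I * κ)) 0 - yukawa κ 0) x * (1 / (2 * κ ^ 2)) := by
    ext x
    simp [plateKernel]
    ring
  rw [e, this.fderiv]
  simp
  ring

theorem fderiv_plateKernelLap (κ : ℂ) {x : Space3} (hx : x ≠ 0) (v : Space3) :
    fderiv ℝ (plateKernelLap κ) x v =
      -((fderiv ℝ (yukawa (-(Complex.I * κ)) 0) x v + fderiv ℝ (yukawa κ 0) x v) / 2) := by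
  have hx' : 0 < ‖x‖ := norm_pos_iff.mpr hx
  have h : 0 < ‖x‖ ^ 2 + 0 := by positivity
  have c1 := (contDiffAt_yukawa (-(Complex.I * κ)) h (n := 1)).differentiableAt (by norm_num)
  have c2 := (contDiffAt_yukawa κ h (n := 1)).differentiableAt (by norm_num)
  have := ((c1.hasFDerivAt.add c2.hasFDerivAt).mul_const (-(1 / 2) : ℂ))
  have e : plateKernelLap κ =
      fun x => (yukawa (-(Complex.I * κ)) 0 + yukawa κ 0) x * (-(1 / 2) : ℂ) := by
    ext x
    simp [plateKernelLap]
    ring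
  rw [e, this.fderiv]
  simp
  ring

theorem differentiable_yukawa_lam (x : Space3) : Differentiable ℂ fun lam => yukawa lam 0 x := by
  unfold yukawa yukawaProfile
  fun_prop

theorem differentiable_fderiv_yukawa_lam {x : Space3} (hx : x ≠ 0) (v : Space3) :
    Differentiable ℂ fun lam => fderiv ℝ (yukawa lam 0) x v := by
  have hx' : 0 < ‖x‖ := norm_pos_iff.mpr hx
  have h : 0 < ‖x‖ ^ 2 + 0 := by positivity
  simp only [fderiv_yukawa _ h, yukawaProfile', Complex.real_smul]
  fun_prop

section families

variable {σ : ℝ}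

theorem differentiableOn_comp_kappaC {F : ℂ → ℂ} (hF : Differentiable ℂ F) :
    DifferentiableOn ℂ (fun z => F (kappaC σ z)) (halfStrip σ) ∧
    DifferentiableOn ℂ (fun z => F (-(Complex.I * kappaC σ z))) (halfStrip σ) := by
  have h := differentiableOn_kappaC σ
  exact ⟨hF.comp_differentiableOn h, hF.comp_differentiableOn (h.const_mul _).neg⟩

theorem kappaC_facts (hσ : 0 < σ) {z : ℂ} (hz : z ∈ halfStrip σ) :
    0 ≤ (kappaC σ z).re ∧ 0 ≤ (-(Complex.I * kappaC σ z)).re ∧ 1 ≤ ‖kappaC σ z‖ ∧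
      ‖kappaC σ z‖ ≤ (1 + σ) * (1 + ‖z‖) ∧ kappaC σ z ≠ 0 ∧
      ‖-(Complex.I * kappaC σ z)‖ = ‖kappaC σ z‖ := by
  obtain ⟨h1, h2⟩ := kappaC_re_im_pos hz
  have h3 := one_le_norm_kappaC hz
  refine ⟨h1.le, by simpa using h2.le, h3, norm_kappaC_le hσ hz, ?_, by simp⟩
  exact norm_pos_iff.mp (by linarith)

theorem fderiv_contDiffOn {k : Space3 → ℂ} (hk : ContDiffOn ℝ 2 k {0}ᶜ) (v : Space3) :
    ContDiffOn ℝ 1 (fun x => fderiv ℝ k x v) {0}ᶜ :=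
  (hk.fderiv_of_isOpen isOpen_compl_singleton (by norm_num)).clm_apply contDiffOn_const

theorem isKernelFamily_plateKernel (hσ : 0 < σ) :
    IsKernelFamily σ fun z => plateKernel (kappaC σ z) where
  holo w _ := by
    obtain ⟨h1, h2⟩ := differentiableOn_comp_kappaC (σ := σ) (differentiable_yukawa_lam w)
    refine (h2.sub h1).div ((((differentiableOn_kappaC σ).pow 2)).const_mul 2) fun z hz => ?_
    have := (kappaC_facts hσ hz).2.2.2.2.1
    simp [this]
  smooth z _ := contDiffOn_plateKernel _
  bound z hz w hw := by
    obtain ⟨h1, h2, h3, h4, h5, h6⟩ := kappaC_facts hσ hz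
    have hw' : 0 < ‖w‖ := norm_pos_iff.mpr hw
    refine (norm_plateKernel_le h1 (by simpa using h2) hw).trans ?_
    have h7 : 1 / ‖kappaC σ z‖ ^ 2 ≤ 1 := by
      rw [div_le_one (by positivity)]
      exact one_le_pow₀ h3
    have h8 : 1 ≤ (1 + σ) * (1 + ‖z‖) := h3.trans h4
    have h9 : 1 / ‖w‖ ≤ 1 / ‖w‖ + 1 / ‖w‖ ^ 2 := by
      have : 0 ≤ 1 / ‖w‖ ^ 2 := by positivity
      linarith
    gcongr
    linarith

theorem isKernelFamily_plateKernelLap (hσ : 0 < σ) :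
    IsKernelFamily σ fun z => plateKernelLap (kappaC σ z) where
  holo w _ := by
    obtain ⟨h1, h2⟩ := differentiableOn_comp_kappaC (σ := σ) (differentiable_yukawa_lam w)
    exact ((h2.add h1).div_const 2).neg
  smooth z _ := contDiffOn_plateKernelLap _
  bound z hz w hw := by
    obtain ⟨h1, h2, h3, h4, h5, h6⟩ := kappaC_facts hσ hz
    have hw' : 0 < ‖w‖ := norm_pos_iff.mpr hw
    have e1 := norm_yukawa_le h1 le_rfl hw
    have e2 := norm_yukawa_le h2 le_rfl hw
    have h8 : 1 ≤ (1 + σ) * (1 + ‖z‖) := h3.trans h4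
    have h9 : 1 / ‖w‖ ≤ 1 / ‖w‖ + 1 / ‖w‖ ^ 2 := by
      have : 0 ≤ 1 / ‖w‖ ^ 2 := by positivity
      linarith
    simp only [plateKernelLap]
    rw [norm_neg, norm_div, Complex.norm_ofNat]
    calc _ ≤ (1 / ‖w‖ + 1 / ‖w‖) / 2 := by
          gcongr
          exact (norm_add_le _ _).trans (add_le_add e2 e1)
      _ = 1 * (1 / ‖w‖) := by ring
      _ ≤ _ := by gcongr

/-- The lower bound `|κ| ≥ 1` lets `|κ|/|w| + 1/|w|²` be written with the common factor `|κ|`. -/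
theorem norm_fderiv_pair_le (hσ : 0 < σ) {z : ℂ} (hz : z ∈ halfStrip σ) {w : Space3} (hw : w ≠ 0)
    {v : Space3} (hv : ‖v‖ = 1) :
    ‖fderiv ℝ (yukawa (-(Complex.I * kappaC σ z)) 0) w v‖ ≤
        ‖kappaC σ z‖ * (1 / ‖w‖ + 1 / ‖w‖ ^ 2) ∧
    ‖fderiv ℝ (yukawa (kappaC σ z) 0) w v‖ ≤ ‖kappaC σ z‖ * (1 / ‖w‖ + 1 / ‖w‖ ^ 2) := by
  obtain ⟨h1, h2, h3, h4, h5, h6⟩ := kappaC_facts hσ hz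
  have hw' : 0 < ‖w‖ := norm_pos_iff.mpr hw
  have e1 := norm_fderiv_yukawa_le h1 le_rfl hw v
  have e2 := norm_fderiv_yukawa_le h2 le_rfl hw v
  rw [h6] at e2
  rw [hv, mul_one] at e1 e2
  have h7 : ‖kappaC σ z‖ / ‖w‖ + 1 / ‖w‖ ^ 2 ≤ ‖kappaC σ z‖ * (1 / ‖w‖ + 1 / ‖w‖ ^ 2) := by
    have : 0 ≤ 1 / ‖w‖ ^ 2 := by positivity
    rw [mul_add, mul_one_div]
    nlinarith
  exact ⟨e2.trans h7, e1.trans h7⟩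

theorem isKernelFamily_fderiv_plateKernel (hσ : 0 < σ) {v : Space3} (hv : ‖v‖ = 1) :
    IsKernelFamily σ fun z x => fderiv ℝ (plateKernel (kappaC σ z)) x v where
  holo w hw := by
    obtain ⟨h1, h2⟩ := differentiableOn_comp_kappaC (σ := σ) (differentiable_fderiv_yukawa_lam hw v)
    simp only [fderiv_plateKernel _ hw]
    refine (h2.sub h1).div ((((differentiableOn_kappaC σ).pow 2)).const_mul 2) fun z hz => ?_
    have := (kappaC_facts hσ hz).2.2.2.2.1
    simp [this]
  smooth z _ := fderiv_contDiffOn (contDiffOn_plateKernel _) v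
  bound z hz w hw := by
    obtain ⟨h1, h2, h3, h4, h5, h6⟩ := kappaC_facts hσ hz
    obtain ⟨e1, e2⟩ := norm_fderiv_pair_le hσ hz hw hv
    have hw' : 0 < ‖w‖ := norm_pos_iff.mpr hw
    rw [fderiv_plateKernel _ hw, norm_div, norm_mul, norm_pow, Complex.norm_ofNat]
    rw [div_le_iff₀ (by positivity)]
    refine (norm_sub_le _ _).trans ((add_le_add e1 e2).trans ?_)
    have h7 : 0 ≤ 1 / ‖w‖ + 1 / ‖w‖ ^ 2 := by positivity
    have h8 : 1 ≤ ‖kappaC σ z‖ ^ 2 := one_le_pow₀ h3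
    calc _ = ‖kappaC σ z‖ * (1 / ‖w‖ + 1 / ‖w‖ ^ 2) * (2 * 1) := by ring
      _ ≤ _ := by gcongr

theorem isKernelFamily_fderiv_plateKernelLap (hσ : 0 < σ) {v : Space3} (hv : ‖v‖ = 1) :
    IsKernelFamily σ fun z x => fderiv ℝ (plateKernelLap (kappaC σ z)) x v where
  holo w hw := by
    obtain ⟨h1, h2⟩ := differentiableOn_comp_kappaC (σ := σ) (differentiable_fderiv_yukawa_lam hw v)
    simp only [fderiv_plateKernelLap _ hw]
    exact ((h2.add h1).div_const 2).neg
  smooth z _ := fderiv_contDiffOn (contDiffOn_plateKernelLap _) v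
  bound z hz w hw := by
    obtain ⟨h1, h2, h3, h4, h5, h6⟩ := kappaC_facts hσ hz
    obtain ⟨e1, e2⟩ := norm_fderiv_pair_le hσ hz hw hv
    have hw' : 0 < ‖w‖ := norm_pos_iff.mpr hw
    rw [fderiv_plateKernelLap _ hw, norm_neg, norm_div, Complex.norm_ofNat]
    rw [div_le_iff₀ (by positivity)]
    refine (norm_add_le _ _).trans ((add_le_add e1 e2).trans ?_)
    have h7 : 0 ≤ 1 / ‖w‖ + 1 / ‖w‖ ^ 2 := by positivity
    calc _ = ‖kappaC σ z‖ * (1 / ‖w‖ + 1 / ‖w‖ ^ 2) * 2 := by ring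
      _ ≤ _ := by gcongr

end families

/-! ### The boundary norm as a holomorphic function of the wavenumber -/

theorem integrable_of_memLp_two {f : Space3 → ℝ} (hf : MemLp f 2 volume)
    (hfc : HasCompactSupport f) : Integrable f := by
  have hK : volume (tsupport f) < ⊤ := hfc.isCompact.measure_lt_top
  rw [← integrableOn_iff_integrable_of_support_subset (subset_tsupport f)]
  have : IsFiniteMeasure (volume.restrict (tsupport f)) := ⟨by simpa using hK⟩
  exact (hf.restrict _).integrable (by norm_num)

/-- The `j`-th vector of the standard basis of `ℝ³`. -/
noncomputable abbrev stdVec (j : Fin 3) : Space3 := EuclideanSpace.single j (1 : ℝ)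

theorem norm_stdVec (j : Fin 3) : ‖stdVec j‖ = 1 := by simp

section solution

variable {σ t : ℝ} {f : Space3 → ℝ} {u : Space3 → ℂ}

theorem IsPlateSolution.eq_potential (hu : IsPlateSolution σ t f u) (hσ : 0 < σ) (ht : 1 < t)
    (hf : Integrable f) (hfc : HasCompactSupport f) {x : Space3} (hx : x ∉ tsupport f) :
    u x = potential (plateKernel (kappaC σ t)) f x := by
  have hmem := (plateKappa_facts hσ ht).1
  have h1 := kappaC_re_im_pos hmem
  exact plateSolution_eq h1.1.le h1.2.le (kappaC_pow_four σ t) (symbolC_im_pos hmem).ne' hf hfc hu hx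

theorem IsPlateSolution.eventuallyEq_potential (hu : IsPlateSolution σ t f u) (hσ : 0 < σ)
    (ht : 1 < t) (hf : Integrable f) (hfc : HasCompactSupport f) {x : Space3}
    (hx : x ∉ tsupport f) : u =ᶠ[nhds x] potential (plateKernel (kappaC σ t)) f := by
  filter_upwards [(isClosed_tsupport f).isOpen_compl.mem_nhds hx] with y hy
  exact hu.eq_potential hσ ht hf hfc hy

theorem fderiv_potential {k : Space3 → ℂ} (hk : ContDiffOn ℝ 1 k {0}ᶜ) (hf : Integrable f)
    (hfc : HasCompactSupport f) {x : Space3} (hx : x ∉ tsupport f) (v : Space3) :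
    fderiv ℝ (potential k f) x v = potential (fun x => fderiv ℝ k x v) f x :=
  fderiv_potential_apply hk hf hfc hx v

theorem laplacian_potential_plateKernel {κ : ℂ} (hκ : κ ≠ 0) (hf : Integrable f)
    (hfc : HasCompactSupport f) {x : Space3} (hx : x ∉ tsupport f) :
    (Δ (potential (plateKernel κ) f)) x = potential (plateKernelLap κ) f x := by
  refine (laplacian_potential (contDiffOn_plateKernel κ) hf hfc hx).trans ?_
  refine integral_congr_ae (Filter.Eventually.of_forall fun y => ?_)
  by_cases hy : y ∈ tsupport f
  · have : x - y ≠ 0 := by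
      rw [sub_ne_zero]
      rintro rfl
      exact hx hy
    simp only [laplacian_plateKernel hκ this]
  · simp [image_eq_zero_of_notMem_tsupport hy]

theorem IsPlateSolution.laplacian_eq (hu : IsPlateSolution σ t f u) (hσ : 0 < σ)
    (ht : 1 < t) (hf : Integrable f) (hfc : HasCompactSupport f) {x : Space3}
    (hx : x ∉ tsupport f) : (Δ u) x = potential (plateKernelLap (kappaC σ t)) f x := by
  have hκ := (kappaC_facts hσ (plateKappa_facts hσ ht).1).2.2.2.2.1
  rw [(InnerProductSpace.laplacian_congr_nhds (hu.eventuallyEq_potential hσ ht hf hfc hx)).eq_of_nhds,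
    laplacian_potential_plateKernel hκ hf hfc hx]

theorem IsPlateSolution.gradSq_eq (hu : IsPlateSolution σ t f u) (hσ : 0 < σ)
    (ht : 1 < t) (hf : Integrable f) (hfc : HasCompactSupport f) {x : Space3}
    (hx : x ∉ tsupport f) : gradSq u x =
      ∑ j, ‖potential (fun x => fderiv ℝ (plateKernel (kappaC σ t)) x (stdVec j)) f x‖ ^ 2 := by
  simp only [gradSq, (hu.eventuallyEq_potential hσ ht hf hfc hx).fderiv_eq,
    fderiv_potential (contDiffOn_plateKernel _) hf hfc hx]

theorem IsPlateSolution.gradSq_laplacian_eq (hu : IsPlateSolution σ t f u) (hσ : 0 < σ)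
    (ht : 1 < t) (hf : Integrable f) (hfc : HasCompactSupport f) {x : Space3}
    (hx : x ∉ tsupport f) : gradSq (Δ u) x =
      ∑ j, ‖potential (fun x => fderiv ℝ (plateKernelLap (kappaC σ t)) x (stdVec j)) f x‖ ^ 2 := by
  have h : Δ u =ᶠ[nhds x] potential (plateKernelLap (kappaC σ t)) f := by
    filter_upwards [(isClosed_tsupport f).isOpen_compl.mem_nhds hx] with y hy
    exact hu.laplacian_eq hσ ht hf hfc hy
  simp only [gradSq, h.fderiv_eq, fderiv_potential (contDiffOn_plateKernelLap _) hf hfc hx]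

end solution

/-- The holomorphic extension of the boundary norm to complex wavenumbers. -/
noncomputable def boundaryForm (R σ : ℝ) (f : Space3 → ℝ) (z : ℂ) : ℂ :=
  (R : ℂ) ^ 2 * (sphereForm R f (fun z => z ^ 4 + z ^ 2) (fun z => plateKernel (kappaC σ z)) z
    + ∑ j, sphereForm R f (fun z => z ^ 2)
        (fun z x => fderiv ℝ (plateKernel (kappaC σ z)) x (stdVec j)) z
    + sphereForm R f (fun z => z ^ 2 + 1) (fun z => plateKernelLap (kappaC σ z)) z
    + ∑ j, sphereForm R f (fun _ => 1)
        (fun z x => fderiv ℝ (plateKernelLap (kappaC σ z)) x (stdVec j)) z)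

section boundaryForm

variable {R σ : ℝ} {f : Space3 → ℝ}

theorem differentiableOn_boundaryForm (hR : 0 < R) (hσ : 0 < σ) (hf : Integrable f)
    (hfc : HasCompactSupport f) (hsupp : tsupport f ⊆ Metric.ball 0 R) :
    DifferentiableOn ℂ (boundaryForm R σ f) (halfStrip σ) := by
  have d1 := (isKernelFamily_plateKernel hσ).differentiableOn_sphereForm hσ hf hfc hR hsupp
    (w := fun z => z ^ 4 + z ^ 2) (by fun_prop)
  have d2 := fun j => (isKernelFamily_fderiv_plateKernel hσ
    (norm_stdVec j)).differentiableOn_sphereForm hσ hf hfc hR hsupp (w := fun z => z ^ 2)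
      (by fun_prop)
  have d3 := (isKernelFamily_plateKernelLap hσ).differentiableOn_sphereForm hσ hf hfc hR hsupp
    (w := fun z => z ^ 2 + 1) (by fun_prop)
  have d4 := fun j => (isKernelFamily_fderiv_plateKernelLap hσ
    (norm_stdVec j)).differentiableOn_sphereForm hσ hf hfc hR hsupp (w := fun _ => 1)
      (by fun_prop)
  exact (((d1.add (DifferentiableOn.fun_sum fun j _ => d2 j)).add d3).add
    (DifferentiableOn.fun_sum fun j _ => d4 j)).const_mul _

theorem boundaryForm_ofReal (hR : 0 < R) (hσ : 0 < σ) (hf : Integrable f)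
    (hfc : HasCompactSupport f) (hsupp : tsupport f ⊆ Metric.ball 0 R) {t : ℝ} (ht : 1 < t)
    {u : Space3 → ℂ} (hu : IsPlateSolution σ t f u) :
    boundaryForm R σ f t = (boundaryNormSq R t u : ℂ) := by
  have hmem := (plateKappa_facts hσ ht).1
  have i1 := (isKernelFamily_plateKernel hσ).integrable_sq_potential hf hfc hR hsupp hmem
  have i2 := fun j => (isKernelFamily_fderiv_plateKernel hσ
    (norm_stdVec j)).integrable_sq_potential hf hfc hR hsupp hmem
  have i3 := (isKernelFamily_plateKernelLap hσ).integrable_sq_potential hf hfc hR hsupp hmem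
  have i4 := fun j => (isKernelFamily_fderiv_plateKernelLap hσ
    (norm_stdVec j)).integrable_sq_potential hf hfc hR hsupp hmem
  have e : ∀ θ : Metric.sphere (0 : Space3) 1, R • (θ : Space3) ∉ tsupport f := fun θ =>
    notMem_tsupport_of_norm_eq hsupp (norm_smul_coe_sphere hR θ)
  rw [boundaryForm, boundaryNormSq, sphereIntegral]
  simp only [fun θ => hu.eq_potential hσ ht hf hfc (e θ), fun θ => hu.gradSq_eq hσ ht hf hfc (e θ),
    fun θ => hu.laplacian_eq hσ ht hf hfc (e θ), fun θ => hu.gradSq_laplacian_eq hσ ht hf hfc (e θ)]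
  rw [IsKernelFamily.sphereForm_ofReal f (p := t ^ 4 + t ^ 2) (by push_cast; rfl),
    IsKernelFamily.sphereForm_ofReal f (p := t ^ 2 + 1) (by push_cast; rfl)]
  simp only [fun j => IsKernelFamily.sphereForm_ofReal (R := R) f (w := fun z => z ^ 2) (t := t)
      (p := t ^ 2) (k := fun z x => fderiv ℝ (plateKernel (kappaC σ z)) x (stdVec j))
      (by push_cast; rfl),
    fun j => IsKernelFamily.sphereForm_ofReal (R := R) f (w := fun _ => 1) (t := t)
      (p := 1) (k := fun z x => fderiv ℝ (plateKernelLap (kappaC σ z)) x (stdVec j))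
      (by push_cast; rfl), Finset.mul_sum]
  rw [integral_add, integral_add, integral_add, integral_finsetSum, integral_finsetSum]
  · push_cast
    simp
  · exact fun j _ => i4 j
  · exact fun j _ => (i2 j).const_mul _
  · exact i1.const_mul _
  · exact integrable_finsetSum _ fun j _ => (i2 j).const_mul _
  · exact (i1.const_mul _).add (integrable_finsetSum _ fun j _ => (i2 j).const_mul _)
  · exact i3.const_mul _
  · exact ((i1.const_mul _).add (integrable_finsetSum _ fun j _ => (i2 j).const_mul _)).add
      (i3.const_mul _)
  · exact integrable_finsetSum _ fun j _ => i4 j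

end boundaryForm

theorem boundaryNormSq_nonneg (R k : ℝ) (u : Space3 → ℂ) : 0 ≤ boundaryNormSq R k u := by
  apply mul_nonneg (sq_nonneg R)
  apply integral_nonneg
  intro θ
  simp only [gradSq]
  positivity

/-- The weights have degree at most 4 and the two kernels contribute `(1 + |z|)²`, hence the power
6. The number 16 counts eight forms, each with a weight bounded by `2(1 + |z|)⁴`. -/
theorem exists_norm_boundaryForm_le {R : ℝ} (hR : 0 < R) : ∃ C : ℝ, 0 < C ∧
    ∀ (σ : ℝ), 0 < σ → ∀ (f : Space3 → ℝ) (Q : ℝ), 0 ≤ Q → Integrable f → HasCompactSupport f →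
      tsupport f ⊆ Metric.ball 0 R →
      eLpNorm f 2 (volume.restrict (Metric.ball (0 : Space3) R)) ≤ ENNReal.ofReal Q →
      ∀ z, z ∈ halfStrip σ →
        ‖boundaryForm R σ f z‖ ≤ C * Q ^ 2 * (1 + σ) ^ 2 * (1 + ‖z‖) ^ 6 := by
  obtain ⟨C, hC, hb⟩ := exists_norm_sphereForm_le hR
  refine ⟨R ^ 2 * (16 * C), by positivity, fun σ hσ f Q hQ hf hfc hsupp hfQ z hz => ?_⟩
  have key : ∀ k, IsKernelFamily σ k → ∀ w : ℂ → ℂ, ‖w z‖ ≤ 2 * (1 + ‖z‖) ^ 4 →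
      ‖sphereForm R f w k z‖ ≤ 2 * C * (1 + σ) ^ 2 * (1 + ‖z‖) ^ 6 * Q ^ 2 := by
    intro k hk w hw
    refine (hb σ hσ f Q hQ hf hfc hsupp hfQ k hk w z hz).trans ?_
    calc _ ≤ (2 * (1 + ‖z‖) ^ 4) * (C * ((1 + σ) * (1 + ‖z‖)) ^ 2 * Q ^ 2) := by gcongr
      _ = _ := by ring
  have hz0 := norm_nonneg z
  have p4 : ‖z‖ ^ 4 ≤ (1 + ‖z‖) ^ 4 := by gcongr; linarith
  have p2 : ‖z‖ ^ 2 ≤ (1 + ‖z‖) ^ 4 :=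
    calc ‖z‖ ^ 2 ≤ (1 + ‖z‖) ^ 2 := by gcongr; linarith
      _ ≤ _ := pow_le_pow_right₀ (by linarith) (by norm_num)
  have p0 : 1 ≤ (1 + ‖z‖) ^ 4 := one_le_pow₀ (by linarith)
  have k1 := key _ (isKernelFamily_plateKernel hσ) (fun z => z ^ 4 + z ^ 2)
    ((norm_add_le _ _).trans (by rw [norm_pow, norm_pow]; linarith))
  have k2 := fun j => key _ (isKernelFamily_fderiv_plateKernel hσ (norm_stdVec j)) (fun z => z ^ 2)
    (by rw [norm_pow]; linarith)
  have k3 := key _ (isKernelFamily_plateKernelLap hσ) (fun z => z ^ 2 + 1)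
    ((norm_add_le _ _).trans (by rw [norm_pow, norm_one]; linarith))
  have k4 := fun j => key _ (isKernelFamily_fderiv_plateKernelLap hσ (norm_stdVec j)) (fun _ => 1)
    (by rw [norm_one]; linarith)
  have s2 := (norm_sum_le_of_le Finset.univ fun j _ => k2 j)
  have s4 := (norm_sum_le_of_le Finset.univ fun j _ => k4 j)
  simp only [Finset.sum_const, Finset.card_univ, Fintype.card_fin, nsmul_eq_mul] at s2 s4
  rw [boundaryForm, norm_mul, norm_pow, Complex.norm_real, Real.norm_of_nonneg hR.le]
  calc _ ≤ R ^ 2 * (8 * (2 * C * (1 + σ) ^ 2 * (1 + ‖z‖) ^ 6 * Q ^ 2)) := by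
        gcongr
        refine (norm_add_le _ _).trans ((add_le_add_left (norm_add₃_le) _).trans ?_)
        push_cast at s2 s4
        linarith
    _ = _ := by ring

/-! ### Quantitative continuation of the data -/

theorem convex_halfStrip (σ : ℝ) : Convex ℝ (halfStrip σ) := by
  have h1 : Convex ℝ {z : ℂ | 1 < z.re} := convex_halfSpace_re_gt 1
  have h2 : Convex ℝ {z : ℂ | z.im < σ / 2} := convex_halfSpace_im_lt _
  have h3 : Convex ℝ {z : ℂ | -(σ / 2) < z.im} := convex_halfSpace_im_gt _
  convert h1.inter (h3.inter h2) using 1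
  ext z
  simp [halfStrip, abs_lt]

theorem two_mem_halfStrip {σ : ℝ} (hσ : 0 < σ) : (2 : ℂ) ∈ halfStrip σ := by
  simp [halfStrip, hσ]

theorem segment_mem_halfStrip {σ : ℝ} (hσ : 0 < σ) {z : ℂ} (hz : z ∈ halfStrip σ) {t : ℝ}
    (ht : t ∈ Set.Icc (0 : ℝ) 1) : 2 + (t : ℂ) * (z - 2) ∈ halfStrip σ := by
  have := (convex_halfStrip σ).add_smul_sub_mem (two_mem_halfStrip hσ) hz ht
  simpa [Complex.real_smul] using this

theorem norm_segment_le (z : ℂ) {t : ℝ} (ht : t ∈ Set.Icc (0 : ℝ) 1) :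
    ‖2 + (t : ℂ) * (z - 2)‖ ≤ 2 + ‖z‖ := by
  have e : 2 + (t : ℂ) * (z - 2) = ((2 * (1 - t) : ℝ) : ℂ) + (t : ℂ) * z := by
    push_cast; ring
  rw [e]
  refine (norm_add_le _ _).trans ?_
  rw [norm_mul, Complex.norm_real, Complex.norm_real, Real.norm_of_nonneg ht.1,
    Real.norm_of_nonneg (by linarith [ht.2])]
  nlinarith [ht.1, ht.2, norm_nonneg z]

/-- The primitive of `B` vanishing at `2`, as an integral over a segment. -/
noncomputable def segmentPrimitive (B : ℂ → ℂ) (z : ℂ) : ℂ :=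
  (z - 2) * ∫ t in Set.Icc (0 : ℝ) 1, B (2 + (t : ℂ) * (z - 2))

section continuation

variable {σ A : ℝ} {B : ℂ → ℂ}

theorem norm_comp_segment_le (hσ : 0 < σ) (hA : 0 ≤ A)
    (hb : ∀ z ∈ halfStrip σ, ‖B z‖ ≤ A * (1 + ‖z‖) ^ 6) {z : ℂ} (hz : z ∈ halfStrip σ) {t : ℝ}
    (ht : t ∈ Set.Icc (0 : ℝ) 1) : ‖B (2 + (t : ℂ) * (z - 2))‖ ≤ A * (3 + ‖z‖) ^ 6 := by
  refine (hb _ (segment_mem_halfStrip hσ hz ht)).trans ?_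
  gcongr A * ?_ ^ 6
  linarith [norm_segment_le z ht]

theorem continuousOn_comp_segment (hσ : 0 < σ) (hB : DifferentiableOn ℂ B (halfStrip σ)) {z : ℂ}
    (hz : z ∈ halfStrip σ) :
    ContinuousOn (fun t : ℝ => B (2 + (t : ℂ) * (z - 2))) (Set.Icc 0 1) :=
  hB.continuousOn.comp (by fun_prop) fun _ ht => segment_mem_halfStrip hσ hz ht

theorem differentiableOn_segmentPrimitive (hσ : 0 < σ) (hA : 0 ≤ A)
    (hB : DifferentiableOn ℂ B (halfStrip σ))
    (hb : ∀ z ∈ halfStrip σ, ‖B z‖ ≤ A * (1 + ‖z‖) ^ 6) :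
    DifferentiableOn ℂ (segmentPrimitive B) (halfStrip σ) := by
  refine DifferentiableOn.mul (by fun_prop) ?_
  refine differentiableOn_integral_of_dominated (isOpen_halfStrip σ) (fun z hz => ?_) ?_
    fun z₀ hz₀ => ⟨1, one_pos, fun _ => A * (3 + (‖z₀‖ + 1)) ^ 6, integrable_const _, ?_⟩
  · exact (continuousOn_comp_segment hσ hB hz).aestronglyMeasurable measurableSet_Icc
  · filter_upwards [ae_restrict_mem measurableSet_Icc] with t ht
    exact hB.comp (by fun_prop) fun z hz => segment_mem_halfStrip hσ hz ht
  · filter_upwards [ae_restrict_mem measurableSet_Icc] with t ht z hz hz'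
    refine (norm_comp_segment_le hσ hA hb hz' ht).trans ?_
    have h1 : ‖z‖ ≤ ‖z₀‖ + 1 := by
      have := norm_sub_norm_le z z₀
      have := mem_ball_iff_norm.mp hz
      linarith
    gcongr

/-- The constant is `2·3⁶`, from `|z - 2| ≤ 2(1 + |z|)` and `3 + |z| ≤ 3(1 + |z|)`. -/
theorem norm_segmentPrimitive_le (hσ : 0 < σ) (hA : 0 ≤ A)
    (hb : ∀ z ∈ halfStrip σ, ‖B z‖ ≤ A * (1 + ‖z‖) ^ 6) {z : ℂ} (hz : z ∈ halfStrip σ) :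
    ‖segmentPrimitive B z‖ ≤ 1458 * A * (1 + ‖z‖) ^ 7 := by
  have h1 : ‖∫ t in Set.Icc (0 : ℝ) 1, B (2 + (t : ℂ) * (z - 2))‖ ≤ A * (3 + ‖z‖) ^ 6 := by
    have := norm_setIntegral_le_of_norm_le_const (μ := volume) (s := Set.Icc (0 : ℝ) 1)
      (by simp) fun t ht => norm_comp_segment_le hσ hA hb hz ht
    simpa using this
  have h2 : ‖z - 2‖ ≤ 2 * (1 + ‖z‖) := by
    refine (norm_sub_le _ _).trans ?_
    rw [Complex.norm_ofNat]
    linarith [norm_nonneg z]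
  rw [segmentPrimitive, norm_mul]
  calc _ ≤ (2 * (1 + ‖z‖)) * (A * (3 + ‖z‖) ^ 6) := by gcongr
    _ ≤ (2 * (1 + ‖z‖)) * (A * (3 * (1 + ‖z‖)) ^ 6) := by
      gcongr
      linarith [norm_nonneg z]
    _ = _ := by ring

theorem segmentPrimitive_ofReal {g : ℝ → ℝ} (hg : ∀ t : ℝ, 1 < t → B t = (g t : ℂ)) {k : ℝ}
    (hk : 2 ≤ k) : segmentPrimitive B k = ((∫ ω in (2 : ℝ)..k, g ω : ℝ) : ℂ) := by
  have h1 : ∫ t in Set.Icc (0 : ℝ) 1, B (2 + (t : ℂ) * ((k : ℂ) - 2)) =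
      ((∫ t in (0 : ℝ)..1, g (2 + (k - 2) * t) : ℝ) : ℂ) := by
    rw [← intervalIntegral.integral_ofReal, intervalIntegral.integral_of_le zero_le_one,
      ← integral_Icc_eq_integral_Ioc]
    refine setIntegral_congr_fun measurableSet_Icc fun t ht => ?_
    have : 1 < 2 + (k - 2) * t := by nlinarith [ht.1]
    rw [← hg _ this]
    push_cast
    ring_nf
  have h2 := intervalIntegral.smul_integral_comp_add_mul (a := 0) (b := 1) g (k - 2) 2
  rw [mul_zero, add_zero, mul_one, add_sub_cancel, smul_eq_mul] at h2
  rw [segmentPrimitive, h1, ← h2]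
  push_cast
  rfl

/-- This allows the holomorphic `1 + z` to replace `1 + |z|` as the normalising factor. -/
theorem one_add_norm_le {z : ℂ} (hz : 1 < z.re) : 1 + ‖z‖ ≤ 2 * ‖1 + z‖ := by
  have h1 : 1 ≤ ‖1 + z‖ := by
    refine le_trans ?_ (Complex.re_le_norm _)
    simp
    linarith
  have h2 : ‖z‖ ≤ ‖1 + z‖ := by
    apply le_of_sq_le_sq _ (norm_nonneg _)
    rw [Complex.sq_norm, Complex.sq_norm, Complex.normSq_apply, Complex.normSq_apply]
    simp
    nlinarith
  linarith

/-- Two-constants estimate for the primitive of a holomorphic function of polynomial growth,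
nonnegative on the real axis. -/
theorem integral_le_rpow_of_holomorphic (hσ : 0 < σ) (hA : 1 ≤ A)
    (hB : DifferentiableOn ℂ B (halfStrip σ))
    (hb : ∀ z ∈ halfStrip σ, ‖B z‖ ≤ A * (1 + ‖z‖) ^ 6) {g : ℝ → ℝ} (hg0 : ∀ t, 0 ≤ g t)
    (hg : ∀ t : ℝ, 1 < t → B t = (g t : ℂ)) {k : ℝ} (hk : 2 + σ / 2 < k) :
    |∫ ω in (2 : ℝ)..k, g ω| ≤ 186624 * A * (1 + k) ^ 7 *
      √(∫ ω in (2 : ℝ)..(2 + σ / 2), g ω) ^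
        (2 * (1 / 4 * Real.exp (-(Real.pi / (σ / 4) * (k - (2 + σ / 4)))))) := by
  set m := 1 / 4 * Real.exp (-(Real.pi / (σ / 4) * (k - (2 + σ / 4)))) with hm
  have hm0 : 0 < m := by positivity
  set η := ∫ ω in (2 : ℝ)..(2 + σ / 2), g ω with hη
  have hη0 : 0 ≤ η := intervalIntegral.integral_nonneg (by linarith) fun t _ => hg0 t
  have hA0 : 0 ≤ A := by linarith
  have hgc : ContinuousOn g (Set.Ioi 1) := by
    have h1 : ContinuousOn (fun t : ℝ => (B t).re) (Set.Ioi 1) :=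
      Complex.continuous_re.comp_continuousOn (hB.continuousOn.comp
        Complex.continuous_ofReal.continuousOn fun t ht => (by
          have : 1 < t := ht
          simp [halfStrip, hσ, this]))
    refine h1.congr fun t ht => ?_
    simp [hg t ht]
  -- Here `186624 = 1458·2⁷`, the `2⁷` coming from replacing `1 + |z|` by `2|1 + z|`; dividing by
  -- `M(1+z)⁷` makes the primitive at most 1.
  set M := 186624 * A with hM
  have hM1 : 1 ≤ M := by linarith
  set F : ℂ → ℂ := fun z => segmentPrimitive B z / (M * (1 + z) ^ 7) with hF
  have hnz : ∀ z ∈ halfStrip σ, 0 < ‖1 + z‖ := by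
    intro z hz
    have := one_add_norm_le hz.1
    linarith [norm_nonneg z]
  have hnF : ∀ z, ‖F z‖ = ‖segmentPrimitive B z‖ / (M * ‖1 + z‖ ^ 7) := by
    intro z
    simp only [hF]
    rw [norm_div, norm_mul, norm_pow, Complex.norm_real, Real.norm_of_nonneg (by linarith)]
  have hFd : DifferentiableOn ℂ F {z | 1 < z.re ∧ |z.im| < σ / 2} := by
    refine (differentiableOn_segmentPrimitive hσ hA0 hB hb).div (by fun_prop) fun z hz => ?_
    have h1 : 1 + z ≠ 0 := norm_pos_iff.mp (hnz z hz)
    have h2 : (M : ℂ) ≠ 0 := by exact_mod_cast (by linarith : M ≠ 0)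
    exact mul_ne_zero h2 (pow_ne_zero _ h1)
  have hF1 : ∀ z : ℂ, 1 < z.re → |z.im| < σ / 2 → ‖F z‖ ≤ 1 := by
    intro z h1 h2
    have h3 := hnz z ⟨h1, h2⟩
    rw [hnF, div_le_one (by positivity)]
    refine (norm_segmentPrimitive_le hσ hA0 hb ⟨h1, h2⟩).trans ?_
    calc _ ≤ 1458 * A * (2 * ‖1 + z‖) ^ 7 := by
          gcongr
          exact one_add_norm_le h1
      _ = _ := by rw [hM]; ring
  have hreal : ∀ t : ℝ, 2 ≤ t → ‖segmentPrimitive B t‖ = |∫ ω in (2 : ℝ)..t, g ω| := by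
    intro t ht
    rw [segmentPrimitive_ofReal hg ht, Complex.norm_real, Real.norm_eq_abs]
  have hnr : ∀ t : ℝ, 2 ≤ t → ‖(1 : ℂ) + t‖ = 1 + t := by
    intro t ht
    rw [← Complex.ofReal_one, ← Complex.ofReal_add, Complex.norm_real, Real.norm_of_nonneg]
    linarith
  -- Because `g ≥ 0`, the primitive is monotone, so it is controlled on the whole segment by its
  -- value at the end; the denominator is at least 1 because `A ≥ 1`.
  have hsmall : ∀ t : ℝ, 2 ≤ t → t ≤ 2 + 2 * (σ / 4) → ‖F t‖ ≤ η := by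
    intro t ht ht'
    have h1 : ∫ ω in (2 : ℝ)..t, g ω ≤ η := by
      apply intervalIntegral.integral_mono_interval le_rfl ht (by linarith)
        (Filter.Eventually.of_forall hg0)
      apply ContinuousOn.intervalIntegrable
      refine hgc.mono fun x hx => ?_
      rw [Set.uIcc_of_le (by linarith)] at hx
      exact lt_of_lt_of_le (by norm_num) hx.1
    have h2 : 0 ≤ ∫ ω in (2 : ℝ)..t, g ω :=
      intervalIntegral.integral_nonneg (by linarith) fun t _ => hg0 t
    rw [hnF, hreal t ht, hnr t ht, abs_of_nonneg h2]
    refine (div_le_self h2 ?_).trans h1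
    have : 1 ≤ (1 + t) ^ 7 := one_le_pow₀ (by linarith)
    nlinarith
  have hmain : ‖F k‖ ≤ η ^ m := by
    rcases le_or_gt 1 η with h1 | h1
    · refine (hF1 k ?_ ?_).trans (Real.one_le_rpow h1 hm0.le)
      · simp
        linarith
      · simpa using hσ
    -- Since `η` may vanish, its logarithm is avoided: the estimate is applied to each `e` in `(η,
    -- 1)` and `e` decreases to `η`.
    · have hlim : Filter.Tendsto (fun e : ℝ => e ^ m) (nhdsWithin η (Set.Ioi η)) (nhds (η ^ m)) :=
        (Real.continuousAt_rpow_const η m (Or.inr hm0.le)).tendsto.mono_left nhdsWithin_le_nhds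
      refine ge_of_tendsto hlim ?_
      filter_upwards [Ioo_mem_nhdsGT h1] with e he
      have he0 : 0 < e := hη0.trans_lt he.1
      have hl : 0 ≤ -Real.log e := by
        have := Real.log_nonpos he0.le he.2.le
        linarith
      have := norm_le_exp_of_segment (b := σ / 4) (s := σ / 2) (δ := 2) (x₀ := 1) (by linarith)
        (by linarith) (by norm_num) hFd hl hF1 (fun t ht ht' => by
          rw [neg_neg, Real.exp_log he0]
          exact (hsmall t ht ht').trans he.1.le) (k := k) (by linarith)
      rw [Real.rpow_def_of_pos he0]
      refine this.trans (le_of_eq ?_)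
      rw [hm]
      ring_nf
  have hk2 : 2 ≤ k := by linarith
  rw [hnF, hreal k hk2, hnr k hk2, div_le_iff₀ (by positivity)] at hmain
  rw [Real.sqrt_eq_rpow, ← Real.rpow_mul hη0, show 1 / 2 * (2 * m) = m by ring]
  linarith

end continuation

/-! ### Elementary bounds -/

/-- The exponent splits as `4Rσ|κ| + 8R|κ|`. The second part absorbs powers of `k`, since `k ≤
|κ|²`; the first absorbs `(1+σ)²`, since `|κ| ≥ 1`. Thus the constant depends only on `R`. -/
theorem exists_poly_le_exp {R : ℝ} (hR : 0 < R) : ∃ C : ℝ, 0 < C ∧ ∀ σ : ℝ, 0 < σ → ∀ k : ℝ, 1 < k →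
    (1 + σ) ^ 2 * (1 + k) ^ 7 ≤ C * Real.exp (4 * R * (σ + 2) * ‖plateKappa σ k‖) := by
  refine ⟨(2 + 4 / (4 * R) ^ 2) * (2 ^ 7 * (Nat.factorial 14 / (8 * R) ^ 14)), by positivity,
    fun σ hσ k hk => ?_⟩
  have h := (plateKappa_facts hσ hk).2
  set q := ‖plateKappa σ k‖
  have hs : 1 ≤ √k := Real.one_le_sqrt.mpr hk.le
  have hq : 1 ≤ q := hs.trans h
  have hkq : k ≤ q ^ 2 := by
    rw [← Real.sq_sqrt (by linarith : 0 ≤ k)]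
    gcongr
  -- From `1 + k ≤ 2q²` the left side is at most `2⁷q¹⁴`, and `x¹⁴/14! ≤ eˣ` is used at `x = 8Rq`.
  have e1 : (1 + k) ^ 7 ≤ 2 ^ 7 * (Nat.factorial 14 / (8 * R) ^ 14) * Real.exp (8 * R * q) := by
    have h1 := Real.pow_div_factorial_le_exp (x := 8 * R * q) (by positivity) 14
    rw [div_le_iff₀ (by positivity)] at h1
    calc (1 + k) ^ 7 ≤ (2 * q ^ 2) ^ 7 := by
          gcongr
          nlinarith
      _ = 2 ^ 7 * (8 * R * q) ^ 14 / (8 * R) ^ 14 := by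
        field_simp
      _ ≤ 2 ^ 7 * (Real.exp (8 * R * q) * Nat.factorial 14) / (8 * R) ^ 14 := by gcongr
      _ = _ := by ring
  have e2 : (1 + σ) ^ 2 ≤ (2 + 4 / (4 * R) ^ 2) * Real.exp (4 * R * σ * q) := by
    have h1 := Real.pow_div_factorial_le_exp (x := 4 * R * σ) (by positivity) 2
    rw [div_le_iff₀ (by positivity)] at h1
    have h2 : Real.exp (4 * R * σ) ≤ Real.exp (4 * R * σ * q) := by
      apply Real.exp_le_exp.mpr
      exact le_mul_of_one_le_right (by positivity) hq
    have h3 : 1 ≤ Real.exp (4 * R * σ) := Real.one_le_exp (by positivity)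
    calc (1 + σ) ^ 2 ≤ 2 * 1 + 2 * ((4 * R * σ) ^ 2 / (4 * R) ^ 2) := by
          have : (4 * R * σ) ^ 2 / (4 * R) ^ 2 = σ ^ 2 := by field_simp
          rw [this]
          nlinarith [sq_nonneg (1 - σ)]
      _ ≤ 2 * Real.exp (4 * R * σ) + 2 * ((Real.exp (4 * R * σ) * Nat.factorial 2) / (4 * R) ^ 2) := by
        gcongr
      _ = (2 + 4 / (4 * R) ^ 2) * Real.exp (4 * R * σ) := by
        simp only [Nat.factorial]
        push_cast
        ring
      _ ≤ _ := by gcongr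
  calc _ ≤ ((2 + 4 / (4 * R) ^ 2) * Real.exp (4 * R * σ * q)) *
        (2 ^ 7 * (Nat.factorial 14 / (8 * R) ^ 14) * Real.exp (8 * R * q)) := by gcongr
    _ = (2 + 4 / (4 * R) ^ 2) * (2 ^ 7 * (Nat.factorial 14 / (8 * R) ^ 14)) *
        (Real.exp (4 * R * σ * q) * Real.exp (8 * R * q)) := by ring
    _ = _ := by
      rw [← Real.exp_add]
      congr 2
      ring

/-- With `a = 2b` and `d = b/4` the prescribed rate `π/(2d)` is `2π/b`, twice the rate obtained. The
prefactor is at most 1, and for `k > 2 + 2b` the excess decay is at least `e^{-2}`-small, which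
yields the factor `1/4`. -/
theorem harmonic_measure_lower_bound {b k : ℝ} (hb : 0 < b) (hk : 2 + 2 * b < k) :
    64 * (2 + 2 * b - 2) * (b / 4) /
        (3 * Real.pi ^ 2 * ((2 + 2 * b - 2) ^ 2 + 4 * (b / 4) ^ 2)) *
      Real.exp (Real.pi / (2 * (b / 4)) * ((2 + 2 * b - 2) / 2 - k)) ≤
    1 / 4 * Real.exp (-(Real.pi / b * (k - (2 + b)))) := by
  have hpi := Real.pi_gt_three
  have h1 : 64 * (2 + 2 * b - 2) * (b / 4) /
      (3 * Real.pi ^ 2 * ((2 + 2 * b - 2) ^ 2 + 4 * (b / 4) ^ 2)) ≤ 1 := by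
    rw [div_le_one (by
      have : 0 < (2 + 2 * b - 2) ^ 2 + 4 * (b / 4) ^ 2 := by positivity
      positivity)]
    have : 9 ≤ Real.pi ^ 2 := by nlinarith
    nlinarith [mul_le_mul_of_nonneg_right this (sq_nonneg b)]
  have h2 : Real.pi / (2 * (b / 4)) * ((2 + 2 * b - 2) / 2 - k) ≤
      -2 + -(Real.pi / b * (k - (2 + b))) := by
    have h3 : Real.pi / (2 * (b / 4)) * ((2 + 2 * b - 2) / 2 - k) =
        -(Real.pi * ((k + 2 - b) / b)) + -(Real.pi / b * (k - (2 + b))) - 0 := by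
      field_simp
      ring
    have h4 : 1 ≤ (k + 2 - b) / b := by
      rw [one_le_div hb]
      linarith
    have : 3 * 1 ≤ Real.pi * ((k + 2 - b) / b) := by gcongr
    linarith
  have h5 : Real.exp (-2) ≤ 1 / 4 := by
    rw [Real.exp_neg, one_div]
    apply inv_anti₀ (by norm_num)
    have := Real.add_one_le_exp 1
    calc (4 : ℝ) ≤ Real.exp 1 * Real.exp 1 := by nlinarith
      _ = Real.exp 2 := by rw [← Real.exp_add]; norm_num
  calc _ ≤ 1 * Real.exp (-2 + -(Real.pi / b * (k - (2 + b)))) := by gcongr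
    _ = Real.exp (-2) * Real.exp (-(Real.pi / b * (k - (2 + b)))) := by rw [one_mul, Real.exp_add]
    _ ≤ _ := by gcongr

/-! ### The stability estimate -/

theorem mainTheorem9 (R : ℝ) (hR : 0 < R) :
    ∃ C : ℝ, 0 < C ∧ ∀ σ : ℝ, 0 < σ →
      ∃ d δ K : ℝ, 0 < d ∧ 0 < δ ∧ δ < K ∧
        ∃ μ : ℝ → ℝ,
          (∀ k : ℝ, K < k →
            64 * (K - δ) * d / (3 * Real.pi ^ 2 * ((K - δ) ^ 2 + 4 * d ^ 2))
                * Real.exp (Real.pi / (2 * d) * ((K - δ) / 2 - k)) ≤ μ k) ∧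
          ∀ (Q : ℝ) (f : Space3 → ℝ) (u : ℝ → Space3 → ℂ),
            1 ≤ Q →
            MemLp f 2 volume →
            HasCompactSupport f →
            tsupport f ⊆ Metric.ball 0 R →
            eLpNorm f 2 (volume.restrict (Metric.ball (0 : Space3) R)) ≤ ENNReal.ofReal Q →
            (∀ k : ℝ, 0 < k → IsPlateSolution σ k f (u k)) →
            ∀ k : ℝ, K < k →
              |dataIntegral R δ u k| ≤
                C * Q ^ 2 * Real.exp (4 * R * (σ + 2) * ‖plateKappa σ k‖)
                  * Real.sqrt (dataIntegral R δ u K) ^ (2 * μ k) := by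
  obtain ⟨C₁, hC₁, hb⟩ := exists_norm_boundaryForm_le hR
  obtain ⟨C₂, hC₂, hexp⟩ := exists_poly_le_exp hR
  -- The continuation uses `b = σ/4`, so that the triangles stay in the strip of half-width `σ/2`;
  -- thus `δ = 2`, `K = 2 + 2b`, and `d = b/4` makes the required bound on `μ` weak enough. Using `1
  -- + C₁` in place of `C₁`, together with `Q ≥ 1`, ensures that the growth constant is at least 1.
  refine ⟨186624 * (1 + C₁) * C₂, by positivity, fun σ hσ =>
    ⟨σ / 4 / 4, 2, 2 + 2 * (σ / 4), by positivity, by norm_num, by linarith,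
      fun k => 1 / 4 * Real.exp (-(Real.pi / (σ / 4) * (k - (2 + σ / 4)))),
      fun k hk => harmonic_measure_lower_bound (by positivity) hk, ?_⟩⟩
  intro Q f u hQ hf hfc hsupp hfQ hu k hk
  have hfi := integrable_of_memLp_two hf hfc
  rw [show 2 + 2 * (σ / 4) = 2 + σ / 2 by ring] at hk ⊢
  have hA : 1 ≤ (1 + C₁) * Q ^ 2 * (1 + σ) ^ 2 :=
    one_le_mul_of_one_le_of_one_le
      (one_le_mul_of_one_le_of_one_le (by linarith) (one_le_pow₀ hQ)) (one_le_pow₀ (by linarith))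
  have hk1 : 1 < k := by linarith
  refine (integral_le_rpow_of_holomorphic hσ hA (differentiableOn_boundaryForm hR hσ hfi hfc hsupp)
    (fun z hz => (hb σ hσ f Q (by linarith) hfi hfc hsupp hfQ z hz).trans ?_)
    (fun t => boundaryNormSq_nonneg R t (u t))
    (fun t ht => boundaryForm_ofReal hR hσ hfi hfc hsupp ht (hu t (by linarith))) hk).trans ?_
  · gcongr
    linarith
  · have h := hexp σ hσ k hk1
    simp only [dataIntegral]
    gcongr ?_ * _
    calc _ = 186624 * (1 + C₁) * Q ^ 2 * ((1 + σ) ^ 2 * (1 + k) ^ 7) := by ring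
      _ ≤ 186624 * (1 + C₁) * Q ^ 2 *
          (C₂ * Real.exp (4 * R * (σ + 2) * ‖plateKappa σ k‖)) := by gcongr
      _ = _ := by ring
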